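/- **Theorem (unconditional first-order convergence of the IMEX Euler scheme).** Let $d\in\{2,3\}$, let $\Omega\subset\mathbb R^d$ be open and bounded, and let $\alpha\in(0,1)$, $\nu>0$, $\gamma\ge 0$, $T>0$. Put $$|||v|||_\alpha^2=\int_{\mathbb R^d}\int_{\mathbb R^d}\frac{|v(x)-v(y)|^2}{|x-y|^{d+2\alpha}}\,dy\,dx,\qquad C_{d,\alpha}=\frac{\alpha\,2^{2\alpha}\,\Gamma(\frac{d+2\alpha}{2})}{\pi^{d/2}\,\Gamma(1-\alpha)},$$ $$X=\{v\in H^\alpha(\mathbb R^d)^d\cap H^1(\mathbb R^d)^d:\ v=0 \text{ a.e. in } \mathbb R^d\setminus\Omega\},\qquad Q=\Big\{q\in L^2(\Omega):\int_\Omega q\,dx=0\Big\},$$ and, for $w,u,v\in X$ and $q\in Q$, $$A(w;u,q;v)=\int_\Omega (w\cdot\nabla)u\cdot v\,dx+\nu\int_\Omega\nabla u:\nabla v\,dx+\gamma\frac{C_{d,\alpha}}2\int_{\mathbb R^d}\int_{\mathbb R^d}\frac{(u(x)-u(y))\cdot(v(x)-v(y))}{|x-y|^{d+2\alpha}}\,dy\,dx-\int_\Omega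 q\,\nabla\cdot v\,dx .$$ *Exact problem.* Let $u_0\in L^2(\Omega)^d$, let $f(t)\in L^2(\Omega)^d$ be given for all $t$, and let $(u,p)$ be a solution of $$u_t+(u\cdot\nabla)u-\nu\Delta u+\gamma(-\Delta)^\alpha u+\nabla p=f,\quad \nabla\cdot u=0\ \text{ in }(0,T]\times\Omega,\qquad u=0\ \text{ in }\mathbb R^d\setminus\Omega,\qquad u(0)=u_0\ \text{ in }\Omega,$$ in the following sense: $u(t)\in X$ for all $t\in[0,T]$, $p(t)\in Q$ for all $t\in(0,T]$, $u\in C([0,T];L^2(\Omega))$, $u(0)=u_0$ in $\Omega$, and for every $t\in(0,T]$ the derivative $u_t(t)$ exists in $L^2(\Omega)$, $\nabla\cdot u(t)=0$ a.e. in $\Omega$, and $$\int_\Omega u_t(t)\cdot v\,dx+A(u(t);u(t),p(t);v)=\int_\Omega f(t)\cdot v\,dx\qquad\forall v\in X .$$ Assume that $$u\in L^\infty(0,T;H^1(\Omega))\cap H^2(0,T;L^2(\Omega)),\qquad p\in L^2(0,T;H^1(\Omega)),\qquad f\in L^2(0,T;L^2(\Omega)).$$ *Scheme.* For a time step $\Delta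 t>0$ put $t_n=n\Delta t$. $N$ steps of the IMEX Euler scheme $$\frac{u^{n+1}-u^n}{\Delta t}+(u^n\cdot\nabla)u^{n+1}-\nu\Delta u^{n+1}+\gamma(-\Delta)^\alpha u^{n+1}+\nabla p^{n+1}=f(t_{n+1}),\qquad \nabla\cdot u^{n+1}=0\quad\text{in }\Omega$$ consist of $u^0,\dots,u^N\in X$ and $p^1,\dots,p^N\in Q$ with $u^0=u_0$ in $\Omega$ and, for $0\le n<N$, $\nabla\cdot u^{n+1}=0$ a.e. in $\Omega$ and $$\int_\Omega\frac{u^{n+1}-u^n}{\Delta t}\cdot v\,dx+A(u^n;u^{n+1},p^{n+1};v)=\int_\Omega f(t_{n+1})\cdot v\,dx\qquad\forall v\in X .$$ *Conclusion.* There is a constant $C>0$, independent of $\Delta t$, of $N$ and of the discrete solution, such that for every $\Delta t>0$, every integer $N\ge0$ with $t_N\le T$, and all $N$ steps $(u^n)_{0\le n\le N}$, $(p^n)_{1\le n\le N}$ of the scheme, the errors $e^n=u(t_n)-u^n$ satisfy $$\frac12\|e^N\|_{L^2(\Omega)}^2+\frac18\Delta t\,\nu\|\nabla e^N\|_{L^2(\Omega)}^2+\frac12\sum_{n=0}^{N-1}\|e^{n+1}-e^n\|_{L^2(\Omega)}^2+\frac12\Delta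 t\sum_{n=0}^{N-1}\nu\|\nabla e^{n+1}\|_{L^2(\Omega)}^2+\Delta t\sum_{n=0}^{N-1}\gamma\frac{C_{d,\alpha}}2|||e^{n+1}|||_\alpha^2\le C\,\Delta t^2 .$$ -/

import Mathlib

open MeasureTheory Set
open scoped ContDiff ENNReal

noncomputable section

namespace FracNS

/-- Euclidean space `ℝᵈ`. -/
abbrev Rd (d : ℕ) := EuclideanSpace ℝ (Fin d)

/-- Vector fields in `L²(ℝᵈ; ℝᵈ)`. -/
abbrev L2Vec (d : ℕ) := Lp (Rd d) 2 (volume : Measure (Rd d))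

/-- `L²(Ω; F)`. -/
abbrev L2On {d : ℕ} (Ω : Set (Rd d)) (F : Type) [NormedAddCommGroup F] :=
  Lp F 2 ((volume : Measure (Rd d)).restrict Ω)

/-- Restriction of a vector field on `ℝᵈ` to `Ω`, as a map `L²(ℝᵈ; ℝᵈ) → L²(Ω; ℝᵈ)`. -/
def restr {d : ℕ} (Ω : Set (Rd d)) : L2Vec d →L[ℝ] L2On Ω (Rd d) :=
  LpToLpRestrictCLM (Rd d) (Rd d) ℝ volume 2 Ω

/-! ### Weak derivatives in space -/

/-- `g` is the weak partial derivative `∂ⱼ v` on the open set `Ω`. -/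
def HasWeakPartial {d : ℕ} {F : Type} [NormedAddCommGroup F] [NormedSpace ℝ F]
    (Ω : Set (Rd d)) (j : Fin d) (v g : Rd d → F) : Prop :=
  ∀ φ : Rd d → ℝ, ContDiff ℝ ∞ φ → HasCompactSupport φ → tsupport φ ⊆ Ω →
    ∫ x in Ω, fderiv ℝ φ x (EuclideanSpace.single j 1) • v x = -∫ x in Ω, φ x • g x

/-- `v ∈ H¹(ℝᵈ; ℝᵈ)`. -/
def MemH1 {d : ℕ} (v : Rd d → Rd d) : Prop :=
  MemLp v 2 volume ∧ ∀ j, ∃ g : Rd d → Rd d, MemLp g 2 volume ∧ HasWeakPartial univ j v g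

open Classical in
/-- The weak partial derivative `∂ⱼ v` on `ℝᵈ` (zero if there is none in `L²`). It is unique up to
null sets. -/
def partialD {d : ℕ} (j : Fin d) (v : Rd d → Rd d) : Rd d → Rd d :=
  if h : ∃ g : Rd d → Rd d, MemLp g 2 volume ∧ HasWeakPartial univ j v g then h.choose else 0

/-- The divergence `∇ · v = ∑ⱼ (∂ⱼ v)ⱼ`. -/
def divergence {d : ℕ} (v : Rd d → Rd d) (x : Rd d) : ℝ := ∑ j, partialD j v x j

/-! ### The spaces of velocities and pressures -/

/-- `v ∈ H^α(ℝᵈ; ℝᵈ)` (the fractional Sobolev space `W^{α,2}`). -/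
def MemHalpha {d : ℕ} (α : ℝ) (v : Rd d → Rd d) : Prop :=
  MemLp v 2 volume ∧
  MemLp (fun z : Rd d × Rd d => ‖v z.1 - v z.2‖ / ‖z.1 - z.2‖ ^ ((d : ℝ) / 2 + α)) 2 volume

/-- The velocity space `X = H^α_Ω(ℝᵈ) ∩ H¹_Ω(ℝᵈ)`, where the subscript `Ω` means vanishing
in `ℝᵈ \ Ω`. -/
def velocitySpace {d : ℕ} (Ω : Set (Rd d)) (α : ℝ) : Set (L2Vec d) :=
  {v | MemHalpha α v ∧ MemH1 v ∧ ∀ᵐ x ∂(volume : Measure (Rd d)), x ∉ Ω → v x = 0}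

/-- The pressure space `Q = L²₀(Ω)`. -/
def pressureSpace {d : ℕ} (Ω : Set (Rd d)) : Set (L2On Ω ℝ) :=
  {q | ∫ x in Ω, q x = 0}

/-! ### Norms and forms -/

/-- `∫_Ω v · w`. -/
def l2Form {d : ℕ} (Ω : Set (Rd d)) (v w : Rd d → Rd d) : ℝ := ∫ x in Ω, inner ℝ (v x) (w x)

/-- `∫_Ω ∇v : ∇w`. -/
def gradForm {d : ℕ} (Ω : Set (Rd d)) (v w : Rd d → Rd d) : ℝ :=
  ∫ x in Ω, ∑ j, inner ℝ (partialD j v x) (partialD j w x)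

/-- `b_Ω(u, v, w) = ∫_Ω (u · ∇) v · w`. -/
def triForm {d : ℕ} (Ω : Set (Rd d)) (u v w : Rd d → Rd d) : ℝ :=
  ∫ x in Ω, ∑ j, u x j * inner ℝ (partialD j v x) (w x)

/-- `∫∫ (v(x) - v(y)) · (w(x) - w(y)) / |x - y|^{d+2α} dy dx` over `ℝᵈ × ℝᵈ`. -/
def gagliardoForm {d : ℕ} (α : ℝ) (v w : Rd d → Rd d) : ℝ :=
  ∫ x, ∫ y, inner ℝ (v x - v y) (w x - w y) / ‖x - y‖ ^ ((d : ℝ) + 2 * α)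

/-- `‖v‖²_{L²(Ω)}`. -/
def l2NormSq {d : ℕ} (Ω : Set (Rd d)) (v : Rd d → Rd d) : ℝ := ∫ x in Ω, ‖v x‖ ^ 2

/-- `‖∇v‖²_{L²(Ω)}`. -/
def gradNormSq {d : ℕ} (Ω : Set (Rd d)) (v : Rd d → Rd d) : ℝ :=
  ∫ x in Ω, ∑ j, ‖partialD j v x‖ ^ 2

/-- The square of the Gagliardo seminorm on `ℝᵈ`. -/
def gagliardoSq {d : ℕ} (α : ℝ) (v : Rd d → Rd d) : ℝ :=
  ∫ x, ∫ y, ‖v x - v y‖ ^ 2 / ‖x - y‖ ^ ((d : ℝ) + 2 * α)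

/-- The normalizing constant `C_{d,α}` for which `(-Δ)^α u (x) = C_{d,α} ∫ (u(x) - u(y)) /
|x - y|^{d+2α} dy` (principal value) has the Fourier symbol `|ξ|^{2α}`. -/
def fracConst (d : ℕ) (α : ℝ) : ℝ :=
  α * 2 ^ (2 * α) * Real.Gamma (((d : ℝ) + 2 * α) / 2) /
    (Real.pi ^ ((d : ℝ) / 2) * Real.Gamma (1 - α))

/-- `(w · ∇) u - ν Δu + γ (-Δ)^α u + ∇p`, in weak form, applied to the test function `v`. -/
def spatialForm {d : ℕ} (Ω : Set (Rd d)) (α ν γ : ℝ) (w u : Rd d → Rd d) (p : Rd d → ℝ)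
    (v : Rd d → Rd d) : ℝ :=
  triForm Ω w u v + ν * gradForm Ω u v + γ * (fracConst d α / 2) * gagliardoForm α u v
    - ∫ x in Ω, p x * divergence v x

/-! ### Bochner–Sobolev regularity in time -/

/-- `V` is the weak derivative of `U` on the time interval `(0, T)`. -/
def HasWeakTimeDeriv {B : Type} [NormedAddCommGroup B] [NormedSpace ℝ B]
    (T : ℝ) (U V : ℝ → B) : Prop :=
  ∀ φ : ℝ → ℝ, ContDiff ℝ ∞ φ → HasCompactSupport φ → tsupport φ ⊆ Ioo 0 T →
    ∫ t in Ioo 0 T, deriv φ t • U t = -∫ t in Ioo 0 T, φ t • V t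

/-- `U ∈ H^k(0, T; B)`. -/
def MemTimeHk {B : Type} [NormedAddCommGroup B] [NormedSpace ℝ B] (T : ℝ) :
    ℕ → (ℝ → B) → Prop
  | 0, U => MemLp U 2 (volume.restrict (Ioo 0 T))
  | k + 1, U => MemLp U 2 (volume.restrict (Ioo 0 T)) ∧
      ∃ V : ℝ → B, HasWeakTimeDeriv T U V ∧ MemTimeHk T k V

/-- `U ∈ L^q(0, T; H¹(Ω; F))`. -/
def MemTimeLqH1 {d : ℕ} {F : Type} [NormedAddCommGroup F] [NormedSpace ℝ F]
    (Ω : Set (Rd d)) (T : ℝ) (q : ℝ≥0∞) (U : ℝ → L2On Ω F) : Prop :=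
  MemLp U q (volume.restrict (Ioo 0 T)) ∧
  ∀ j : Fin d, ∃ G : ℝ → L2On Ω F, MemLp G q (volume.restrict (Ioo 0 T)) ∧
    ∀ᵐ t ∂(volume.restrict (Ioo 0 T)), HasWeakPartial Ω j (U t) (G t)

/-! ### The exact problem and the scheme -/

/-- `(u, p)` solves, on `(0, T] × Ω`,
`u_t + (u·∇)u - νΔu + γ(-Δ)^α u + ∇p = f`, `∇·u = 0`, with `u = 0` in `ℝᵈ \ Ω` and `u(0) = u₀`
in `Ω`. At every time the momentum equation is understood in weak form, with test functions in the
velocity space; `u_t` is the time derivative in `L²(Ω)`. -/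
structure IsExactSolution {d : ℕ} (Ω : Set (Rd d)) (α ν γ T : ℝ)
    (f : ℝ → L2On Ω (Rd d)) (u₀ : L2On Ω (Rd d))
    (u : ℝ → L2Vec d) (p : ℝ → L2On Ω ℝ) : Prop where
  mem_velocity : ∀ t ∈ Icc 0 T, u t ∈ velocitySpace Ω α
  mem_pressure : ∀ t ∈ Ioc 0 T, p t ∈ pressureSpace Ω
  continuous : ContinuousOn (fun t => restr Ω (u t)) (Icc 0 T)
  initial : restr Ω (u 0) = u₀
  momentum : ∀ t ∈ Ioc 0 T, ∃ u' : L2On Ω (Rd d),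
    HasDerivWithinAt (fun s => restr Ω (u s)) u' (Icc 0 T) t ∧
    ∀ v ∈ velocitySpace Ω α,
      l2Form Ω u' v + spatialForm Ω α ν γ (u t) (u t) (p t) v = l2Form Ω (f t) v
  incompressible : ∀ t ∈ Ioc 0 T, ∀ᵐ x ∂(volume.restrict Ω), divergence (u t) x = 0

/-- `U 0, …, U N` and `P 1, …, P N` are produced by `N` steps of the IMEX Euler scheme with time
step `Δt`, started at `u₀`:
`(uⁿ⁺¹ - uⁿ)/Δt + (uⁿ·∇)uⁿ⁺¹ - νΔuⁿ⁺¹ + γ(-Δ)^α uⁿ⁺¹ + ∇pⁿ⁺¹ = f(tₙ₊₁)`, `∇·uⁿ⁺¹ = 0` in `Ω`. -/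
structure IsIMEXEuler {d : ℕ} (Ω : Set (Rd d)) (α ν γ Δt : ℝ)
    (f : ℝ → L2On Ω (Rd d)) (u₀ : L2On Ω (Rd d)) (N : ℕ)
    (U : ℕ → L2Vec d) (P : ℕ → L2On Ω ℝ) : Prop where
  mem_velocity : ∀ n ≤ N, U n ∈ velocitySpace Ω α
  mem_pressure : ∀ n < N, P (n + 1) ∈ pressureSpace Ω
  initial : restr Ω (U 0) = u₀
  momentum : ∀ n < N, ∀ v ∈ velocitySpace Ω α,
    l2Form Ω (Δt⁻¹ • (U (n + 1) - U n) : L2Vec d) v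
      + spatialForm Ω α ν γ (U n) (U (n + 1)) (P (n + 1)) v
      = l2Form Ω (f (((n : ℝ) + 1) * Δt)) v
  incompressible : ∀ n < N, ∀ᵐ x ∂(volume.restrict Ω), divergence (U (n + 1)) x = 0

/-- The error `eⁿ = u(tₙ) - uⁿ`, `tₙ = n Δt`. -/
def err {d : ℕ} (u : ℝ → L2Vec d) (U : ℕ → L2Vec d) (Δt : ℝ) (n : ℕ) : L2Vec d :=
  u ((n : ℝ) * Δt) - U n

end FracNS

end

noncomputable section

open Filter Topology
open scoped NNReal Convolution

namespace FracNS

/-! Write `uₙ` for the exact solution at `tₙ`, `Uₙ` for the discrete one and `eₙ` for the error.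
Subtract the scheme from the exact equation at `tₙ₊₁` and test with `eₙ₊₁`. The pressures disappear
because `eₙ₊₁` is divergence free, and the local and fractional diffusion give the dissipation. The
convective terms differ by `(uₙ₊₁ - uₙ)·∇uₙ₊₁ + eₙ·∇uₙ₊₁ + Uₙ·∇eₙ₊₁`; tested with `eₙ₊₁`, the last
one vanishes, as `Uₙ` is solenoidal (`tri_self_eq_zero`). This is `error_energy_identity`.

Three terms remain. The consistency error of the difference quotient is controlled by the integral
of the second time derivative over one step. The term with `eₙ` is bounded by Hölder with exponents
3, 2, 6, by Sobolev and by interpolating L³ between L² and L⁶; Young's inequality then leaves a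
multiple of `‖eₙ‖²` and one eighth of the dissipation at the old level. Only old-level quantities
are left on the right (`energy_step`), so `discrete_gronwall` applies to an explicit recursion and
no restriction on the time step arises.

The delicate term is the one with `uₙ₊₁ - uₙ`. It needs the sum of the squared L³ norms of the
increments to be of order `Δt`, while the time derivative is only known to lie in L² in space. The
remedy is a discrete Gagliardo–Nirenberg inequality in time (`sum_nrm_three_sq_le`): a bound in L⁶
and smallness of the second differences in L² together control the first differences in L³. It rests
on summation by parts in the sum of `|D|D·D`, where `D` is the increment. Combined with the H²
regularity in time it yields `exists_increment_bound`.

The rest is groundwork: mollification, the Sobolev inequality for weak derivatives, weak derivatives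
in time, and the passage from bounds at almost every time to bounds at every node
(`exists_gradient_bound`). -/

section
variable {d : ℕ}

/-! ### Mollification in L² -/

/-- The standard sequence of bump functions shrinking to the origin. -/
def bump (d k : ℕ) : ContDiffBump (0 : Rd d) where
  rIn := 1 / (2 * ((k : ℝ) + 1))
  rOut := 1 / ((k : ℝ) + 1)
  rIn_pos := by positivity
  rIn_lt_rOut := by
    apply one_div_lt_one_div_of_lt <;> linarith [(Nat.cast_nonneg k : (0 : ℝ) ≤ k)]

/-- The standard mollifier kernels. -/
def moll {F : Type} [NormedAddCommGroup F] [NormedSpace ℝ F] (k : ℕ) (f : Rd d → F) : Rd d → F :=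
  (bump d k).normed volume ⋆[ContinuousLinearMap.lsmul ℝ ℝ, volume] f

variable {F : Type} [NormedAddCommGroup F] [NormedSpace ℝ F]

lemma moll_apply (k : ℕ) (f : Rd d → F) (x : Rd d) :
    moll k f x = ∫ y, (bump d k).normed volume y • f (x - y) := by
  simp [moll, convolution]

lemma moll_apply_swap (k : ℕ) (f : Rd d → F) (x : Rd d) :
    moll k f x = ∫ y, (bump d k).normed volume (x - y) • f y := by
  simp [moll, convolution_eq_swap]

lemma lintegral_bump_normed (k : ℕ) :
    ∫⁻ y, ‖(bump d k).normed volume y‖ₑ = 1 := by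
  have h := (bump d k).integral_normed (μ := (volume : Measure (Rd d)))
  have h2 : ∀ y, ‖(bump d k).normed volume y‖ₑ = ENNReal.ofReal ((bump d k).normed volume y) :=
    fun y => by rw [Real.enorm_eq_ofReal ((bump d k).nonneg_normed y)]
  simp_rw [h2]
  rw [← ofReal_integral_eq_lintegral_ofReal (bump d k).integrable_normed
    (Eventually.of_forall (bump d k).nonneg_normed), h, ENNReal.ofReal_one]

lemma eLpNorm_two_sq {X G : Type*} [MeasurableSpace X] [NormedAddCommGroup G] (μ : Measure X)
    (f : X → G) : eLpNorm f 2 μ ^ 2 = ∫⁻ x, ‖f x‖ₑ ^ 2 ∂μ := by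
  have := eLpNorm_nnreal_pow_eq_lintegral (μ := μ) (f := f) (p := 2) (by norm_num)
  have h2 : ((2 : ℝ≥0) : ℝ≥0∞) = 2 := by norm_num
  rw [h2] at this
  simpa using this

/-- Young's convolution inequality for a kernel of mass one: Cauchy–Schwarz against the probability
density moves the square under the integral, and Tonelli with translation invariance finishes. -/
lemma eLpNorm_moll_le (k : ℕ) {f : Rd d → F} (hf : AEStronglyMeasurable f volume) :
    eLpNorm (moll k f) 2 volume ≤ eLpNorm f 2 volume := by
  set ρ := (bump d k).normed (volume : Measure (Rd d)) with hρ
  have hρc : Continuous ρ := (bump d k).continuous_normed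
  have hρm : Measurable fun y => ‖ρ y‖ₑ := hρc.measurable.enorm
  have hsub : ∀ x : Rd d, AEStronglyMeasurable (fun y => f (x - y)) volume := fun x =>
    hf.comp_quasiMeasurePreserving (quasiMeasurePreserving_sub_left volume x)
  have key : ∀ x, ‖moll k f x‖ₑ ^ 2 ≤ ∫⁻ y, ‖ρ y‖ₑ * ‖f (x - y)‖ₑ ^ 2 := by
    intro x
    have h1 : ‖moll k f x‖ₑ ≤ ∫⁻ y, ‖ρ y‖ₑ * ‖f (x - y)‖ₑ := by
      rw [moll_apply]
      refine (enorm_integral_le_lintegral_enorm _).trans (le_of_eq ?_)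
      simp_rw [enorm_smul]; rfl
    have h2 := ENNReal.lintegral_mul_norm_pow_le (μ := (volume : Measure (Rd d)))
      (f := fun y => ‖ρ y‖ₑ) (g := fun y => ‖ρ y‖ₑ * ‖f (x - y)‖ₑ ^ 2)
      hρm.aemeasurable (hρm.aemeasurable.mul ((hsub x).enorm.pow_const 2))
      (p := 1 / 2) (q := 1 / 2) (by norm_num) (by norm_num) (by norm_num)
    have h3 : ∀ y, ‖ρ y‖ₑ ^ (1 / 2 : ℝ) * (‖ρ y‖ₑ * ‖f (x - y)‖ₑ ^ 2) ^ (1 / 2 : ℝ)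
        = ‖ρ y‖ₑ * ‖f (x - y)‖ₑ := by
      intro y
      rw [ENNReal.mul_rpow_of_nonneg _ _ (by norm_num), ← mul_assoc, ← ENNReal.rpow_add_of_nonneg _ _
        (by norm_num) (by norm_num), ← ENNReal.rpow_natCast, ← ENNReal.rpow_mul]
      norm_num
    simp_rw [h3] at h2
    rw [lintegral_bump_normed, ENNReal.one_rpow, one_mul] at h2
    calc ‖moll k f x‖ₑ ^ 2 ≤ ((∫⁻ y, ‖ρ y‖ₑ * ‖f (x - y)‖ₑ ^ 2) ^ (1 / 2 : ℝ)) ^ 2 := by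
          gcongr; exact h1.trans h2
      _ = _ := by
          rw [← ENNReal.rpow_natCast, ← ENNReal.rpow_mul]; norm_num
  have hsq : eLpNorm (moll k f) 2 volume ^ 2 ≤ eLpNorm f 2 volume ^ 2 := by
    rw [eLpNorm_two_sq, eLpNorm_two_sq]
    calc ∫⁻ x, ‖moll k f x‖ₑ ^ 2 ≤ ∫⁻ x, ∫⁻ y, ‖ρ y‖ₑ * ‖f (x - y)‖ₑ ^ 2 := lintegral_mono key
      _ = ∫⁻ y, ∫⁻ x, ‖ρ y‖ₑ * ‖f (x - y)‖ₑ ^ 2 := by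
          apply lintegral_lintegral_swap
          refine AEMeasurable.mul (hρm.comp measurable_snd).aemeasurable ?_
          refine AEMeasurable.pow_const ?_ 2
          refine AEStronglyMeasurable.enorm ?_
          exact hf.comp_quasiMeasurePreserving
            (quasiMeasurePreserving_sub_of_right_invariant volume volume)
      _ = ∫⁻ y, ‖ρ y‖ₑ * ∫⁻ x, ‖f x‖ₑ ^ 2 := by
          refine lintegral_congr fun y => ?_
          rw [lintegral_const_mul' _ _ enorm_ne_top]
          congr 1
          exact lintegral_sub_right_eq_self (fun x => ‖f x‖ₑ ^ 2) y
      _ = _ := by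
          rw [lintegral_mul_const _ hρm, lintegral_bump_normed, one_mul]
  exact (ENNReal.pow_right_strictMono two_ne_zero).le_iff_le.1 hsq

lemma locallyIntegrable_of_memLp_two {G : Type*} [NormedAddCommGroup G] {f : Rd d → G}
    (hf : MemLp f 2 volume) : LocallyIntegrable f volume := hf.locallyIntegrable (by norm_num)

lemma contDiff_moll [CompleteSpace F] (k : ℕ) {f : Rd d → F} (hf : LocallyIntegrable f volume) :
    ContDiff ℝ ∞ (moll k f) := by
  have := HasCompactSupport.contDiff_convolution_left (n := ⊤) (μ := (volume : Measure (Rd d)))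
    (F := F) (ContinuousLinearMap.lsmul ℝ ℝ : ℝ →L[ℝ] F →L[ℝ] F) ((bump d k).hasCompactSupport_normed (μ := (volume : Measure (Rd d))))
    (bump d k).contDiff_normed hf
  exact this

lemma ae_tendsto_moll {f : Rd d → F} [CompleteSpace F] (hf : LocallyIntegrable f volume) :
    ∀ᵐ x, Tendsto (fun k => moll k f x) atTop (𝓝 (f x)) := by
  refine ContDiffBump.ae_convolution_tendsto_right_of_locallyIntegrable (K := 2)
    (φ := fun k => bump d k) (l := atTop) ?_ ?_ hf
  · exact tendsto_one_div_add_atTop_nhds_zero_nat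
  · refine Eventually.of_forall fun k => le_of_eq ?_
    simp only [bump]
    field_simp

lemma memLp_moll [CompleteSpace F] (k : ℕ) {f : Rd d → F} (hf : MemLp f 2 volume) :
    MemLp (moll k f) 2 volume :=
  ⟨(contDiff_moll k (locallyIntegrable_of_memLp_two hf)).continuous.aestronglyMeasurable,
    (eLpNorm_moll_le k hf.1).trans_lt hf.2⟩

/-- Every kernel lives in the unit ball, so supports grow by at most one, uniformly in `k`; a single
Sobolev constant therefore serves all mollifications. -/
lemma moll_eq_zero (k : ℕ) {f : Rd d → F} {R : ℝ} (hf : ∀ᵐ x, R < ‖x‖ → f x = 0) {x : Rd d}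
    (hx : R + 1 < ‖x‖) : moll k f x = 0 := by
  rw [moll_apply_swap]
  refine integral_eq_zero_of_ae ?_
  filter_upwards [hf] with y hy
  by_cases h : R < ‖y‖
  · simp [hy h]
  · have : (bump d k).normed volume (x - y) = 0 := by
      by_contra hne
      have h2 : x - y ∈ Function.support ((bump d k).normed volume) := hne
      rw [(bump d k).support_normed_eq] at h2
      simp only [Metric.mem_ball, dist_zero_right] at h2
      have h3 : (bump d k).rOut ≤ 1 := by
        simp only [bump]
        rw [div_le_one (by positivity)]
        linarith [(Nat.cast_nonneg k : (0 : ℝ) ≤ k)]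
      have := norm_sub_norm_le x y
      linarith
    simp [this]

lemma support_moll_subset (k : ℕ) {f : Rd d → F} {R : ℝ} (hf : ∀ᵐ x, R < ‖x‖ → f x = 0) :
    Function.support (moll k f) ⊆ Metric.closedBall 0 (R + 1) := by
  intro x hx
  by_contra h
  simp only [Metric.mem_closedBall, dist_zero_right, not_le] at h
  exact hx (moll_eq_zero k hf h)

lemma hasCompactSupport_moll (k : ℕ) {f : Rd d → F} {R : ℝ} (hf : ∀ᵐ x, R < ‖x‖ → f x = 0) :
    HasCompactSupport (moll k f) :=
  HasCompactSupport.of_support_subset_isCompact (isCompact_closedBall 0 (R + 1))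
    (support_moll_subset k hf)

/-- Derivatives of mollifications are mollifications of weak derivatives. -/
lemma fderiv_moll [CompleteSpace F] (k : ℕ) {f g : Rd d → F} {j : Fin d}
    (hf : LocallyIntegrable f volume) (hfg : HasWeakPartial univ j f g) (x : Rd d) :
    fderiv ℝ (moll k f) x (EuclideanSpace.single j 1) = moll k g x := by
  set ρ := (bump d k).normed (volume : Measure (Rd d)) with hρ
  have hρs : ContDiff ℝ ∞ ρ := (bump d k).contDiff_normed
  have hρc : HasCompactSupport ρ := (bump d k).hasCompactSupport_normed
  have h1 := (HasCompactSupport.hasFDerivAt_convolution_left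
    (ContinuousLinearMap.lsmul ℝ ℝ : ℝ →L[ℝ] F →L[ℝ] F) hρc
    (hρs.of_le (by norm_cast)) hf x)
  -- The weak derivative is tested with the reflected kernel; the sign from differentiating `x - y`
  -- in `y` cancels the one from integration by parts.
  have h2 := hfg (fun y => ρ (x - y)) (hρs.comp (by fun_prop))
    (hρc.comp_homeomorph (Homeomorph.subLeft x)) (subset_univ _)
  have hd : ∀ y, fderiv ℝ (fun y => ρ (x - y)) y (EuclideanSpace.single j 1)
      = - fderiv ℝ ρ (x - y) (EuclideanSpace.single j 1) := by
    intro y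
    have : HasFDerivAt (fun y => ρ (x - y)) ((fderiv ℝ ρ (x - y)).comp
        (-ContinuousLinearMap.id ℝ (Rd d))) y :=
      ((hρs.differentiable (by simp)) (x - y)).hasFDerivAt.comp y
        ((hasFDerivAt_id y).const_sub x)
    rw [this.fderiv]; simp
  simp_rw [hd] at h2
  simp only [Measure.restrict_univ, neg_smul, integral_neg, neg_inj] at h2
  rw [moll_apply_swap, ← hρ, ← h2]
  have h3 : HasFDerivAt (moll k f) _ x := h1
  rw [h3.fderiv, convolution_eq_swap]
  rw [ContinuousLinearMap.integral_apply]
  · rfl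
  · have := (hρc.fderiv ℝ).convolutionExists_left
      ((ContinuousLinearMap.lsmul ℝ ℝ : ℝ →L[ℝ] F →L[ℝ] F).precompL (Rd d))
      (hρs.continuous_fderiv (by simp)) hf x
    exact this.integrable_swap

lemma moll_sub (k : ℕ) {f g : Rd d → F} (hf : LocallyIntegrable f volume)
    (hg : LocallyIntegrable g volume) : moll k (f - g) = moll k f - moll k g := by
  funext x
  have hρc := (bump d k).hasCompactSupport_normed (μ := (volume : Measure (Rd d)))
  have h1 := hρc.convolutionExists_left (ContinuousLinearMap.lsmul ℝ ℝ : ℝ →L[ℝ] F →L[ℝ] F)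
    (bump d k).continuous_normed hf x
  have h2 := hρc.convolutionExists_left (ContinuousLinearMap.lsmul ℝ ℝ : ℝ →L[ℝ] F →L[ℝ] F)
    (bump d k).continuous_normed hg x
  have := integral_sub h1.integrable h2.integrable
  simp only [moll, convolution, Pi.sub_apply, map_sub]
  exact this

lemma norm_moll_le (k : ℕ) {f : Rd d → F} {C : ℝ} (hC : ∀ x, ‖f x‖ ≤ C) (x : Rd d) :
    ‖moll k f x‖ ≤ C := by
  rw [moll_apply]
  refine (norm_integral_le_of_norm_le (g := fun y => (bump d k).normed volume y * C)
    ((bump d k).integrable_normed.mul_const C) (Eventually.of_forall fun y => ?_)).trans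
    (le_of_eq ?_)
  · rw [norm_smul, Real.norm_of_nonneg ((bump d k).nonneg_normed y)]
    exact mul_le_mul_of_nonneg_left (hC _) ((bump d k).nonneg_normed y)
  · rw [integral_mul_const, (bump d k).integral_normed, one_mul]

/-- Dominated convergence suffices on this dense class, since the differences are uniformly bounded
and live in one ball. The contraction bound `eLpNorm_moll_le` then extends the convergence to all of
L². -/
lemma tendsto_eLpNorm_moll_sub_of_continuous [CompleteSpace F] {g : Rd d → F}
    (hg : Continuous g) (hgc : HasCompactSupport g) :
    Tendsto (fun k => eLpNorm (moll k g - g) 2 volume) atTop (𝓝 0) := by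
  obtain ⟨C, hC⟩ := hgc.exists_bound_of_continuous hg
  obtain ⟨R, hR⟩ := hgc.isCompact.isBounded.subset_closedBall (0 : Rd d)
  have hR' : ∀ x, R < ‖x‖ → g x = 0 := by
    intro x hx
    by_contra hne
    have := hR (subset_tsupport g hne)
    simp only [Metric.mem_closedBall, dist_zero_right] at this
    linarith
  have hli : LocallyIntegrable g volume := hg.locallyIntegrable
  have hlim : Tendsto (fun k => ∫⁻ x, ‖(moll k g - g) x‖ₑ ^ 2) atTop
      (𝓝 (∫⁻ _ : Rd d, 0)) := by
    refine tendsto_lintegral_of_dominated_convergence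
      (fun x => (Metric.closedBall (0 : Rd d) (R + 1)).indicator
        (fun _ => ENNReal.ofReal (2 * C) ^ 2) x) (fun k => ?_) (fun k => ?_) ?_ ?_
    · exact (((contDiff_moll k hli).continuous.sub hg).enorm.measurable).pow_const 2
    · refine Eventually.of_forall fun x => ?_
      by_cases hx : x ∈ Metric.closedBall (0 : Rd d) (R + 1)
      · simp only [indicator_of_mem hx]
        have : ‖(moll k g - g) x‖ ≤ 2 * C := by
          refine (norm_sub_le _ _).trans ?_
          have := norm_moll_le k hC x
          linarith [hC x]
        gcongr
        rw [← ofReal_norm]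
        exact ENNReal.ofReal_le_ofReal this
      · simp only [indicator_of_notMem hx]
        simp only [Metric.mem_closedBall, dist_zero_right, not_le] at hx
        simp [moll_eq_zero k (Eventually.of_forall hR') hx, hR' x (by linarith)]
    · rw [lintegral_indicator Metric.isClosed_closedBall.measurableSet, setLIntegral_const]
      exact ENNReal.mul_ne_top (ENNReal.pow_ne_top ENNReal.ofReal_ne_top) (measure_closedBall_lt_top.ne)
    · filter_upwards [ae_tendsto_moll hli] with x hx
      have h1 : Tendsto (fun k => moll k g x - g x) atTop (𝓝 0) := by
        simpa using hx.sub_const (g x)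
      have h2 := ((ENNReal.continuous_pow 2).tendsto _).comp (h1.enorm)
      simpa [Function.comp_def] using h2
  simp_rw [← eLpNorm_two_sq] at hlim
  rw [lintegral_zero] at hlim
  have h3 := (ENNReal.continuous_rpow_const (y := (1 / 2 : ℝ))).tendsto 0 |>.comp hlim
  have h4 : ∀ a : ℝ≥0∞, (a ^ 2) ^ (1 / 2 : ℝ) = a := by
    intro a; rw [← ENNReal.rpow_natCast, ← ENNReal.rpow_mul]; norm_num
  simp only [Function.comp_def, h4] at h3
  simpa using h3

/-- Mollifications converge in `L²`. -/
lemma tendsto_eLpNorm_moll_sub [CompleteSpace F] {f : Rd d → F} (hf : MemLp f 2 volume) :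
    Tendsto (fun k => eLpNorm (moll k f - f) 2 volume) atTop (𝓝 0) := by
  rw [ENNReal.tendsto_nhds_zero]
  intro ε hε
  have hε3 : ε / 3 ≠ 0 := by simp [hε.ne']
  obtain ⟨g, hgc, hfg, hg, hgL⟩ := hf.exists_hasCompactSupport_eLpNorm_sub_le (by norm_num) hε3
  filter_upwards [ENNReal.tendsto_nhds_zero.1
    (tendsto_eLpNorm_moll_sub_of_continuous hg hgc) (ε / 3) (pos_iff_ne_zero.2 hε3)] with k hk
  have hfl := locallyIntegrable_of_memLp_two hf
  have hgl := locallyIntegrable_of_memLp_two hgL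
  have heq : moll k f - f = moll k (f - g) + (moll k g - g) + (g - f) := by
    rw [moll_sub k hfl hgl]; abel
  have hm1 := (memLp_moll k (hf.sub hgL)).1
  have hm2 := ((memLp_moll k hgL).sub hgL).1
  have hm3 := (hgL.sub hf).1
  rw [heq]
  calc _ ≤ eLpNorm (moll k (f - g) + (moll k g - g)) 2 volume + eLpNorm (g - f) 2 volume :=
        eLpNorm_add_le (hm1.add hm2) hm3 (by norm_num)
    _ ≤ eLpNorm (moll k (f - g)) 2 volume + eLpNorm (moll k g - g) 2 volume
          + eLpNorm (g - f) 2 volume := by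
        gcongr; exact eLpNorm_add_le hm1 hm2 (by norm_num)
    _ ≤ ε / 3 + ε / 3 + ε / 3 := by
        gcongr
        · exact (eLpNorm_moll_le k (hf.sub hgL).1).trans hfg
        · rw [eLpNorm_sub_comm]; exact hfg
    _ = ε := ENNReal.add_thirds ε

end

section
variable {d : ℕ} {F : Type} [NormedAddCommGroup F] [NormedSpace ℝ F]

/-! ### Weak partial derivatives -/

lemma integrable_smul_of_hasCompactSupport {f : Rd d → F} (hf : LocallyIntegrable f volume)
    {φ : Rd d → ℝ} (hφ : Continuous φ) (hc : HasCompactSupport φ) :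
    Integrable (fun x => φ x • f x) volume :=
  hf.integrable_smul_left_of_hasCompactSupport hφ hc

lemma continuous_partial_of_contDiff {φ : Rd d → ℝ} (hφ : ContDiff ℝ ∞ φ) (w : Rd d) :
    Continuous fun x => fderiv ℝ φ x w :=
  (hφ.continuous_fderiv (by simp)).clm_apply continuous_const

lemma hasCompactSupport_partial {φ : Rd d → ℝ} (hc : HasCompactSupport φ) (w : Rd d) :
    HasCompactSupport fun x => fderiv ℝ φ x w :=
  (hc.fderiv ℝ).comp_left (g := fun L : Rd d →L[ℝ] ℝ => L w) (by simp)

lemma HasWeakPartial.sub {j : Fin d} {v w g h : Rd d → F}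
    (hv : LocallyIntegrable v volume) (hw : LocallyIntegrable w volume)
    (hg : LocallyIntegrable g volume) (hh : LocallyIntegrable h volume)
    (h1 : HasWeakPartial univ j v g) (h2 : HasWeakPartial univ j w h) :
    HasWeakPartial univ j (v - w) (g - h) := by
  intro φ hφ hc hs
  have e1 := h1 φ hφ hc hs
  have e2 := h2 φ hφ hc hs
  simp only [Measure.restrict_univ] at *
  have c1 := continuous_partial_of_contDiff hφ (EuclideanSpace.single j 1)
  have c2 := hasCompactSupport_partial hc (EuclideanSpace.single j 1)
  simp only [Pi.sub_apply, smul_sub]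
  rw [integral_sub (integrable_smul_of_hasCompactSupport hv c1 c2)
    (integrable_smul_of_hasCompactSupport hw c1 c2),
    integral_sub (integrable_smul_of_hasCompactSupport hg hφ.continuous hc)
    (integrable_smul_of_hasCompactSupport hh hφ.continuous hc), e1, e2]
  abel

lemma HasWeakPartial.congr {Ω : Set (Rd d)} {j : Fin d} {v w g h : Rd d → F}
    (h1 : HasWeakPartial Ω j v g) (hv : v =ᵐ[volume.restrict Ω] w)
    (hg : g =ᵐ[volume.restrict Ω] h) : HasWeakPartial Ω j w h := by
  intro φ hφ hc hs
  have e1 := h1 φ hφ hc hs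
  have c1 : ∫ x in Ω, fderiv ℝ φ x (EuclideanSpace.single j 1) • v x
      = ∫ x in Ω, fderiv ℝ φ x (EuclideanSpace.single j 1) • w x :=
    integral_congr_ae (hv.mono fun x hx => by simp only [hx])
  have c2 : ∫ x in Ω, φ x • g x = ∫ x in Ω, φ x • h x :=
    integral_congr_ae (hg.mono fun x hx => by simp only [hx])
  rw [← c1, e1, c2]

lemma HasWeakPartial.restrict {Ω : Set (Rd d)} {j : Fin d} {v g : Rd d → F}
    (h : HasWeakPartial univ j v g) : HasWeakPartial Ω j v g := by
  intro φ hφ hc hs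
  have e1 := h φ hφ hc (subset_univ _)
  simp only [Measure.restrict_univ] at e1
  rw [setIntegral_eq_integral_of_forall_compl_eq_zero, e1,
    setIntegral_eq_integral_of_forall_compl_eq_zero]
  · intro x hx
    rw [image_eq_zero_of_notMem_tsupport fun h => hx (hs h), zero_smul]
  · intro x hx
    have : fderiv ℝ φ x = 0 := by
      by_contra hne
      exact hx (hs (support_fderiv_subset ℝ hne))
    simp [this]

lemma HasWeakPartial.unique [CompleteSpace F] {Ω : Set (Rd d)} (hΩ : IsOpen Ω) {j : Fin d}
    {v g h : Rd d → F} (hg : MemLp g 2 (volume.restrict Ω)) (hh : MemLp h 2 (volume.restrict Ω))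
    (h1 : HasWeakPartial Ω j v g) (h2 : HasWeakPartial Ω j v h) :
    g =ᵐ[volume.restrict Ω] h := by
  have hgl : LocallyIntegrable g (volume.restrict Ω) := hg.locallyIntegrable (by norm_num)
  have hhl : LocallyIntegrable h (volume.restrict Ω) := hh.locallyIntegrable (by norm_num)
  have hsub : LocallyIntegrableOn (g - h) Ω volume := by
    intro x hx
    obtain ⟨s, hs, hi⟩ := (hgl.sub hhl) x
    refine ⟨s ∩ Ω, Filter.inter_mem (mem_nhdsWithin_of_mem_nhds hs) self_mem_nhdsWithin, ?_⟩
    rw [IntegrableOn, ← Measure.restrict_restrict' hΩ.measurableSet]; exact hi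
  have := hΩ.ae_eq_zero_of_integral_contDiff_smul_eq_zero hsub fun φ hφ hc hs => ?_
  · rw [EventuallyEq, ae_restrict_iff' hΩ.measurableSet]
    filter_upwards [this] with x hx hxΩ
    simpa [sub_eq_zero] using hx hxΩ
  · have e : ∫ x in Ω, φ x • g x = ∫ x in Ω, φ x • h x := by
      have := (h1 φ hφ hc hs).symm.trans (h2 φ hφ hc hs)
      simpa using this
    rw [← setIntegral_eq_integral_of_forall_compl_eq_zero (s := Ω)]
    · simp only [Pi.sub_apply, smul_sub]
      rw [integral_sub, e, sub_self]
      · exact hgl.integrable_smul_left_of_hasCompactSupport hφ.continuous hc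
      · exact hhl.integrable_smul_left_of_hasCompactSupport hφ.continuous hc
    · intro x hx
      rw [image_eq_zero_of_notMem_tsupport fun h => hx (hs h), zero_smul]

lemma HasWeakPartial.clm_comp {G : Type} [NormedAddCommGroup G] [NormedSpace ℝ G]
    [CompleteSpace F] [CompleteSpace G]
    {j : Fin d} {v g : Rd d → F} (hv : LocallyIntegrable v volume)
    (hg : LocallyIntegrable g volume) (h : HasWeakPartial univ j v g) (L : F →L[ℝ] G) :
    HasWeakPartial univ j (fun x => L (v x)) (fun x => L (g x)) := by
  intro φ hφ hc hs
  have e1 := h φ hφ hc hs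
  simp only [Measure.restrict_univ] at *
  have c1 := continuous_partial_of_contDiff hφ (EuclideanSpace.single j 1)
  have c2 := hasCompactSupport_partial hc (EuclideanSpace.single j 1)
  simp_rw [← map_smul]
  rw [L.integral_comp_comm (integrable_smul_of_hasCompactSupport hv c1 c2),
    L.integral_comp_comm (integrable_smul_of_hasCompactSupport hg hφ.continuous hc), e1, map_neg]

lemma partialD_spec {v : Rd d → Rd d} (hv : MemH1 v) (j : Fin d) :
    MemLp (partialD j v) 2 volume ∧ HasWeakPartial univ j v (partialD j v) := by
  have h := hv.2 j
  have h2 : partialD j v = h.choose := by unfold partialD; rw [dif_pos h]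
  rw [h2]; exact h.choose_spec

/-- Since `partialD` is a choice, it obeys algebraic rules only almost everywhere; uniqueness of
weak derivatives is how those rules are obtained. -/
lemma partialD_ae_eq {v g : Rd d → Rd d} {j : Fin d} (hg : MemLp g 2 volume)
    (h : HasWeakPartial univ j v g) : partialD j v =ᵐ[volume] g := by
  have hex : ∃ g : Rd d → Rd d, MemLp g 2 volume ∧ HasWeakPartial univ j v g := ⟨g, hg, h⟩
  have h2 : partialD j v = hex.choose := by unfold partialD; rw [dif_pos hex]
  have := HasWeakPartial.unique isOpen_univ (by simpa [h2] using hex.choose_spec.1)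
    (by simpa using hg) (h2 ▸ hex.choose_spec.2) h
  simpa using this

/-! ### Hölder's inequality with real-valued norms -/

/-- The `Lᵖ` norm as a real number. -/
def nrm {X G : Type*} [MeasurableSpace X] [NormedAddCommGroup G] (p : ℝ≥0∞) (μ : Measure X)
    (f : X → G) : ℝ := (eLpNorm f p μ).toReal

section Holder
variable {X G H : Type*} [MeasurableSpace X] {μ : Measure X} [NormedAddCommGroup G]
  [NormedAddCommGroup H]

lemma nrm_nonneg (p : ℝ≥0∞) (f : X → G) : 0 ≤ nrm p μ f := ENNReal.toReal_nonneg

lemma nrm_congr {p : ℝ≥0∞} {f g : X → G} (h : f =ᵐ[μ] g) : nrm p μ f = nrm p μ g := by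
  rw [nrm, nrm, eLpNorm_congr_ae h]

lemma nrm_add_le {p : ℝ≥0∞} (hp : 1 ≤ p) {f g : X → G} (hf : MemLp f p μ) (hg : MemLp g p μ) :
    nrm p μ (f + g) ≤ nrm p μ f + nrm p μ g := by
  rw [nrm, nrm, nrm, ← ENNReal.toReal_add hf.2.ne hg.2.ne]
  exact ENNReal.toReal_mono (ENNReal.add_ne_top.2 ⟨hf.2.ne, hg.2.ne⟩) (eLpNorm_add_le hf.1 hg.1 hp)

lemma nrm_sub_le {p : ℝ≥0∞} (hp : 1 ≤ p) {f g : X → G} (hf : MemLp f p μ) (hg : MemLp g p μ) :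
    nrm p μ (f - g) ≤ nrm p μ f + nrm p μ g := by
  have := nrm_add_le hp hf hg.neg
  rwa [← sub_eq_add_neg, show nrm p μ (-g) = nrm p μ g by rw [nrm, nrm, eLpNorm_neg]] at this

lemma nrm_smul [NormedSpace ℝ G] {p : ℝ≥0∞} (c : ℝ) (f : X → G) :
    nrm p μ (c • f) = |c| * nrm p μ f := by
  rw [nrm, nrm, eLpNorm_const_smul, ENNReal.toReal_mul]; simp

lemma nrm_two_sq {f : X → G} (hf : MemLp f 2 μ) : nrm 2 μ f ^ 2 = ∫ x, ‖f x‖ ^ 2 ∂μ := by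
  have hm : AEStronglyMeasurable (fun x => ‖f x‖ ^ 2) μ := hf.1.norm.pow 2
  rw [nrm, ← ENNReal.toReal_pow, eLpNorm_two_sq,
    integral_eq_lintegral_of_nonneg_ae (Eventually.of_forall fun x => by positivity) hm]
  congr 1
  refine lintegral_congr fun x => ?_
  rw [ENNReal.ofReal_pow (norm_nonneg _), ofReal_norm]

lemma nrm_pow_eq_integral {f : X → G} {p : ℕ} (hp : p ≠ 0) (hf : AEStronglyMeasurable f μ) :
    nrm p μ f ^ p = ∫ x, ‖f x‖ ^ p ∂μ := by
  have := eLpNorm_nnreal_pow_eq_lintegral (μ := μ) (f := f) (p := (p : ℝ≥0)) (by exact_mod_cast hp)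
  have hm : AEStronglyMeasurable (fun x => ‖f x‖ ^ p) μ := hf.norm.pow p
  rw [integral_eq_lintegral_of_nonneg_ae (Eventually.of_forall fun x => by positivity) hm, nrm, ← ENNReal.toReal_pow]
  congr 1
  have h2 : (((p : ℝ≥0) : ℝ≥0∞)) = p := by simp
  rw [h2] at this
  simp only [NNReal.coe_natCast, ENNReal.rpow_natCast] at this
  rw [this]
  refine lintegral_congr fun x => ?_
  rw [ENNReal.ofReal_pow (norm_nonneg _), ofReal_norm]

lemma integrable_norm_mul_norm {p q : ℝ≥0∞} [ENNReal.HolderTriple p q 1] {f : X → G} {g : X → H}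
    (hf : MemLp f p μ) (hg : MemLp g q μ) : Integrable (fun x => ‖f x‖ * ‖g x‖) μ := by
  have := (MemLp.mul (r := 1) hg.norm hf.norm : MemLp _ 1 μ)
  exact memLp_one_iff_integrable.1 this

lemma nrm_mul_le {p q r : ℝ≥0∞} [ENNReal.HolderTriple p q r] {f : X → G} {g : X → H}
    (hf : MemLp f p μ) (hg : MemLp g q μ) :
    nrm r μ (fun x => ‖f x‖ * ‖g x‖) ≤ nrm p μ f * nrm q μ g := by
  have h := eLpNorm_smul_le_mul_eLpNorm (p := p) (q := q) (r := r) hg.1.norm hf.1.norm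
  rw [eLpNorm_norm, eLpNorm_norm] at h
  rw [nrm, nrm, nrm, ← ENNReal.toReal_mul]
  exact ENNReal.toReal_mono (ENNReal.mul_ne_top hf.2.ne hg.2.ne) h

lemma integral_norm_mul_norm_le {p q : ℝ≥0∞} [ENNReal.HolderTriple p q 1] {f : X → G} {g : X → H}
    (hf : MemLp f p μ) (hg : MemLp g q μ) :
    ∫ x, ‖f x‖ * ‖g x‖ ∂μ ≤ nrm p μ f * nrm q μ g := by
  have h1 := nrm_mul_le (r := 1) hf hg
  have h2 := nrm_pow_eq_integral (p := 1) one_ne_zero (f := fun x => ‖f x‖ * ‖g x‖)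
    (integrable_norm_mul_norm hf hg).1
  simp only [Nat.cast_one, pow_one, norm_mul, norm_norm] at h2
  rwa [h2] at h1

instance : ENNReal.HolderTriple 6 3 2 := ⟨by
  rw [← ENNReal.toReal_eq_toReal_iff' (by simp) (by simp), ENNReal.toReal_add (by simp) (by simp)]
  simp; norm_num⟩

instance : ENNReal.HolderTriple 3 6 2 := inferInstance

lemma memLp_norm_mul_norm {f : X → G} {g : X → H} (hf : MemLp f 3 μ) (hg : MemLp g 6 μ) :
    MemLp (fun x => ‖f x‖ * ‖g x‖) 2 μ := MemLp.mul (r := 2) hg.norm hf.norm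

lemma integrable_norm_mul_norm_mul_norm {K : Type*} [NormedAddCommGroup K] {f : X → G} {g : X → H}
    {h : X → K} (hf : MemLp f 3 μ) (hg : MemLp g 2 μ) (hh : MemLp h 6 μ) :
    Integrable (fun x => ‖f x‖ * ‖g x‖ * ‖h x‖) μ := by
  have := integrable_norm_mul_norm (memLp_norm_mul_norm hf hh) hg
  refine this.congr (Eventually.of_forall fun x => ?_)
  simp only [norm_mul, norm_norm]; ring

/-- The exponents satisfy 1/3 + 1/2 + 1/6 = 1 and suit the convective term in both dimensions: the
gradient is in L², Sobolev gives L⁶, and interpolation gives L³. -/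
lemma integral_norm_mul_norm_mul_norm_le {K : Type*} [NormedAddCommGroup K] {f : X → G} {g : X → H}
    {h : X → K} (hf : MemLp f 3 μ) (hg : MemLp g 2 μ) (hh : MemLp h 6 μ) :
    ∫ x, ‖f x‖ * ‖g x‖ * ‖h x‖ ∂μ ≤ nrm 3 μ f * nrm 2 μ g * nrm 6 μ h := by
  have h1 := integral_norm_mul_norm_le (memLp_norm_mul_norm hf hh) hg
  have h2 := nrm_mul_le (r := 2) hf hh
  calc _ = ∫ x, ‖(‖f x‖ * ‖h x‖)‖ * ‖g x‖ ∂μ := by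
        refine integral_congr_ae (Eventually.of_forall fun x => ?_)
        simp only [norm_mul, norm_norm]; ring
    _ ≤ _ := h1
    _ ≤ (nrm 3 μ f * nrm 6 μ h) * nrm 2 μ g :=
        mul_le_mul_of_nonneg_right h2 (nrm_nonneg _ _)
    _ = _ := by ring

/-- The interpolation inequality `‖f‖₃² ≤ ‖f‖₂ ‖f‖₆`. -/
lemma nrm_three_sq_le {f : X → G} (h2 : MemLp f 2 μ) (h6 : MemLp f 6 μ) (h3 : MemLp f 3 μ) :
    nrm 3 μ f ^ 2 ≤ nrm 2 μ f * nrm 6 μ f := by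
  -- With all three functions equal to `f`, Hölder bounds the cube of the L³ norm by the product of
  -- the three norms; one factor `nrm 3 μ f` is then cancelled if it is nonzero.
  have h := integral_norm_mul_norm_mul_norm_le h3 h2 h6
  have e := nrm_pow_eq_integral (p := 3) (by norm_num) h3.1
  have e' : ∫ x, ‖f x‖ ^ 3 ∂μ = ∫ x, ‖f x‖ * ‖f x‖ * ‖f x‖ ∂μ :=
    integral_congr_ae (Eventually.of_forall fun x => by simp only; ring)
  rw [← e', ← e] at h
  push_cast at h
  rcases (nrm_nonneg 3 f (μ := μ)).eq_or_lt with h0 | h0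
  · rw [← h0]
    have := mul_nonneg (nrm_nonneg 2 f (μ := μ)) (nrm_nonneg 6 f (μ := μ))
    simpa using this
  · refine le_of_mul_le_mul_left ?_ h0
    nlinarith

/-- Pointwise, the cube is at most the sum of the square and the sixth power, according to whether
the norm is below or above one. -/
lemma memLp_three {f : X → G} (h2 : MemLp f 2 μ) (h6 : MemLp f 6 μ) : MemLp f 3 μ := by
  refine ⟨h2.1, ?_⟩
  have e2 := (eLpNorm_lt_top_iff_lintegral_rpow_enorm_lt_top (by norm_num) (by norm_num)).1 h2.2
  have e6 := (eLpNorm_lt_top_iff_lintegral_rpow_enorm_lt_top (by norm_num) (by norm_num)).1 h6.2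
  refine (eLpNorm_lt_top_iff_lintegral_rpow_enorm_lt_top (by norm_num) (by norm_num)).2 ?_
  refine lt_of_le_of_lt ?_ (ENNReal.add_lt_top.2 ⟨e2, e6⟩)
  rw [← lintegral_add_left' (h2.1.enorm.pow_const _)]
  refine lintegral_mono fun x => ?_
  simp only [ENNReal.toReal_ofNat]
  rcases le_total ‖f x‖ₑ 1 with h | h
  · exact (ENNReal.rpow_le_rpow_of_exponent_ge h (by norm_num)).trans le_self_add
  · exact (ENNReal.rpow_le_rpow_of_exponent_le h (by norm_num)).trans le_add_self

end Holder

end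

/-! ### Vanishing of weak derivatives on zero sets -/

section
variable {d : ℕ} {F : Type} [NormedAddCommGroup F] [NormedSpace ℝ F]

lemma tendsto_nrm_moll_sub [CompleteSpace F] {f : Rd d → F} (hf : MemLp f 2 volume) :
    Tendsto (fun k => nrm 2 volume (moll k f - f)) atTop (𝓝 0) := by
  have := (ENNReal.tendsto_toReal ENNReal.zero_ne_top).comp (tendsto_eLpNorm_moll_sub hf)
  simpa [nrm, Function.comp_def] using this

/-- Pairings of bounded a.e. convergent functions with `L²` convergent ones. -/
lemma tendsto_integral_mul_mul {φ g : Rd d → ℝ} {gk hk : ℕ → Rd d → ℝ} {h : Rd d → ℝ}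
    (hφ : MemLp φ 2 volume) (hg : MemLp g 2 volume) (hgk : ∀ k, MemLp (gk k) 2 volume)
    (hhk : ∀ k, AEStronglyMeasurable (hk k) volume) (hb : ∀ k x, |hk k x| ≤ 1)
    (hglim : Tendsto (fun k => nrm 2 volume (gk k - g)) atTop (𝓝 0))
    (hlim : ∀ᵐ x, Tendsto (fun k => hk k x) atTop (𝓝 (h x))) :
    Tendsto (fun k => ∫ x, φ x * gk k x * hk k x) atTop (𝓝 (∫ x, φ x * g x * h x)) := by
  have hi : Integrable (fun x => φ x * g x) volume := memLp_one_iff_integrable.1 (hg.mul hφ)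
  have h1 : Tendsto (fun k => ∫ x, φ x * g x * hk k x) atTop (𝓝 (∫ x, φ x * g x * h x)) := by
    refine tendsto_integral_of_dominated_convergence (fun x => ‖φ x * g x‖)
      (fun k => hi.1.mul (hhk k)) hi.norm (fun k => Eventually.of_forall fun x => ?_) ?_
    · rw [norm_mul]
      exact mul_le_of_le_one_right (norm_nonneg _) (hb k x)
    · filter_upwards [hlim] with x hx using hx.const_mul _
  have h2 : Tendsto (fun k => ∫ x, φ x * (gk k - g) x * hk k x) atTop (𝓝 0) := by
    refine squeeze_zero_norm (fun k => ?_) (by simpa using hglim.const_mul (nrm 2 volume φ))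
    have hd := (hgk k).sub hg
    refine (norm_integral_le_of_norm_le (integrable_norm_mul_norm hφ hd)
      (Eventually.of_forall fun x => ?_)).trans (integral_norm_mul_norm_le hφ hd)
    rw [norm_mul, norm_mul]
    exact mul_le_of_le_one_right (by positivity) (hb k x)
  have h3 := h2.add h1
  rw [zero_add] at h3
  refine h3.congr fun k => ?_
  rw [← integral_add]
  · refine integral_congr_ae (Eventually.of_forall fun x => ?_)
    simp only [Pi.sub_apply]; ring
  · refine Integrable.mul_bdd (c := 1) ?_ (hhk k) (Eventually.of_forall fun x => hb k x)
    exact memLp_one_iff_integrable.1 (((hgk k).sub hg).mul hφ)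
  · exact hi.mul_bdd (c := 1) (hhk k) (Eventually.of_forall fun x => hb k x)

lemma memLp_of_continuous_hasCompactSupport {G : Type*} [NormedAddCommGroup G] {φ : Rd d → G}
    (hφ : Continuous φ)
    (hc : HasCompactSupport φ) (p : ℝ≥0∞) : MemLp φ p volume :=
  hφ.memLp_of_hasCompactSupport hc

lemma damp_bound (s : ℝ) : |1 / (1 + s ^ 2)| ≤ 1 := by
  rw [abs_of_nonneg (by positivity), div_le_one (by positivity)]
  nlinarith [sq_nonneg s]

/-- The damped derivative is the weak derivative of `ε arctan(v/ε)`, which is at most `2ε` in size;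
integrating by parts puts the derivative on `φ`. The chain rule is applied to mollifications, where
it is classical, and the limit is taken afterwards. -/
lemma hasWeakPartial_damped_bound {j : Fin d} {v g : Rd d → ℝ} (hv : MemLp v 2 volume)
    (hg : MemLp g 2 volume) (h : HasWeakPartial univ j v g) {φ : Rd d → ℝ}
    (hφ : ContDiff ℝ ∞ φ) (hc : HasCompactSupport φ) {ε : ℝ} (hε : 0 < ε) :
    |∫ x, φ x * g x * (1 / (1 + (v x / ε) ^ 2))| ≤
      ε * (2 * ∫ x, ‖fderiv ℝ φ x (EuclideanSpace.single j 1)‖) := by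
  have hvl := locallyIntegrable_of_memLp_two hv
  have hsm : ∀ k, ContDiff ℝ ∞ (moll k v) := fun k => contDiff_moll k hvl
  have cd := continuous_partial_of_contDiff hφ (EuclideanSpace.single j 1)
  have sd := hasCompactSupport_partial hc (EuclideanSpace.single j 1)
  have hcont : ∀ k, Continuous fun x => 1 / (1 + (moll k v x / ε) ^ 2) := fun k =>
    continuous_const.div (by have := (hsm k).continuous; fun_prop) fun x => by positivity
  have hlim := tendsto_integral_mul_mul (memLp_of_continuous_hasCompactSupport hφ.continuous hc 2)
    hg (fun k => memLp_moll k hg) (hk := fun k x => 1 / (1 + (moll k v x / ε) ^ 2))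
    (h := fun x => 1 / (1 + (v x / ε) ^ 2))
    (fun k => (hcont k).aestronglyMeasurable) (fun k x => damp_bound _) (tendsto_nrm_moll_sub hg)
    (by
      filter_upwards [ae_tendsto_moll hvl] with x hx
      exact (tendsto_const_nhds.div (((hx.div_const ε).pow 2).const_add 1) (by positivity)))
  refine le_of_tendsto hlim.abs (Eventually.of_forall fun k => ?_)
  have hψ : ContDiff ℝ ∞ fun x => ε * Real.arctan (moll k v x / ε) :=
    contDiff_const.mul (((hsm k).div_const ε).arctan)
  have hψd : ∀ x, fderiv ℝ (fun x => ε * Real.arctan (moll k v x / ε)) x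
      (EuclideanSpace.single j 1) = moll k g x * (1 / (1 + (moll k v x / ε) ^ 2)) := by
    intro x
    have h1 : HasFDerivAt (moll k v) (fderiv ℝ (moll k v) x) x :=
      ((hsm k).differentiable (by simp) x).hasFDerivAt
    have h2 := ((h1.mul_const ε⁻¹).arctan).const_mul ε
    simp_rw [← div_eq_mul_inv] at h2
    rw [h2.fderiv]
    simp only [_root_.smul_apply, fderiv_moll k hvl h x, smul_eq_mul]
    field_simp
  have hibp := integral_mul_fderiv_eq_neg_fderiv_mul_of_integrable (μ := (volume : Measure (Rd d)))
    (f := φ) (g := fun x => ε * Real.arctan (moll k v x / ε)) (v := EuclideanSpace.single j 1)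
    ((cd.mul hψ.continuous).integrable_of_hasCompactSupport sd.mul_right)
    ((hφ.continuous.mul (continuous_partial_of_contDiff hψ _)).integrable_of_hasCompactSupport
      hc.mul_right)
    ((hφ.continuous.mul hψ.continuous).integrable_of_hasCompactSupport hc.mul_right)
    (fun x _ => hφ.differentiable (by simp) x) (fun x _ => hψ.differentiable (by simp) x)
  simp_rw [hψd, ← mul_assoc] at hibp
  rw [hibp, abs_neg, ← Real.norm_eq_abs, ← mul_assoc, ← integral_const_mul]
  refine norm_integral_le_of_norm_le ((cd.integrable_of_hasCompactSupport sd).norm.const_mul _)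
    (Eventually.of_forall fun x => ?_)
  rw [norm_mul, norm_mul, Real.norm_of_nonneg hε.le]
  have h5 : ‖Real.arctan (moll k v x / ε)‖ ≤ 2 := by
    rw [Real.norm_eq_abs, abs_le]
    have := Real.arctan_lt_pi_div_two (moll k v x / ε)
    have := Real.neg_pi_div_two_lt_arctan (moll k v x / ε)
    have := Real.pi_le_four
    constructor <;> linarith
  calc _ ≤ ‖fderiv ℝ φ x (EuclideanSpace.single j 1)‖ * ε * 2 := by gcongr
    _ = _ := by ring

lemma tendsto_damp (a : ℝ) :
    Tendsto (fun k : ℕ => 1 / (1 + (a / (1 / ((k : ℝ) + 1))) ^ 2)) atTop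
      (𝓝 (({0} : Set ℝ).indicator 1 a)) := by
  by_cases ha : a = 0
  · simp [ha]
  · rw [indicator_of_notMem (by simpa using ha)]
    have h2 : Tendsto (fun k : ℕ => ((k : ℝ) + 1) ^ 2) atTop atTop :=
      (tendsto_pow_atTop two_ne_zero).comp
        (tendsto_natCast_atTop_atTop.atTop_add tendsto_const_nhds)
    have h3 := h2.const_mul_atTop (show 0 < a ^ 2 by positivity)
    refine tendsto_const_nhds.div_atTop (tendsto_atTop_add_const_left _ 1 (h3.congr fun k => ?_))
    field_simp

/-- Let `ε = 1/(k+1)` tend to zero in the damped bound: the damping factor tends to the indicator of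
the zero set of `v`, and the bound tends to zero. -/
lemma HasWeakPartial.integral_mul_indicator_eq_zero {j : Fin d} {v g : Rd d → ℝ}
    (hv : MemLp v 2 volume) (hg : MemLp g 2 volume) (h : HasWeakPartial univ j v g)
    {φ : Rd d → ℝ} (hφ : ContDiff ℝ ∞ φ) (hc : HasCompactSupport φ) :
    ∫ x, φ x * g x * ({0} : Set ℝ).indicator 1 (v x) = 0 := by
  have hm : ∀ k : ℕ, AEStronglyMeasurable
      (fun x => 1 / (1 + (v x / (1 / ((k : ℝ) + 1))) ^ 2)) volume := by
    intro k
    have hc : Continuous fun s : ℝ => 1 / (1 + (s / (1 / ((k : ℝ) + 1))) ^ 2) :=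
      continuous_const.div (by fun_prop) fun x => by positivity
    exact hc.comp_aestronglyMeasurable hv.1
  have hz : Tendsto (fun _ : ℕ => nrm 2 volume (g - g)) atTop (𝓝 0) := by
    simp [nrm]
  have hlim := tendsto_integral_mul_mul (memLp_of_continuous_hasCompactSupport hφ.continuous hc 2)
    hg (gk := fun _ => g) (fun _ => hg) hm (fun k x => damp_bound _) hz
    (Eventually.of_forall fun x => tendsto_damp (v x))
  refine tendsto_nhds_unique hlim (squeeze_zero_norm (fun k => hasWeakPartial_damped_bound
    hv hg h hφ hc (show 0 < 1 / ((k : ℝ) + 1) by positivity)) ?_)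
  have := (tendsto_one_div_add_atTop_nhds_zero_nat (𝕜 := ℝ)).mul_const
    (2 * ∫ x, ‖fderiv ℝ φ x (EuclideanSpace.single j 1)‖)
  rwa [zero_mul] at this

/-- A weak derivative vanishes a.e. on the zero set of the function. -/
lemma HasWeakPartial.ae_eq_zero_of_eq_zero {j : Fin d} {v g : Rd d → ℝ} (hv : MemLp v 2 volume)
    (hg : MemLp g 2 volume) (h : HasWeakPartial univ j v g) : ∀ᵐ x, v x = 0 → g x = 0 := by
  have hm : AEStronglyMeasurable (fun x => ({0} : Set ℝ).indicator (1 : ℝ → ℝ) (v x)) volume :=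
    ((measurable_one.indicator (measurableSet_singleton 0)).comp_aemeasurable
      hv.1.aemeasurable).aestronglyMeasurable
  have hL : MemLp (fun x => g x * ({0} : Set ℝ).indicator (1 : ℝ → ℝ) (v x)) 2 volume := by
    refine hg.mono (hg.1.mul hm) (Eventually.of_forall fun x => ?_)
    rw [norm_mul]
    refine mul_le_of_le_one_right (norm_nonneg _) ?_
    by_cases hx : v x = 0 <;> simp [hx]
  have h0 := ae_eq_zero_of_integral_contDiff_smul_eq_zero (locallyIntegrable_of_memLp_two hL)
    fun φ hφ hc => by
      have h1 := h.integral_mul_indicator_eq_zero hv hg hφ hc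
      simp_rw [mul_assoc] at h1
      exact h1
  filter_upwards [h0] with x hx hv0
  simpa [hv0] using hx

lemma HasWeakPartial.ae_eq_zero_of_eq_zero_vec {j : Fin d} {v g : Rd d → Rd d}
    (hv : MemLp v 2 volume) (hg : MemLp g 2 volume) (h : HasWeakPartial univ j v g) :
    ∀ᵐ x, v x = 0 → g x = 0 := by
  have hi : ∀ i : Fin d, ∀ᵐ x, v x i = 0 → g x i = 0 := fun i =>
    HasWeakPartial.ae_eq_zero_of_eq_zero (v := fun x => EuclideanSpace.proj (𝕜 := ℝ) i (v x))
      (g := fun x => EuclideanSpace.proj (𝕜 := ℝ) i (g x))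
      ((EuclideanSpace.proj (𝕜 := ℝ) i : Rd d →L[ℝ] ℝ).comp_memLp' hv)
      ((EuclideanSpace.proj (𝕜 := ℝ) i : Rd d →L[ℝ] ℝ).comp_memLp' hg)
      (h.clm_comp (locallyIntegrable_of_memLp_two hv) (locallyIntegrable_of_memLp_two hg) _)
  filter_upwards [ae_all_iff.2 hi] with x hx hv0
  ext i
  simpa using hx i (by simp [hv0])

/-! ### The Sobolev inequality -/

lemma norm_le_sum_single (L : Rd d →L[ℝ] F) :
    ‖L‖ ≤ ∑ j, ‖L (EuclideanSpace.single j 1)‖ := by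
  refine L.opNorm_le_bound (Finset.sum_nonneg fun _ _ => norm_nonneg _) fun x => ?_
  have hx : x = ∑ j, x j • EuclideanSpace.single j (1 : ℝ) := by
    simpa using ((EuclideanSpace.basisFun (Fin d) ℝ).sum_repr x).symm
  conv_lhs => rw [hx, map_sum]
  refine (norm_sum_le _ _).trans ?_
  rw [Finset.sum_mul]
  refine Finset.sum_le_sum fun j _ => ?_
  rw [map_smul, norm_smul, mul_comm]
  exact mul_le_mul_of_nonneg_left (PiLp.norm_apply_le x j) (norm_nonneg _)

lemma eLpNorm_le_of_eq_zero_off {X G : Type*} [MeasurableSpace X] [NormedAddCommGroup G]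
    {μ : Measure X} {f : X → G} {S : Set X} (hSm : MeasurableSet S) (hS : ∀ᵐ x ∂μ, x ∉ S → f x = 0)
    (hf : AEStronglyMeasurable f μ) {p q : ℝ≥0∞} (hpq : p ≤ q) :
    eLpNorm f p μ ≤ eLpNorm f q μ * μ S ^ (1 / p.toReal - 1 / q.toReal) := by
  have hs : f =ᵐ[μ] S.indicator f := by
    filter_upwards [hS] with x hx
    by_cases h : x ∈ S
    · rw [indicator_of_mem h]
    · rw [indicator_of_notMem h, hx h]
  have h := eLpNorm_le_eLpNorm_mul_rpow_measure_univ (μ := μ.restrict S) hpq hf.restrict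
  rwa [← eLpNorm_indicator_eq_eLpNorm_restrict hSm, ← eLpNorm_indicator_eq_eLpNorm_restrict hSm,
    ← eLpNorm_congr_ae hs, ← eLpNorm_congr_ae hs, Measure.restrict_apply_univ] at h

/-- In the plane L² is the critical exponent, so the embedding starts from 3/2, whose Sobolev
conjugate is exactly 6; Hölder on the fixed ball then raises 3/2 to 2. In dimension three the
conjugate of 2 is already 6. -/
lemma exists_sobolev_const_smooth_two (R : ℝ) :
    ∃ C : ℝ≥0, ∀ w : Rd 2 → Rd 2, ContDiff ℝ 1 w →
      Function.support w ⊆ Metric.closedBall 0 R →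
      eLpNorm w 6 volume ≤ C * eLpNorm (fderiv ℝ w) 2 volume := by
  have hfr : Module.finrank ℝ (Rd 2) = 2 := by simp
  have hA : (volume (Metric.closedBall (0 : Rd 2) R)) ^
      ((1 : ℝ) / (3 / 2 : ℝ≥0∞).toReal - 1 / (2 : ℝ≥0∞).toReal) ≠ ⊤ :=
    ENNReal.rpow_ne_top_of_nonneg (by norm_num) measure_closedBall_lt_top.ne
  obtain ⟨A, hA⟩ : ∃ A : ℝ≥0, (A : ℝ≥0∞) = _ := ⟨_, ENNReal.coe_toNNReal hA⟩
  refine ⟨eLpNormLESNormFDerivOfLeConst (Rd 2) volume (Metric.closedBall (0 : Rd 2) R) (3 / 2) 6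
    * A, fun w hw hs => ?_⟩
  have h1 := eLpNorm_le_eLpNorm_fderiv_of_le (volume : Measure (Rd 2)) hw hs (p := 3 / 2)
    (q := 6) (by norm_num; rw [le_div_iff₀ (by norm_num)]; norm_num)
    (by rw [hfr, div_lt_iff₀ (by norm_num)]; norm_num) (by rw [hfr]; norm_num)
    Metric.isBounded_closedBall
  have hz : ∀ x, x ∉ Metric.closedBall (0 : Rd 2) R → fderiv ℝ w x = 0 := by
    intro x hx
    by_contra hne
    exact hx (closure_minimal hs Metric.isClosed_closedBall (support_fderiv_subset ℝ hne))
  have h32 : (3 / 2 : ℝ≥0∞) ≤ 2 := by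
    rw [ENNReal.div_le_iff (by norm_num) (by norm_num)]; norm_num
  have h2 := eLpNorm_le_of_eq_zero_off measurableSet_closedBall
    (Eventually.of_forall hz)
    (hw.continuous_fderiv (by simp)).aestronglyMeasurable (μ := volume) h32
  rw [← hA] at h2
  have h32 : (((3 / 2 : ℝ≥0) : ℝ≥0∞)) = 3 / 2 := by
    rw [ENNReal.coe_div (by norm_num)]; norm_num
  have h6 : (((6 : ℝ≥0) : ℝ≥0∞)) = 6 := by norm_num
  rw [h32, h6] at h1
  refine h1.trans ?_
  rw [ENNReal.coe_mul, mul_assoc]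
  gcongr
  rw [mul_comm]; exact h2

lemma exists_sobolev_const_smooth_three (R : ℝ) :
    ∃ C : ℝ≥0, ∀ w : Rd 3 → Rd 3, ContDiff ℝ 1 w →
      Function.support w ⊆ Metric.closedBall 0 R →
      eLpNorm w 6 volume ≤ C * eLpNorm (fderiv ℝ w) 2 volume := by
  have hfr : Module.finrank ℝ (Rd 3) = 3 := by simp
  refine ⟨eLpNormLESNormFDerivOfLeConst (Rd 3) volume (Metric.closedBall (0 : Rd 3) R) 2 6,
    fun w hw hs => ?_⟩
  have h1 := eLpNorm_le_eLpNorm_fderiv_of_le (volume : Measure (Rd 3)) hw hs (p := 2)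
    (q := 6) (by norm_num) (by rw [hfr]; norm_num) (by rw [hfr]; norm_num)
    Metric.isBounded_closedBall
  exact_mod_cast h1

lemma exists_sobolev_const_smooth (hd : d = 2 ∨ d = 3) (R : ℝ) :
    ∃ C : ℝ≥0, ∀ w : Rd d → Rd d, ContDiff ℝ 1 w →
      Function.support w ⊆ Metric.closedBall 0 R →
      eLpNorm w 6 volume ≤ C * eLpNorm (fderiv ℝ w) 2 volume := by
  rcases hd with rfl | rfl
  · exact exists_sobolev_const_smooth_two R
  · exact exists_sobolev_const_smooth_three R

/-- Fatou's lemma along the mollifications, which converge almost everywhere. -/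
lemma eLpNorm_le_of_moll_le [CompleteSpace F] {f : Rd d → F} (hf : LocallyIntegrable f volume)
    {p C : ℝ≥0∞} (h : ∀ k, eLpNorm (moll k f) p volume ≤ C) : eLpNorm f p volume ≤ C := by
  refine (Lp.eLpNorm_lim_le_liminf_eLpNorm
    (fun k => (contDiff_moll k hf).continuous.aestronglyMeasurable) f (ae_tendsto_moll hf)).trans ?_
  exact (liminf_le_liminf (Eventually.of_forall h)).trans (by simp)

/-- The Sobolev inequality for functions supported in a fixed ball. -/
lemma exists_sobolev_const (hd : d = 2 ∨ d = 3) (R : ℝ) :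
    ∃ C : ℝ≥0, ∀ (v : Rd d → Rd d) (g : Fin d → Rd d → Rd d), MemLp v 2 volume →
      (∀ j, MemLp (g j) 2 volume) → (∀ j, HasWeakPartial univ j v (g j)) →
      (∀ᵐ x, R < ‖x‖ → v x = 0) →
      eLpNorm v 6 volume ≤ C * ∑ j, eLpNorm (g j) 2 volume := by
  obtain ⟨C, hC⟩ := exists_sobolev_const_smooth hd (R + 1)
  refine ⟨C, fun v g hv hg hvg hR => ?_⟩
  have hvl := locallyIntegrable_of_memLp_two hv
  refine eLpNorm_le_of_moll_le hvl fun k => ?_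
  refine (hC _ ((contDiff_moll k hvl).of_le (by norm_cast)) (support_moll_subset k hR)).trans ?_
  gcongr
  calc eLpNorm (fderiv ℝ (moll k v)) 2 volume
      ≤ eLpNorm (∑ j, fun x => ‖moll k (g j) x‖) 2 volume := by
        refine eLpNorm_mono_real fun x => ?_
        rw [Finset.sum_apply]
        refine (norm_le_sum_single _).trans (le_of_eq ?_)
        exact Finset.sum_congr rfl fun j _ => by rw [fderiv_moll k hvl (hvg j)]
    _ ≤ ∑ j, eLpNorm (fun x => ‖moll k (g j) x‖) 2 volume :=
        eLpNorm_sum_le (fun j _ => (memLp_moll k (hg j)).1.norm) (by norm_num)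
    _ ≤ _ := by
        refine Finset.sum_le_sum fun j _ => ?_
        rw [eLpNorm_norm]
        exact eLpNorm_moll_le k (hg j).1

end

section
variable {d : ℕ} {Ω : Set (Rd d)}

/-! ### `H¹` fields vanishing outside `Ω` -/

/-- `v ∈ H¹(ℝᵈ; ℝᵈ)` and `v = 0` outside `Ω`. -/
def MemH1Zero (Ω : Set (Rd d)) (v : Rd d → Rd d) : Prop :=
  MemH1 v ∧ ∀ᵐ x, x ∉ Ω → v x = 0

lemma MemH1Zero.memLp {v : Rd d → Rd d} (h : MemH1Zero Ω v) : MemLp v 2 volume := h.1.1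

lemma MemH1Zero.memLp_partialD {v : Rd d → Rd d} (h : MemH1Zero Ω v) (j : Fin d) :
    MemLp (partialD j v) 2 volume := (partialD_spec h.1 j).1

/-- The boundary of `Ω` may have positive measure, so locality on the exterior is not enough; the
derivative vanishes almost everywhere on the whole zero set of `v`. This lets integrals over `Ω` and
over the whole space be interchanged. -/
lemma MemH1Zero.partialD_eq_zero {v : Rd d → Rd d} (h : MemH1Zero Ω v) (j : Fin d) :
    ∀ᵐ x, x ∉ Ω → partialD j v x = 0 := by
  filter_upwards [h.2, (partialD_spec h.1 j).2.ae_eq_zero_of_eq_zero_vec h.1.1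
    (partialD_spec h.1 j).1] with x h1 h2 hx using h2 (h1 hx)

lemma setIntegral_eq_integral_of_ae_zero {X : Type*} [MeasurableSpace X] {μ : Measure X}
    {s : Set X} {f : X → ℝ} (h : ∀ᵐ x ∂μ, x ∉ s → f x = 0) : ∫ x in s, f x ∂μ = ∫ x, f x ∂μ :=
  setIntegral_eq_integral_of_ae_compl_eq_zero h

lemma MemH1Zero.gradNormSq_eq {v : Rd d → Rd d} (h : MemH1Zero Ω v) :
    gradNormSq Ω v = ∑ j, nrm 2 volume (partialD j v) ^ 2 := by
  have h1 : ∀ j, Integrable (fun x => ‖partialD j v x‖ ^ 2) volume := fun j =>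
    (h.memLp_partialD j).integrable_norm_pow (by norm_num)
  rw [gradNormSq, integral_finsetSum _ fun j _ => (h1 j).integrableOn]
  refine Finset.sum_congr rfl fun j _ => ?_
  rw [nrm_two_sq (h.memLp_partialD j), setIntegral_eq_integral_of_ae_zero]
  filter_upwards [h.partialD_eq_zero j] with x hx hxΩ
  simp [hx hxΩ]

lemma gradNormSq_nonneg (v : Rd d → Rd d) : 0 ≤ gradNormSq Ω v :=
  integral_nonneg fun _ => Finset.sum_nonneg fun _ _ => by positivity

lemma MemH1Zero.nrm_partialD_le {v : Rd d → Rd d} (h : MemH1Zero Ω v) (j : Fin d) :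
    nrm 2 volume (partialD j v) ≤ √(gradNormSq Ω v) := by
  refine Real.le_sqrt_of_sq_le ?_
  rw [h.gradNormSq_eq]
  exact Finset.single_le_sum (f := fun j => nrm 2 volume (partialD j v) ^ 2)
    (fun j _ => by positivity) (Finset.mem_univ j)

lemma MemH1Zero.sum_nrm_partialD_le {v : Rd d → Rd d} (h : MemH1Zero Ω v) :
    ∑ j, nrm 2 volume (partialD j v) ≤ d * √(gradNormSq Ω v) := by
  refine (Finset.sum_le_sum fun j _ => h.nrm_partialD_le j).trans (by simp)

/-- The support condition is stated on the unit neighbourhood of `Ω`, and the derivatives `g` are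
free, so that the same constant applies to `v`, to its mollifications and to their difference. -/
lemma exists_memH1Zero_sobolev (hd : d = 2 ∨ d = 3) (hΩb : Bornology.IsBounded Ω) :
    ∃ K : ℝ, 0 ≤ K ∧ ∀ (v : Rd d → Rd d) (g : Fin d → Rd d → Rd d), MemLp v 2 volume →
      (∀ j, MemLp (g j) 2 volume) → (∀ j, HasWeakPartial univ j v (g j)) →
      (∀ᵐ x, x ∉ Metric.cthickening 1 Ω → v x = 0) →
      MemLp v 6 volume ∧ nrm 6 volume v ≤ K * ∑ j, nrm 2 volume (g j) := by
  obtain ⟨R, hR⟩ := (hΩb.cthickening (δ := 1)).subset_closedBall (0 : Rd d)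
  obtain ⟨C, hC⟩ := exists_sobolev_const hd R
  refine ⟨C, C.2, fun v g hv hg hvg h0 => ?_⟩
  have h1 := hC v g hv hg hvg (by
    filter_upwards [h0] with x hx hxR
    refine hx fun hmem => ?_
    have := hR hmem
    simp only [Metric.mem_closedBall, dist_zero_right] at this
    linarith)
  have hs : ∑ j, eLpNorm (g j) 2 volume ≠ ⊤ := ENNReal.sum_ne_top.2 fun j _ => (hg j).2.ne
  have hf : (C : ℝ≥0∞) * ∑ j, eLpNorm (g j) 2 volume ≠ ⊤ := ENNReal.mul_ne_top (by simp) hs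
  refine ⟨⟨hv.1, h1.trans_lt (lt_top_iff_ne_top.2 hf)⟩, ?_⟩
  have h2 := ENNReal.toReal_mono hf h1
  rw [ENNReal.toReal_mul, ENNReal.toReal_sum fun j _ => (hg j).2.ne] at h2
  exact h2

lemma hasWeakPartial_of_contDiff {F : Type} [NormedAddCommGroup F] [NormedSpace ℝ F]
    {f : Rd d → F} (hf : ContDiff ℝ 1 f) (j : Fin d) :
    HasWeakPartial univ j f fun x => fderiv ℝ f x (EuclideanSpace.single j 1) := by
  intro φ hφ hc _
  simp only [Measure.restrict_univ]
  have cd := continuous_partial_of_contDiff hφ (EuclideanSpace.single j 1)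
  have sd := hasCompactSupport_partial hc (EuclideanSpace.single j 1)
  have cf : Continuous fun x => fderiv ℝ f x (EuclideanSpace.single j 1) :=
    (hf.continuous_fderiv (by simp)).clm_apply continuous_const
  have := integral_smul_fderiv_eq_neg_fderiv_smul_of_integrable
    (μ := (volume : Measure (Rd d))) (𝕜 := ℝ) (f := φ) (g := f) (v := EuclideanSpace.single j 1)
    ((cd.smul hf.continuous).integrable_of_hasCompactSupport sd.smul_right)
    ((hφ.continuous.smul cf).integrable_of_hasCompactSupport hc.smul_right)
    ((hφ.continuous.smul hf.continuous).integrable_of_hasCompactSupport hc.smul_right)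
    (fun x _ => hφ.differentiable (by simp) x) (fun x _ => hf.differentiable (by simp) x)
  rw [this, neg_neg]

lemma hasWeakPartial_moll {F : Type} [NormedAddCommGroup F] [NormedSpace ℝ F] [CompleteSpace F]
    (k : ℕ) {f g : Rd d → F} {j : Fin d} (hf : LocallyIntegrable f volume)
    (hfg : HasWeakPartial univ j f g) : HasWeakPartial univ j (moll k f) (moll k g) := by
  have := hasWeakPartial_of_contDiff ((contDiff_moll k hf).of_le (by norm_cast)) j
  simpa only [fderiv_moll k hf hfg] using this

lemma moll_eq_zero_of_notMem_cthickening {F : Type} [NormedAddCommGroup F] [NormedSpace ℝ F]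
    (k : ℕ) {f : Rd d → F} (hf : ∀ᵐ x, x ∉ Ω → f x = 0) {x : Rd d}
    (hx : x ∉ Metric.cthickening 1 Ω) : moll k f x = 0 := by
  rw [moll_apply_swap]
  refine integral_eq_zero_of_ae ?_
  filter_upwards [hf] with y hy
  by_cases h : y ∈ Ω
  · have : (bump d k).normed volume (x - y) = 0 := by
      by_contra hne
      have h2 : x - y ∈ Function.support ((bump d k).normed volume) := hne
      rw [(bump d k).support_normed_eq] at h2
      simp only [Metric.mem_ball, dist_zero_right] at h2
      have h3 : (bump d k).rOut ≤ 1 := by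
        simp only [bump]
        rw [div_le_one (by positivity)]
        linarith [(Nat.cast_nonneg k : (0 : ℝ) ≤ k)]
      refine hx (Metric.mem_cthickening_of_dist_le x y 1 Ω h ?_)
      rw [dist_eq_norm]; linarith
    simp [this]
  · simp [hy h]

/-! ### Solenoidal fields -/

/-- `w` is divergence free on `ℝᵈ` in the sense of distributions. -/
def IsSolenoidal (w : Rd d → Rd d) : Prop :=
  ∀ φ : Rd d → ℝ, ContDiff ℝ ∞ φ → HasCompactSupport φ → ∫ x, fderiv ℝ φ x (w x) = 0

lemma clm_apply_eq_sum {F : Type*} [NormedAddCommGroup F] [NormedSpace ℝ F] (L : Rd d →L[ℝ] F)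
    (x : Rd d) : L x = ∑ j, x j • L (EuclideanSpace.single j 1) := by
  have hx : x = ∑ j, x j • EuclideanSpace.single j (1 : ℝ) := by
    simpa using ((EuclideanSpace.basisFun (Fin d) ℝ).sum_repr x).symm
  conv_lhs => rw [hx, map_sum]
  simp_rw [map_smul]

lemma MemLp.coord {v : Rd d → Rd d} {p : ℝ≥0∞} (hv : MemLp v p volume) (j : Fin d) :
    MemLp (fun x => v x j) p volume :=
  (EuclideanSpace.proj (𝕜 := ℝ) j : Rd d →L[ℝ] ℝ).comp_memLp' hv

/-- Off `Ω` all partial derivatives vanish, so the divergence is zero on the whole space and the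
extension by zero creates no boundary flux; test functions therefore need not vanish near the
boundary. -/
lemma MemH1Zero.isSolenoidal {w : Rd d → Rd d} (hw : MemH1Zero Ω w)
    (hΩ : MeasurableSet Ω)
    (h : ∀ᵐ x ∂(volume.restrict Ω), divergence w x = 0) : IsSolenoidal w := by
  intro φ hφ hc
  have h0 : ∀ᵐ x, divergence w x = 0 := by
    rw [ae_restrict_iff' hΩ] at h
    filter_upwards [h, ae_all_iff.2 hw.partialD_eq_zero] with x h1 h2
    by_cases hx : x ∈ Ω
    · exact h1 hx
    · simp [divergence, h2 _ hx]
  have hj : ∀ j : Fin d, ∫ x, w x j * fderiv ℝ φ x (EuclideanSpace.single j 1)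
      = -∫ x, φ x * partialD j w x j := by
    intro j
    have h1 := ((partialD_spec hw.1 j).2.clm_comp (locallyIntegrable_of_memLp_two hw.memLp)
      (locallyIntegrable_of_memLp_two (hw.memLp_partialD j))
      (EuclideanSpace.proj (𝕜 := ℝ) j : Rd d →L[ℝ] ℝ)) φ hφ hc (subset_univ _)
    simpa [mul_comm] using h1
  have hi : ∀ j : Fin d, Integrable (fun x => w x j * fderiv ℝ φ x (EuclideanSpace.single j 1))
      volume := fun j => memLp_one_iff_integrable.1
    ((memLp_of_continuous_hasCompactSupport (continuous_partial_of_contDiff hφ _)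
      (hasCompactSupport_partial hc _) 2).mul (MemLp.coord hw.memLp j))
  have hi2 : ∀ j : Fin d, Integrable (fun x => φ x * partialD j w x j)
      volume := fun j => memLp_one_iff_integrable.1
    ((MemLp.coord (hw.memLp_partialD j) j).mul
      (memLp_of_continuous_hasCompactSupport hφ.continuous hc 2))
  simp_rw [clm_apply_eq_sum (fderiv ℝ φ _) (w _), smul_eq_mul]
  rw [integral_finsetSum _ fun j _ => hi j]
  simp_rw [hj]
  rw [Finset.sum_neg_distrib, ← integral_finsetSum _ fun j _ => hi2 j, neg_eq_zero]
  refine integral_eq_zero_of_ae ?_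
  filter_upwards [h0] with x hx
  rw [← Finset.mul_sum]
  simp only [divergence] at hx
  rw [hx, mul_zero]; rfl

/-- For each test function the condition is linear and L²-continuous in the field, hence closed. It
serves at the initial time, where the divergence condition is not imposed. -/
lemma IsSolenoidal.of_tendsto {w : Rd d → Rd d} {wk : ℕ → Rd d → Rd d} (hw : MemLp w 2 volume)
    (hwk : ∀ k, MemLp (wk k) 2 volume) (h : ∀ k, IsSolenoidal (wk k))
    (hlim : Tendsto (fun k => nrm 2 volume (wk k - w)) atTop (𝓝 0)) : IsSolenoidal w := by
  intro φ hφ hc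
  have hφ' : MemLp (fderiv ℝ φ) 2 volume :=
    memLp_of_continuous_hasCompactSupport (hφ.continuous_fderiv (by simp)) (hc.fderiv ℝ) 2
  have hi : ∀ v : Rd d → Rd d, MemLp v 2 volume → Integrable (fun x => fderiv ℝ φ x (v x)) volume ∧
      ‖∫ x, fderiv ℝ φ x (v x)‖ ≤ nrm 2 volume (fderiv ℝ φ) * nrm 2 volume v := by
    intro v hv
    have hb : ∀ᵐ x, ‖fderiv ℝ φ x (v x)‖ ≤ ‖fderiv ℝ φ x‖ * ‖v x‖ :=
      Eventually.of_forall fun x => ContinuousLinearMap.le_opNorm _ _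
    have hI := integrable_norm_mul_norm hφ' hv
    refine ⟨hI.mono' ?_ hb, (norm_integral_le_of_norm_le hI hb).trans
      (integral_norm_mul_norm_le hφ' hv)⟩
    exact (isBoundedBilinearMap_apply.continuous).comp_aestronglyMeasurable (hφ'.1.prodMk hv.1)
  have hle : ∀ k, ‖∫ x, fderiv ℝ φ x (w x)‖ ≤
      nrm 2 volume (fderiv ℝ φ) * nrm 2 volume (wk k - w) := by
    intro k
    have h1 := (hi _ ((hwk k).sub hw)).2
    simp only [Pi.sub_apply, map_sub] at h1
    rwa [integral_sub (hi _ (hwk k)).1 (hi _ hw).1, h k φ hφ hc, zero_sub, norm_neg] at h1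
  have := ge_of_tendsto (hlim.const_mul (nrm 2 volume (fderiv ℝ φ))) (Eventually.of_forall hle)
  rw [mul_zero] at this
  exact norm_le_zero_iff.1 this

end

section
variable {d : ℕ} {Ω : Set (Rd d)}

/-! ### The trilinear form -/

/-- `∫ ∑ⱼ wⱼ Gⱼ · v` over `ℝᵈ`. -/
def tri (w : Rd d → Rd d) (G : Fin d → Rd d → Rd d) (v : Rd d → Rd d) : ℝ :=
  ∫ x, ∑ j, w x j * inner ℝ (G j x) (v x)

section tri
variable {w v : Rd d → Rd d} {G : Fin d → Rd d → Rd d}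

lemma norm_tri_integrand_le (x : Rd d) :
    ‖∑ j, w x j * inner ℝ (G j x) (v x)‖ ≤ ∑ j, ‖w x‖ * ‖G j x‖ * ‖v x‖ := by
  refine (norm_sum_le _ _).trans (Finset.sum_le_sum fun j _ => ?_)
  rw [norm_mul, mul_assoc]
  gcongr
  · exact PiLp.norm_apply_le _ _
  · exact norm_inner_le_norm _ _

lemma integrable_tri (hw : MemLp w 3 volume) (hG : ∀ j, MemLp (G j) 2 volume)
    (hv : MemLp v 6 volume) : Integrable (fun x => ∑ j, w x j * inner ℝ (G j x) (v x)) volume := by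
  refine (integrable_finsetSum (f := fun j x => ‖w x‖ * ‖G j x‖ * ‖v x‖) Finset.univ
    fun j _ => integrable_norm_mul_norm_mul_norm hw (hG j) hv).mono' ?_
    (Eventually.of_forall norm_tri_integrand_le)
  refine Finset.aestronglyMeasurable_fun_sum _ fun j _ => ?_
  exact (MemLp.coord hw j).1.mul ((hG j).1.inner hv.1)

lemma abs_tri_le (hw : MemLp w 3 volume) (hG : ∀ j, MemLp (G j) 2 volume)
    (hv : MemLp v 6 volume) :
    |tri w G v| ≤ nrm 3 volume w * (∑ j, nrm 2 volume (G j)) * nrm 6 volume v := by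
  have hi := fun j => integrable_norm_mul_norm_mul_norm hw (hG j) hv
  refine (norm_integral_le_of_norm_le (integrable_finsetSum _ fun j _ => hi j)
    (Eventually.of_forall norm_tri_integrand_le)).trans ?_
  rw [integral_finsetSum _ fun j _ => hi j, Finset.mul_sum, Finset.sum_mul]
  exact Finset.sum_le_sum fun j _ => integral_norm_mul_norm_mul_norm_le hw (hG j) hv

lemma triForm_eq_tri {u : Rd d → Rd d} (hv : ∀ᵐ x, x ∉ Ω → v x = 0) :
    triForm Ω w u v = tri w (fun j => partialD j u) v := by
  rw [triForm, tri, setIntegral_eq_integral_of_ae_zero]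
  filter_upwards [hv] with x hx hxΩ
  simp [hx hxΩ]

lemma tri_sub_sub {v' : Rd d → Rd d} {G' : Fin d → Rd d → Rd d} (hw : MemLp w 3 volume)
    (hG : ∀ j, MemLp (G j) 2 volume) (hv : MemLp v 6 volume)
    (hG' : ∀ j, MemLp (G' j) 2 volume) (hv' : MemLp v' 6 volume) :
    tri w G v - tri w G' v' = tri w (fun j => G j - G' j) v + tri w G' (v - v') := by
  rw [tri, tri, tri, tri, ← integral_sub (integrable_tri hw hG hv) (integrable_tri hw hG' hv'),
    ← integral_add (integrable_tri hw (fun j => (hG j).sub (hG' j)) hv)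
      (integrable_tri hw hG' (hv.sub hv'))]
  refine integral_congr_ae (Eventually.of_forall fun x => ?_)
  simp only [Pi.sub_apply, inner_sub_left, inner_sub_right, mul_sub, Finset.sum_sub_distrib]
  ring

/-- `|moll k e|²` is an admissible test function for solenoidality, and its derivative along `w` is
twice the integrand. -/
lemma tri_moll_self (hw : IsSolenoidal w) {e : Rd d → Rd d} (he : MemH1Zero Ω e)
    (hΩb : Bornology.IsBounded Ω) (k : ℕ) :
    tri w (fun j => moll k (partialD j e)) (moll k e) = 0 := by
  have hel := locallyIntegrable_of_memLp_two he.memLp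
  have hsm := contDiff_moll k hel
  obtain ⟨R, hR⟩ := hΩb.subset_closedBall (0 : Rd d)
  have h0 : ∀ᵐ x, R < ‖x‖ → e x = 0 := by
    filter_upwards [he.2] with x hx hxR
    refine hx fun hmem => ?_
    have := hR hmem
    simp only [Metric.mem_closedBall, dist_zero_right] at this
    linarith
  have h1 := hw (fun x => ‖moll k e x‖ ^ 2) (hsm.norm_sq ℝ)
    ((hasCompactSupport_moll k h0).comp_left (g := fun y => ‖y‖ ^ 2) (by simp))
  have h2 : ∀ x, fderiv ℝ (fun x => ‖moll k e x‖ ^ 2) x (w x)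
      = 2 * ∑ j, w x j * inner ℝ (moll k (partialD j e) x) (moll k e x) := by
    intro x
    have h3 : HasFDerivAt (moll k e) (fderiv ℝ (moll k e) x) x :=
      (hsm.differentiable (by simp) x).hasFDerivAt
    rw [h3.norm_sq.fderiv]
    simp only [_root_.smul_apply, ContinuousLinearMap.comp_apply, innerSL_apply_apply,
      nsmul_eq_mul, Nat.cast_ofNat]
    rw [clm_apply_eq_sum (fderiv ℝ (moll k e) x) (w x), inner_sum]
    congr 1
    refine Finset.sum_congr rfl fun j _ => ?_
    rw [inner_smul_right, fderiv_moll k hel (partialD_spec he.1 j).2, real_inner_comm]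
  simp_rw [h2] at h1
  rw [integral_const_mul] at h1
  simpa [tri] using h1

/-- The convective term is skew-symmetric for solenoidal transport fields. -/
lemma tri_self_eq_zero (hd : d = 2 ∨ d = 3) (hΩb : Bornology.IsBounded Ω) (hw : IsSolenoidal w)
    (hw3 : MemLp w 3 volume) {e : Rd d → Rd d} (he : MemH1Zero Ω e) :
    tri w (fun j => partialD j e) e = 0 := by
  obtain ⟨K, hK, hS⟩ := exists_memH1Zero_sobolev hd hΩb
  have hel := locallyIntegrable_of_memLp_two he.memLp
  have hp := he.memLp_partialD
  have hpl := fun j => locallyIntegrable_of_memLp_two (hp j)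
  have hwp := fun j => (partialD_spec he.1 j).2
  have hΩ0 : ∀ᵐ x, x ∉ Metric.cthickening 1 Ω → e x = 0 := by
    filter_upwards [he.2] with x hx hxΩ using hx fun h => hxΩ (Metric.self_subset_cthickening _ h)
  have hm0 : ∀ k, ∀ x, x ∉ Metric.cthickening 1 Ω → moll k e x = 0 := fun k x hx =>
    moll_eq_zero_of_notMem_cthickening k he.2 hx
  have he6 := (hS e _ he.memLp hp hwp hΩ0).1
  have hmk := fun k => hS (moll k e) (fun j => moll k (partialD j e)) (memLp_moll k he.memLp)
    (fun j => memLp_moll k (hp j)) (fun j => hasWeakPartial_moll k hel (hwp j))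
    (Eventually.of_forall (hm0 k))
  set δ : ℕ → ℝ := fun k => ∑ j, nrm 2 volume (moll k (partialD j e) - partialD j e) with hδ
  have hδ0 : Tendsto δ atTop (𝓝 0) := by
    have := tendsto_finsetSum Finset.univ fun j _ => tendsto_nrm_moll_sub (hp j)
    simpa using this
  set S := ∑ j, nrm 2 volume (partialD j e) with hSdef
  have hS0 : 0 ≤ S := Finset.sum_nonneg fun j _ => nrm_nonneg _ _
  -- Sobolev for the difference turns L² convergence of the gradients into L⁶ convergence of the
  -- functions.
  have hdiff : ∀ k, nrm 6 volume (moll k e - e) ≤ K * δ k := fun k =>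
    (hS (moll k e - e) (fun j => moll k (partialD j e) - partialD j e)
      ((memLp_moll k he.memLp).sub he.memLp)
      (fun j => (memLp_moll k (hp j)).sub (hp j))
      (fun j => (hasWeakPartial_moll k hel (hwp j)).sub
        (locallyIntegrable_of_memLp_two (memLp_moll k he.memLp)) hel
        (locallyIntegrable_of_memLp_two (memLp_moll k (hp j))) (hpl j) (hwp j))
      (by filter_upwards [hΩ0] with x hx hxΩ; simp [hx hxΩ, hm0 k x hxΩ])).2
  have hm6 : ∀ k, nrm 6 volume (moll k e) ≤ K * S := by
    intro k
    refine (hmk k).2.trans (mul_le_mul_of_nonneg_left (Finset.sum_le_sum fun j _ => ?_) hK)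
    exact ENNReal.toReal_mono (hp j).2.ne (eLpNorm_moll_le k (hp j).1)
  -- Comparison with the mollified form, which is zero, leaves one error from the gradient and one
  -- from the test function; both are controlled by `δ k`.
  have hle : ∀ k, |tri w (fun j => partialD j e) e| ≤
      nrm 3 volume w * δ k * (K * S) + nrm 3 volume w * S * (K * δ k) := by
    intro k
    have h1 := tri_sub_sub hw3 (fun j => memLp_moll k (hp j)) (hmk k).1 hp he6
    rw [tri_moll_self hw he hΩb k, zero_sub] at h1
    have hδk : 0 ≤ δ k := Finset.sum_nonneg fun j _ => nrm_nonneg _ _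
    have hw0 := nrm_nonneg 3 w (μ := volume)
    rw [← abs_neg, h1]
    refine (abs_add_le _ _).trans (add_le_add ?_ ?_)
    · exact (abs_tri_le hw3 (fun j => (memLp_moll k (hp j)).sub (hp j)) (hmk k).1).trans
        (mul_le_mul_of_nonneg_left (hm6 k) (mul_nonneg hw0 hδk))
    · exact (abs_tri_le hw3 hp ((hmk k).1.sub he6)).trans
        (mul_le_mul_of_nonneg_left (hdiff k) (mul_nonneg hw0 hS0))
  have hlim : Tendsto (fun k => nrm 3 volume w * δ k * (K * S) + nrm 3 volume w * S * (K * δ k))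
      atTop (𝓝 0) := by
    have := ((hδ0.const_mul (nrm 3 volume w)).mul_const (K * S)).add
      ((hδ0.const_mul K).const_mul (nrm 3 volume w * S))
    simpa using this
  exact abs_nonpos_iff.1 (ge_of_tendsto hlim (Eventually.of_forall hle))

end tri

/-! ### Weak lower semicontinuity of the gradient norm -/

lemma tendsto_integral_smul_of_nrm {F : Type} [NormedAddCommGroup F] [NormedSpace ℝ F]
    {ψ : Rd d → ℝ} {v : Rd d → F} {vk : ℕ → Rd d → F} (hψ : MemLp ψ 2 volume)
    (hv : MemLp v 2 volume) (hvk : ∀ k, MemLp (vk k) 2 volume)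
    (hlim : Tendsto (fun k => nrm 2 volume (vk k - v)) atTop (𝓝 0)) :
    Tendsto (fun k => ∫ x, ψ x • vk k x) atTop (𝓝 (∫ x, ψ x • v x)) := by
  have hi : ∀ g : Rd d → F, MemLp g 2 volume → Integrable (fun x => ψ x • g x) volume :=
    fun g hg => memLp_one_iff_integrable.1 (hg.smul hψ)
  rw [tendsto_iff_norm_sub_tendsto_zero]
  refine squeeze_zero (fun _ => norm_nonneg _) (fun k => ?_)
    (by simpa using hlim.const_mul (nrm 2 volume ψ))
  rw [← integral_sub (hi _ (hvk k)) (hi _ hv)]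
  have hd := (hvk k).sub hv
  refine (norm_integral_le_of_norm_le (integrable_norm_mul_norm hψ hd)
    (Eventually.of_forall fun x => ?_)).trans (integral_norm_mul_norm_le hψ hd)
  rw [← smul_sub, norm_smul]; rfl

/-- After mollification the derivative falls on the kernel, so L² convergence of `vk` alone makes
`moll m (gk k)` converge pointwise. Fatou bounds `moll m g`, and `m` is arbitrary. -/
lemma eLpNorm_weakPartial_le_of_tendsto {F : Type} [NormedAddCommGroup F] [NormedSpace ℝ F]
    [CompleteSpace F] {j : Fin d} {v g : Rd d → F} {vk gk : ℕ → Rd d → F} {M : ℝ≥0∞}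
    (hv : MemLp v 2 volume) (hg : MemLp g 2 volume) (hvk : ∀ k, MemLp (vk k) 2 volume)
    (hgk : ∀ k, MemLp (gk k) 2 volume) (h : HasWeakPartial univ j v g)
    (hk : ∀ k, HasWeakPartial univ j (vk k) (gk k)) (hM : ∀ k, eLpNorm (gk k) 2 volume ≤ M)
    (hlim : Tendsto (fun k => nrm 2 volume (vk k - v)) atTop (𝓝 0)) :
    eLpNorm g 2 volume ≤ M := by
  refine eLpNorm_le_of_moll_le (locallyIntegrable_of_memLp_two hg) fun m => ?_
  set ρ := (bump d m).normed (volume : Measure (Rd d)) with hρ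
  have hρs : ContDiff ℝ ∞ ρ := (bump d m).contDiff_normed
  have hρc : HasCompactSupport ρ := (bump d m).hasCompactSupport_normed
  have hpt : ∀ x, Tendsto (fun k => moll m (gk k) x) atTop (𝓝 (moll m g x)) := by
    intro x
    have s1 : ContDiff ℝ ∞ fun y => ρ (x - y) := hρs.comp (by fun_prop)
    have s2 : HasCompactSupport fun y => ρ (x - y) := hρc.comp_homeomorph (Homeomorph.subLeft x)
    have key : ∀ v g : Rd d → F, HasWeakPartial univ j v g → moll m g x =
        -∫ y, fderiv ℝ (fun y => ρ (x - y)) y (EuclideanSpace.single j 1) • v y := by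
      intro v g h
      have := h _ s1 s2 (subset_univ _)
      simp only [Measure.restrict_univ] at this
      rw [this, neg_neg, moll_apply_swap]
    rw [key v g h]
    simp_rw [fun k => key _ _ (hk k)]
    exact (tendsto_integral_smul_of_nrm (memLp_of_continuous_hasCompactSupport
      (continuous_partial_of_contDiff s1 _) (hasCompactSupport_partial s2 _) 2) hv hvk hlim).neg
  refine (Lp.eLpNorm_lim_le_liminf_eLpNorm (fun k => (memLp_moll m (hgk k)).1) _
    (Eventually.of_forall hpt)).trans ?_
  exact (liminf_le_liminf (Eventually.of_forall fun k =>
    (eLpNorm_moll_le m (hgk k).1).trans (hM k))).trans (by simp)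

end

section
/-! ### Weak derivatives in time -/

section Time
variable {T : ℝ}

/-- The zero mean is what makes the primitive vanish to the right of the support, hence a test
function again. -/
lemma exists_primitive_test {f : ℝ → ℝ} (hf : ContDiff ℝ ∞ f) (hc : HasCompactSupport f)
    (hs : tsupport f ⊆ Ioo 0 T) (h0 : ∫ s, f s = 0) :
    ContDiff ℝ ∞ (fun t => ∫ s in (0 : ℝ)..t, f s) ∧
      HasCompactSupport (fun t => ∫ s in (0 : ℝ)..t, f s) ∧
      tsupport (fun t => ∫ s in (0 : ℝ)..t, f s) ⊆ Ioo 0 T ∧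
      ∀ t, deriv (fun t => ∫ s in (0 : ℝ)..t, f s) t = f t := by
  have hder : ∀ t, HasDerivAt (fun t => ∫ s in (0 : ℝ)..t, f s) (f t) t := fun t =>
    intervalIntegral.integral_hasDerivAt_right (hf.continuous.intervalIntegrable _ _)
      (hf.continuous.stronglyMeasurableAtFilter _ _) hf.continuous.continuousAt
  have hderiv : deriv (fun t => ∫ s in (0 : ℝ)..t, f s) = f := funext fun t => (hder t).deriv
  obtain ⟨a, b, ha, hb, hab⟩ : ∃ a b : ℝ, 0 < a ∧ b < T ∧ tsupport f ⊆ Icc a b := by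
    rcases (tsupport f).eq_empty_or_nonempty with he | hne
    · exact ⟨1, T - 1, one_pos, by linarith, by simp [he]⟩
    · exact ⟨sInf (tsupport f), sSup (tsupport f), (hs (hc.isCompact.sInf_mem hne)).1,
        (hs (hc.isCompact.sSup_mem hne)).2, fun x hx =>
        ⟨csInf_le hc.isCompact.bddBelow hx, le_csSup hc.isCompact.bddAbove hx⟩⟩
  have hfz : ∀ s, s ∉ Icc a b → f s = 0 := fun s hs' =>
    image_eq_zero_of_notMem_tsupport fun h => hs' (hab h)
  have hsup : Function.support (fun t => ∫ s in (0 : ℝ)..t, f s) ⊆ Icc a b := by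
    intro t ht
    by_contra hnot
    apply ht
    rcases lt_or_ge t a with hta | hta
    · refine intervalIntegral.integral_zero_ae (Eventually.of_forall fun s hs' => hfz s fun h => ?_)
      have h1 : s ≤ max 0 t := hs'.2
      have h2 : max 0 t < a := max_lt ha hta
      linarith [h.1]
    · have htb : b < t := by
        by_contra h
        exact hnot ⟨hta, not_lt.1 h⟩
      show ∫ s in (0 : ℝ)..t, f s = 0
      rw [intervalIntegral.integral_eq_integral_of_support_subset, h0]
      intro s hs'
      by_contra h
      exact hs' (hfz s fun h2 => h ⟨by linarith [h2.1], by linarith [h2.2]⟩)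
  refine ⟨contDiff_infty_iff_deriv.2 ⟨fun t => (hder t).differentiableAt, by rwa [hderiv]⟩,
    HasCompactSupport.of_support_subset_isCompact isCompact_Icc hsup,
    (closure_minimal hsup isClosed_Icc).trans fun t ht => ⟨by linarith [ht.1], by linarith [ht.2]⟩,
    fun t => (hder t).deriv⟩

variable {B : Type} [NormedAddCommGroup B] [NormedSpace ℝ B] [CompleteSpace B]

/-- Fubini on the triangle `s ≤ t` produces the integral of `f` from `s` to `T`, and the zero mean
turns it into minus the integral from `0` to `s`. -/
lemma integral_smul_primitive {f : ℝ → ℝ} (hf : Continuous f) (hc : HasCompactSupport f)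
    (hs : tsupport f ⊆ Ioo 0 T) (h0 : ∫ s, f s = 0) {V : ℝ → B}
    (hV : IntegrableOn V (Ioo 0 T)) :
    ∫ t in Ioo 0 T, f t • ∫ s in (0 : ℝ)..t, V s
      = -∫ t in Ioo 0 T, (∫ s in (0 : ℝ)..t, f s) • V t := by
  set μ : Measure ℝ := volume.restrict (Ioo 0 T) with hμ
  have hfi : Integrable f μ := (hf.integrable_of_hasCompactSupport hc).integrableOn
  set k : ℝ → ℝ → ℝ := fun t s => (Iic t).indicator 1 s with hk
  have hkm : Measurable fun z : ℝ × ℝ => k z.1 z.2 := by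
    have : (fun z : ℝ × ℝ => k z.1 z.2) = ({z : ℝ × ℝ | z.2 ≤ z.1}).indicator 1 := by
      funext z; simp [hk, indicator]
    rw [this]
    exact measurable_one.indicator (measurableSet_le measurable_snd measurable_fst)
  have hint : Integrable (fun z : ℝ × ℝ => k z.1 z.2 • (f z.1 • V z.2)) (μ.prod μ) := by
    refine Integrable.bdd_smul (hfi.smul_prod hV) 1 hkm.aestronglyMeasurable
      (Eventually.of_forall fun z => ?_)
    simp only [hk, indicator]
    split_ifs <;> simp
  have h1 : ∀ t ∈ Ioo 0 T, f t • ∫ s in (0 : ℝ)..t, V s = ∫ s, k t s • (f t • V s) ∂μ := by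
    intro t ht
    rw [intervalIntegral.integral_of_le ht.1.le, ← integral_smul, hμ,
      ← integral_indicator measurableSet_Ioc, ← integral_indicator measurableSet_Ioo]
    refine integral_congr_ae (Eventually.of_forall fun s => ?_)
    simp only [hk, indicator, mem_Ioc, mem_Ioo, mem_Iic]
    by_cases hs1 : 0 < s <;> by_cases hs2 : s ≤ t
    · simp [hs1, hs2, hs2.trans_lt ht.2]
    · simp [hs1, hs2]
    · simp [hs1]
    · simp [hs1]
  have h2 : ∀ s ∈ Ioo 0 T, ∫ t, k t s • (f t • V s) ∂μ = -((∫ r in (0 : ℝ)..s, f r) • V s) := by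
    intro s hs'
    have hT : (0 : ℝ) ≤ T := (hs'.1.trans hs'.2).le
    have e1 : ∫ t, k t s • (f t • V s) ∂μ = (∫ t in s..T, f t) • V s := by
      have e0 : ∫ t in s..T, f t = ∫ t in Ico s T, f t := by
        rw [intervalIntegral.integral_of_le hs'.2.le, integral_Ioc_eq_integral_Ioo,
          integral_Ico_eq_integral_Ioo]
      simp_rw [smul_smul]
      rw [integral_smul_const, e0, hμ, ← integral_indicator measurableSet_Ico, ← integral_indicator measurableSet_Ioo]
      congr 1
      refine integral_congr_ae (Eventually.of_forall fun t => ?_)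
      simp only [hk, indicator, mem_Ico, mem_Ioo, mem_Iic]
      by_cases ht1 : s ≤ t <;> by_cases ht2 : t < T
      · simp [ht1, ht2, hs'.1.trans_le ht1]
      · simp [ht2]
      · simp [ht1]
      · simp [ht1, ht2]
    have e2 : (∫ r in (0 : ℝ)..s, f r) + ∫ t in s..T, f t = 0 := by
      rw [intervalIntegral.integral_add_adjacent_intervals (hf.intervalIntegrable _ _)
        (hf.intervalIntegrable _ _), intervalIntegral.integral_eq_integral_of_support_subset, h0]
      exact ((subset_tsupport f).trans hs).trans Ioo_subset_Ioc_self
    rw [e1, eq_neg_of_add_eq_zero_right e2, neg_smul]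
  calc ∫ t in Ioo 0 T, f t • ∫ s in (0 : ℝ)..t, V s
      = ∫ t, ∫ s, k t s • (f t • V s) ∂μ ∂μ := setIntegral_congr_fun measurableSet_Ioo h1
    _ = ∫ s, ∫ t, k t s • (f t • V s) ∂μ ∂μ := integral_integral_swap hint
    _ = ∫ s in Ioo 0 T, -((∫ r in (0 : ℝ)..s, f r) • V s) :=
        setIntegral_congr_fun measurableSet_Ioo h2
    _ = _ := integral_neg _

/-- A function with an integrable weak derivative is a.e. a primitive of it. -/
lemma HasWeakTimeDeriv.ae_eq_primitive (hT : 0 < T) {U V : ℝ → B}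
    (h : HasWeakTimeDeriv T U V) (hU : IntegrableOn U (Ioo 0 T)) (hV : IntegrableOn V (Ioo 0 T)) :
    ∃ c : B, ∀ᵐ t, t ∈ Ioo 0 T → U t = c + ∫ s in (0 : ℝ)..t, V s := by
  set G : ℝ → B := fun t => U t - ∫ s in (0 : ℝ)..t, V s with hG
  have hPc : ContinuousOn (fun t => ∫ s in (0 : ℝ)..t, V s) (Icc 0 T) := by
    refine (intervalIntegral.continuousOn_primitive_interval (a := 0) (b := T) ?_).mono
      (by rw [uIcc_of_le hT.le])
    rw [uIcc_of_le hT.le]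
    exact (integrableOn_Icc_iff_integrableOn_Ioo).2 hV
  have hP : IntegrableOn (fun t => ∫ s in (0 : ℝ)..t, V s) (Ioo 0 T) :=
    (hPc.integrableOn_compact isCompact_Icc).mono_set Ioo_subset_Icc_self
  have hGi : IntegrableOn G (Ioo 0 T) := hU.sub hP
  have hfG : ∀ f : ℝ → ℝ, ContDiff ℝ ∞ f → HasCompactSupport f → tsupport f ⊆ Ioo 0 T →
      ∫ s, f s = 0 → ∫ t in Ioo 0 T, f t • G t = 0 := by
    intro f hf hc hs h0
    obtain ⟨p1, p2, p3, p4⟩ := exists_primitive_test hf hc hs h0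
    have e1 := h _ p1 p2 p3
    simp_rw [p4] at e1
    have e2 := integral_smul_primitive hf.continuous hc hs h0 hV
    have hb : ∀ g : ℝ → B, IntegrableOn g (Ioo 0 T) →
        IntegrableOn (fun t => f t • g t) (Ioo 0 T) := by
      intro g hg
      obtain ⟨C, hC⟩ := hc.exists_bound_of_continuous hf.continuous
      exact hg.bdd_smul C hf.continuous.aestronglyMeasurable (Eventually.of_forall hC)
    simp only [hG, smul_sub]
    rw [integral_sub (hb _ hU) (hb _ hP), e1, e2, sub_self]
  -- A fixed bump of mass one: subtracting `(∫ψ)η` makes any test function `ψ` mean zero, so `G`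
  -- minus its `η`-average is orthogonal to every `ψ`. That average is the constant of integration.
  let β : ContDiffBump (T / 2) := ⟨T / 8, T / 4, by positivity, by linarith⟩
  set η : ℝ → ℝ := β.normed volume with hη
  have hηs : ContDiff ℝ ∞ η := β.contDiff_normed
  have hηc : HasCompactSupport η := β.hasCompactSupport_normed
  have hηt : tsupport η ⊆ Ioo 0 T := by
    rw [hη, β.tsupport_normed_eq, Real.closedBall_eq_Icc]
    intro t ht
    have h1 : T / 2 - T / 4 ≤ t := ht.1
    have h2 : t ≤ T / 2 + T / 4 := ht.2
    constructor <;> linarith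
  have hη1 : ∫ s, η s = 1 := β.integral_normed
  refine ⟨∫ t in Ioo 0 T, η t • G t, ?_⟩
  set c := ∫ t in Ioo 0 T, η t • G t with hcdef
  have hb : ∀ f : ℝ → ℝ, Continuous f → HasCompactSupport f → ∀ g : ℝ → B,
      IntegrableOn g (Ioo 0 T) → IntegrableOn (fun t => f t • g t) (Ioo 0 T) := by
    intro f hf hc g hg
    obtain ⟨C, hC⟩ := hc.exists_bound_of_continuous hf
    exact hg.bdd_smul C hf.aestronglyMeasurable (Eventually.of_forall hC)
  have hci : IntegrableOn (fun _ : ℝ => c) (Ioo 0 T) := by simp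
  have hloc : LocallyIntegrableOn (fun t => G t - c) (Ioo 0 T) volume :=
    (hGi.sub hci).locallyIntegrableOn
  have := isOpen_Ioo.ae_eq_zero_of_integral_contDiff_smul_eq_zero hloc fun ψ hψ hψc hψt => by
    set m := ∫ s, ψ s with hm
    have hψi := hψ.continuous.integrable_of_hasCompactSupport (μ := volume) hψc
    have hηi := hηs.continuous.integrable_of_hasCompactSupport (μ := volume) hηc
    have hmη : HasCompactSupport fun t => m * η t := hηc.mul_left
    have e := hfG (fun t => ψ t - m * η t) (hψ.sub (contDiff_const.mul hηs))
      (hψc.sub hmη)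
      ((tsupport_sub ψ fun t => m * η t).trans (union_subset hψt
        ((closure_mono (Function.support_mul_subset_right _ _)).trans hηt)))
      (by rw [integral_sub hψi (hηi.const_mul m), integral_const_mul, hη1]; simp [hm])
    simp only [sub_smul, mul_smul] at e
    have hmi : IntegrableOn (fun t => m • η t • G t) (Ioo 0 T) :=
      (hb η hηs.continuous hηc _ hGi).smul m
    rw [integral_sub (hb ψ hψ.continuous hψc _ hGi) hmi, integral_smul, ← hcdef] at e
    rw [← setIntegral_eq_integral_of_forall_compl_eq_zero (s := Ioo 0 T)]
    · have hm' : ∫ t in Ioo 0 T, ψ t = m := setIntegral_eq_integral_of_forall_compl_eq_zero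
        fun t ht => image_eq_zero_of_notMem_tsupport fun h => ht (hψt h)
      simp only [smul_sub]
      rw [integral_sub (hb ψ hψ.continuous hψc _ hGi) (hb ψ hψ.continuous hψc _ hci),
        integral_smul_const, hm', e]
    · intro t ht
      rw [image_eq_zero_of_notMem_tsupport fun h => ht (hψt h), zero_smul]
  filter_upwards [this] with t ht htT
  have := ht htT
  simp only [hG] at this
  rw [sub_sub, sub_eq_zero] at this
  rw [this, add_comm]

end Time

end

/-! ### Functions of time with a square integrable second derivative -/

section
section Time
variable {T : ℝ} {B : Type} [NormedAddCommGroup B] [NormedSpace ℝ B]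

/-- `V` is a continuous first derivative and `W` a square integrable second derivative of `U` on
`[0, T]`. -/
structure IsTimeC1H2 (T : ℝ) (U V W : ℝ → B) : Prop where
  cont : Continuous V
  memLp : MemLp W 2 volume
  integrable : Integrable W volume
  sub_eq : ∀ s t, V t - V s = ∫ r in s..t, W r
  primitive : ∀ s ∈ Icc 0 T, ∀ t ∈ Icc 0 T, U t - U s = ∫ r in s..t, V r

/-- Two uses of `ae_eq_primitive` give the representation almost everywhere, and continuity of `U`
upgrades it to every time in the closed interval. Extending `W` by zero makes the integrals of `W`
and the primitive `V` available on the whole line. -/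
lemma exists_isTimeC1H2 [CompleteSpace B] (hT : 0 < T) {U : ℝ → B} (hc : ContinuousOn U (Icc 0 T))
    (h : MemTimeHk T 2 U) : ∃ V W : ℝ → B, IsTimeC1H2 T U V W := by
  obtain ⟨hU, V, hUV, hV, W, hVW, hW⟩ := h
  have hW : MemLp W 2 (volume.restrict (Ioo 0 T)) := hW
  have hUi : IntegrableOn U (Ioo 0 T) := hU.integrable (by norm_num)
  have hVi : IntegrableOn V (Ioo 0 T) := hV.integrable (by norm_num)
  have hWi : IntegrableOn W (Ioo 0 T) := hW.integrable (by norm_num)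
  obtain ⟨c1, h1⟩ := hUV.ae_eq_primitive hT hUi hVi
  obtain ⟨c2, h2⟩ := hVW.ae_eq_primitive hT hVi hWi
  set W' : ℝ → B := (Ioo 0 T).indicator W with hW'
  have hW'L : MemLp W' 2 volume := (memLp_indicator_iff_restrict measurableSet_Ioo).2 hW
  have hW'i : Integrable W' volume := (integrable_indicator_iff measurableSet_Ioo).2 hWi
  set V' : ℝ → B := fun t => c2 + ∫ r in (0 : ℝ)..t, W' r with hV'
  have hV'c : Continuous V' :=
    continuous_const.add (intervalIntegral.continuous_primitive (fun a b => hW'i.intervalIntegrable) 0)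
  have hprimW : ∀ t ∈ Ioo 0 T, ∫ r in (0 : ℝ)..t, W r = ∫ r in (0 : ℝ)..t, W' r := by
    intro t ht
    refine intervalIntegral.integral_congr_ae (Eventually.of_forall fun r hr => ?_)
    rw [uIoc_of_le ht.1.le] at hr
    rw [hW', indicator_of_mem (show r ∈ Ioo 0 T from ⟨hr.1, hr.2.trans_lt ht.2⟩)]
  have hVV' : ∀ᵐ t, t ∈ Ioo 0 T → V t = V' t := by
    filter_upwards [h2] with t ht htT
    rw [ht htT, hV', hprimW t htT]
  have hprimV : ∀ t ∈ Ioo 0 T, ∫ r in (0 : ℝ)..t, V r = ∫ r in (0 : ℝ)..t, V' r := by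
    intro t ht
    refine intervalIntegral.integral_congr_ae ?_
    filter_upwards [hVV'] with r hr hrt
    rw [uIoc_of_le ht.1.le] at hrt
    exact hr ⟨hrt.1, hrt.2.trans_lt ht.2⟩
  have hPc : Continuous fun t => c1 + ∫ r in (0 : ℝ)..t, V' r :=
    continuous_const.add (intervalIntegral.continuous_primitive
      (fun a b => hV'c.intervalIntegrable a b) 0)
  have hall : ∀ t ∈ Icc 0 T, U t = c1 + ∫ r in (0 : ℝ)..t, V' r := by
    have hae : ∀ᵐ t ∂(volume.restrict (Icc 0 T)), U t = c1 + ∫ r in (0 : ℝ)..t, V' r := by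
      rw [← restrict_Ioo_eq_restrict_Icc, ae_restrict_iff' measurableSet_Ioo]
      filter_upwards [h1] with t ht htT
      rw [ht htT, hprimV t htT]
    exact Measure.eqOn_Icc_of_ae_eq volume hT.ne hae hc hPc.continuousOn
  refine ⟨V', W', hV'c, hW'L, hW'i, fun s t => ?_, fun s hs t ht => ?_⟩
  · have := intervalIntegral.integral_interval_sub_left (a := 0) (b := t) (c := s)
      hW'i.intervalIntegrable hW'i.intervalIntegrable
    rw [← this]
    simp only [hV']; abel
  · have := intervalIntegral.integral_interval_sub_left (a := 0) (b := t) (c := s)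
      (hV'c.intervalIntegrable (μ := volume) _ _) (hV'c.intervalIntegrable _ _)
    rw [hall s hs, hall t ht, ← this]
    abel

namespace IsTimeC1H2
variable {U V W : ℝ → B}

lemma hasDerivWithinAt [CompleteSpace B] (h : IsTimeC1H2 T U V W) {t : ℝ} (ht : t ∈ Icc 0 T) : HasDerivWithinAt U (V t) (Icc 0 T) t := by
  have h1 : HasDerivAt (fun s => U t + ∫ r in t..s, V r) (V t) t :=
    (intervalIntegral.integral_hasDerivAt_right (h.cont.intervalIntegrable _ _)
      (h.cont.stronglyMeasurableAtFilter _ _) h.cont.continuousAt).const_add _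
  refine h1.hasDerivWithinAt.congr (fun s hs => ?_) (by simp)
  rw [← h.primitive t ht s hs]; abel

lemma norm_sub_le (h : IsTimeC1H2 T U V W) {a b s t : ℝ} (hs : s ∈ Icc a b) (ht : t ∈ Icc a b) :
    ‖V t - V s‖ ≤ ∫ r in a..b, ‖W r‖ := by
  have hab : a ≤ b := hs.1.trans hs.2
  have key : ∀ s t, s ∈ Icc a b → t ∈ Icc a b → s ≤ t → ‖V t - V s‖ ≤ ∫ r in a..b, ‖W r‖ := by
    intro s t hs ht hst
    rw [h.sub_eq]
    refine (intervalIntegral.norm_integral_le_integral_norm hst).trans ?_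
    exact intervalIntegral.integral_mono_interval hs.1 hst ht.2
      (Eventually.of_forall fun _ => norm_nonneg _) h.integrable.norm.intervalIntegrable
  rcases le_total s t with hst | hst
  · exact key s t hs ht hst
  · rw [norm_sub_rev]; exact key t s ht hs hst

/-- For `c = b` this is the consistency error of backward Euler. The free node `c` also allows two
neighbouring increments to be compared with one common derivative. -/
lemma norm_sub_sub_smul_le [CompleteSpace B] (h : IsTimeC1H2 T U V W) {a b c : ℝ}
    (ha : 0 ≤ a) (hab : a ≤ b) (hb : b ≤ T)
    (hc : c ∈ Icc a b) : ‖U b - U a - (b - a) • V c‖ ≤ (b - a) * ∫ r in a..b, ‖W r‖ := by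
  have h1 : U b - U a - (b - a) • V c = ∫ r in a..b, (V r - V c) := by
    rw [intervalIntegral.integral_sub (h.cont.intervalIntegrable _ _) (by simp),
      intervalIntegral.integral_const, h.primitive a ⟨ha, hab.trans hb⟩ b ⟨ha.trans hab, hb⟩]
  rw [h1, mul_comm, ← abs_of_nonneg (sub_nonneg.2 hab)]
  refine intervalIntegral.norm_integral_le_of_norm_le_const fun r hr => ?_
  rw [uIoc_of_le hab] at hr
  exact h.norm_sub_le hc ⟨hr.1.le, hr.2⟩

lemma integrable_sq (h : IsTimeC1H2 T U V W) : Integrable (fun r => ‖W r‖ ^ 2) volume :=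
  h.memLp.integrable_norm_pow (by norm_num)

/-- Cauchy–Schwarz, read as nonnegativity of the variance of `‖W‖` about its mean `m / (b - a)`. -/
lemma sq_integral_norm_le (h : IsTimeC1H2 T U V W) {a b : ℝ} (hab : a ≤ b) :
    (∫ r in a..b, ‖W r‖) ^ 2 ≤ (b - a) * ∫ r in a..b, ‖W r‖ ^ 2 := by
  set m := ∫ r in a..b, ‖W r‖ with hm
  rcases hab.eq_or_lt with rfl | hlt
  · simp [hm]
  have hba : 0 < b - a := sub_pos.2 hlt
  have h0 : 0 ≤ ∫ r in a..b, (‖W r‖ - m / (b - a)) ^ 2 :=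
    intervalIntegral.integral_nonneg hab fun _ _ => sq_nonneg _
  have hi1 : IntervalIntegrable (fun r => ‖W r‖ ^ 2) volume a b := h.integrable_sq.intervalIntegrable
  have hi2 : IntervalIntegrable (fun r => 2 * (m / (b - a)) * ‖W r‖) volume a b :=
    (h.integrable.norm.const_mul _).intervalIntegrable
  have e : ∫ r in a..b, (‖W r‖ - m / (b - a)) ^ 2
      = (∫ r in a..b, ‖W r‖ ^ 2) - 2 * (m / (b - a)) * m + (b - a) * (m / (b - a)) ^ 2 := by
    have : ∀ r, (‖W r‖ - m / (b - a)) ^ 2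
        = ‖W r‖ ^ 2 - 2 * (m / (b - a)) * ‖W r‖ + (m / (b - a)) ^ 2 := fun r => by ring
    simp_rw [this]
    rw [intervalIntegral.integral_add (hi1.sub hi2) (by simp),
      intervalIntegral.integral_sub hi1 hi2, intervalIntegral.integral_const_mul,
      intervalIntegral.integral_const, smul_eq_mul]
  rw [e] at h0
  have e2 : (b - a) * ((∫ r in a..b, ‖W r‖ ^ 2) - 2 * (m / (b - a)) * m
      + (b - a) * (m / (b - a)) ^ 2) = (b - a) * (∫ r in a..b, ‖W r‖ ^ 2) - m ^ 2 := by
    field_simp; ring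
  have := mul_nonneg hba.le h0
  rw [e2] at this
  linarith

/-- The discrete `L²` bound for the increments of the first derivative. -/
lemma sum_sq_le (h : IsTimeC1H2 T U V W) {Δ : ℝ} (hΔ : 0 ≤ Δ) (N : ℕ) :
    ∑ n ∈ Finset.range N, (∫ r in ((n : ℝ) * Δ)..(((n : ℝ) + 1) * Δ), ‖W r‖) ^ 2
      ≤ Δ * ∫ r, ‖W r‖ ^ 2 := by
  calc _ ≤ ∑ n ∈ Finset.range N, Δ * ∫ r in ((n : ℝ) * Δ)..(((n : ℝ) + 1) * Δ), ‖W r‖ ^ 2 := by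
        refine Finset.sum_le_sum fun n _ => ?_
        refine (h.sq_integral_norm_le (by nlinarith)).trans (le_of_eq ?_)
        congr 1; ring
    _ = Δ * ∫ r in (((0 : ℕ) : ℝ) * Δ)..((N : ℝ) * Δ), ‖W r‖ ^ 2 := by
        rw [← Finset.mul_sum, ← intervalIntegral.sum_integral_adjacent_intervals
          (a := fun n : ℕ => (n : ℝ) * Δ) fun k _ => h.integrable_sq.intervalIntegrable]
        push_cast; rfl
    _ ≤ _ := by
        gcongr
        rw [intervalIntegral.integral_of_le (by simp; positivity)]
        exact setIntegral_le_integral h.integrable_sq (Eventually.of_forall fun _ => by positivity)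

end IsTimeC1H2
end Time

end

section
/-! ### A discrete interpolation inequality in time -/

section Discrete
variable {E : Type*} [NormedAddCommGroup E] [InnerProductSpace ℝ E]

lemma norm_norm_smul_sub_le (x y : E) : ‖‖x‖ • x - ‖y‖ • y‖ ≤ (‖x‖ + ‖y‖) * ‖x - y‖ := by
  have h : ‖x‖ • x - ‖y‖ • y = ‖x‖ • (x - y) + (‖x‖ - ‖y‖) • y := by
    rw [smul_sub, sub_smul]; abel
  rw [h]
  refine (norm_add_le _ _).trans ?_
  rw [norm_smul, norm_smul, norm_norm, add_mul]
  have := abs_norm_sub_norm_le x y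
  rw [Real.norm_eq_abs, mul_comm ‖y‖]
  gcongr

/-- Abel summation, after writing the cube as the inner product of `|D|D` with the increment `D`;
the lower boundary term vanishes by `ha`. -/
lemma sum_norm_cube_eq (a : ℕ → E) (ha : a 0 = 0) (N : ℕ) :
    ∑ n ∈ Finset.range (N + 1), ‖a (n + 1) - a n‖ ^ 3
      = inner ℝ (‖a (N + 1) - a N‖ • (a (N + 1) - a N)) (a (N + 1))
        - ∑ n ∈ Finset.range N, inner ℝ (‖a (n + 2) - a (n + 1)‖ • (a (n + 2) - a (n + 1))
          - ‖a (n + 1) - a n‖ • (a (n + 1) - a n)) (a (n + 1)) := by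
  have hc : ∀ x : E, ‖x‖ ^ 3 = inner ℝ (‖x‖ • x) x := fun x => by
    rw [real_inner_smul_left, real_inner_self_eq_norm_sq]; ring
  induction N with
  | zero => simp [hc, ha]
  | succ N ih =>
    rw [Finset.sum_range_succ, ih, Finset.sum_range_succ _ N, hc]
    simp only [inner_sub_left, inner_sub_right]
    ring

/-- Summation by parts for sequences vanishing at both ends. -/
lemma sum_norm_cube_le (a : ℕ → E) (N : ℕ) (h0 : a 0 = 0) (hN : a (N + 1) = 0) :
    ∑ n ∈ Finset.range (N + 1), ‖a (n + 1) - a n‖ ^ 3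
      ≤ ∑ n ∈ Finset.range N, (‖a (n + 2) - a (n + 1)‖ * ‖a (n + 2) - a (n + 1) - (a (n + 1) - a n)‖
          * ‖a (n + 1)‖ + ‖a (n + 1) - a n‖ * ‖a (n + 2) - a (n + 1) - (a (n + 1) - a n)‖
          * ‖a (n + 1)‖) := by
  rw [sum_norm_cube_eq a h0 N, hN, inner_zero_right, zero_sub, ← Finset.sum_neg_distrib]
  refine Finset.sum_le_sum fun n _ => ?_
  refine (neg_le_abs _).trans ((abs_real_inner_le_norm _ _).trans ?_)
  rw [← add_mul, ← add_mul]
  gcongr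
  exact norm_norm_smul_sub_le _ _

variable {X : Type*} [MeasurableSpace X] {μ : Measure X}

/-- Summation by parts is done pointwise in space and then integrated; Hölder places the second
differences in L², the sequence itself in L⁶ and the increments in L³. -/
lemma sum_nrm_cube_le (a : ℕ → X → E) (N : ℕ) (h0 : a 0 = 0) (hN : a (N + 1) = 0)
    (h2 : ∀ n ≤ N + 1, MemLp (a n) 2 μ) (h6 : ∀ n ≤ N + 1, MemLp (a n) 6 μ) {A : ℝ}
    (hA : ∀ n ≤ N + 1, nrm 6 μ (a n) ≤ A) :
    ∑ n ∈ Finset.range (N + 1), nrm 3 μ (a (n + 1) - a n) ^ 3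
      ≤ A * ∑ n ∈ Finset.range N, (nrm 3 μ (a (n + 2) - a (n + 1)) + nrm 3 μ (a (n + 1) - a n))
          * nrm 2 μ (a (n + 2) - a (n + 1) - (a (n + 1) - a n)) := by
  have h3 : ∀ n ≤ N + 1, MemLp (a n) 3 μ := fun n hn => memLp_three (h2 n hn) (h6 n hn)
  have hD3 : ∀ n < N + 1, MemLp (a (n + 1) - a n) 3 μ := fun n hn =>
    (h3 _ (by omega)).sub (h3 _ (by omega))
  have hZ : ∀ n < N, MemLp (a (n + 2) - a (n + 1) - (a (n + 1) - a n)) 2 μ := fun n hn =>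
    ((h2 _ (by omega)).sub (h2 _ (by omega))).sub ((h2 _ (by omega)).sub (h2 _ (by omega)))
  have hi1 := fun n (hn : n < N) => integrable_norm_mul_norm_mul_norm (hD3 (n + 1) (by omega))
    (hZ n hn) (h6 (n + 1) (by omega))
  have hi2 := fun n (hn : n < N) => integrable_norm_mul_norm_mul_norm (hD3 n (by omega))
    (hZ n hn) (h6 (n + 1) (by omega))
  have hcube : ∀ n < N + 1, Integrable (fun x => ‖(a (n + 1) - a n) x‖ ^ 3) μ := fun n hn =>
    MemLp.integrable_norm_pow (p := 3) (hD3 n hn) (by norm_num)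
  have e : ∀ n < N + 1, nrm 3 μ (a (n + 1) - a n) ^ 3 = ∫ x, ‖(a (n + 1) - a n) x‖ ^ 3 ∂μ :=
    fun n hn => by
      have := nrm_pow_eq_integral (p := 3) (by norm_num) (hD3 n hn).1
      exact_mod_cast this
  rw [Finset.sum_congr rfl fun n hn => e n (Finset.mem_range.1 hn),
    ← integral_finsetSum _ fun n hn => hcube n (Finset.mem_range.1 hn)]
  calc _ ≤ ∫ x, ∑ n ∈ Finset.range N,
        (‖(a (n + 1 + 1) - a (n + 1)) x‖ * ‖(a (n + 2) - a (n + 1) - (a (n + 1) - a n)) x‖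
          * ‖a (n + 1) x‖ + ‖(a (n + 1) - a n) x‖
          * ‖(a (n + 2) - a (n + 1) - (a (n + 1) - a n)) x‖ * ‖a (n + 1) x‖) ∂μ := by
        refine integral_mono (integrable_finsetSum _ fun n hn => hcube n (Finset.mem_range.1 hn))
          (integrable_finsetSum _ fun n hn => (hi1 n (Finset.mem_range.1 hn)).add
            (hi2 n (Finset.mem_range.1 hn))) fun x => ?_
        exact sum_norm_cube_le (fun n => a n x) N (by simp [h0]) (by simp [hN])
    _ = ∑ n ∈ Finset.range N,
        ((∫ x, ‖(a (n + 1 + 1) - a (n + 1)) x‖ * ‖(a (n + 2) - a (n + 1) - (a (n + 1) - a n)) x‖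
          * ‖a (n + 1) x‖ ∂μ) + ∫ x, ‖(a (n + 1) - a n) x‖
          * ‖(a (n + 2) - a (n + 1) - (a (n + 1) - a n)) x‖ * ‖a (n + 1) x‖ ∂μ) := by
        refine (integral_finsetSum _ fun n hn => (hi1 n (Finset.mem_range.1 hn)).add
            (hi2 n (Finset.mem_range.1 hn))).trans ?_
        exact Finset.sum_congr rfl fun n hn =>
          integral_add (hi1 n (Finset.mem_range.1 hn)) (hi2 n (Finset.mem_range.1 hn))
    _ ≤ _ := by
        rw [Finset.mul_sum]
        refine Finset.sum_le_sum fun n hn => ?_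
        have hn := Finset.mem_range.1 hn
        have b1 := integral_norm_mul_norm_mul_norm_le (hD3 (n + 1) (by omega))
          (hZ n hn) (h6 (n + 1) (by omega))
        have b2 := integral_norm_mul_norm_mul_norm_le (hD3 n (by omega))
          (hZ n hn) (h6 (n + 1) (by omega))
        refine (add_le_add b1 b2).trans ?_
        rw [← add_mul, ← add_mul, mul_comm A]
        refine mul_le_mul_of_nonneg_left (hA _ (by omega)) ?_
        exact mul_nonneg (add_nonneg (nrm_nonneg _ _) (nrm_nonneg _ _)) (nrm_nonneg _ _)

/-- Let `Yₖ` be the sum of k-th powers of `y` and `Z` that of squares of `z`. Then `Y₂² ≤ Y₁Y₃`,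
`Y₁² ≤ (N+1)Y₂` and `Y₃² ≤ 4A²Y₂Z`; squaring the first and inserting the others lets `Y₂²` cancel.
-/
lemma sq_sum_sq_le {y z : ℕ → ℝ} {A : ℝ} (hy : ∀ n, 0 ≤ y n) (hz : ∀ n, 0 ≤ z n)
    (N : ℕ) (h : ∑ n ∈ Finset.range (N + 1), y n ^ 3
      ≤ A * ∑ n ∈ Finset.range N, (y (n + 1) + y n) * z n) :
    (∑ n ∈ Finset.range (N + 1), y n ^ 2) ^ 2
      ≤ 4 * (N + 1) * A ^ 2 * ∑ n ∈ Finset.range N, z n ^ 2 := by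
  set Y2 := ∑ n ∈ Finset.range (N + 1), y n ^ 2 with hY2
  set Y3 := ∑ n ∈ Finset.range (N + 1), y n ^ 3 with hY3
  set Y1 := ∑ n ∈ Finset.range (N + 1), y n with hY1
  set Z := ∑ n ∈ Finset.range N, z n ^ 2 with hZ
  set S := ∑ n ∈ Finset.range N, (y (n + 1) + y n) * z n with hS
  have h20 : 0 ≤ Y2 := Finset.sum_nonneg fun _ _ => by positivity
  have h30 : 0 ≤ Y3 := Finset.sum_nonneg fun n _ => pow_nonneg (hy n) 3
  have h10 : 0 ≤ Y1 := Finset.sum_nonneg fun n _ => hy n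
  have hZ0 : 0 ≤ Z := Finset.sum_nonneg fun _ _ => by positivity
  have hS0 : 0 ≤ S := Finset.sum_nonneg fun n _ => mul_nonneg (add_nonneg (hy _) (hy _)) (hz n)
  have c1 : Y2 ^ 2 ≤ Y1 * Y3 := by
    have := Finset.sum_mul_sq_le_sq_mul_sq (Finset.range (N + 1)) (fun n => √(y n))
      (fun n => √(y n) ^ 3)
    have e1 : ∀ n, √(y n) * √(y n) ^ 3 = y n ^ 2 := fun n => by
      rw [show √(y n) * √(y n) ^ 3 = (√(y n) ^ 2) ^ 2 by ring, Real.sq_sqrt (hy n)]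
    have e2 : ∀ n, (√(y n) ^ 3) ^ 2 = y n ^ 3 := fun n => by
      rw [show (√(y n) ^ 3) ^ 2 = (√(y n) ^ 2) ^ 3 by ring, Real.sq_sqrt (hy n)]
    simp_rw [e1, e2, Real.sq_sqrt (hy _)] at this
    exact this
  have c2 : Y1 ^ 2 ≤ (N + 1) * Y2 := by
    have := sq_sum_le_card_mul_sum_sq (s := Finset.range (N + 1)) (f := y)
    simpa using this
  have c3 : S ^ 2 ≤ 4 * Y2 * Z := by
    have h1 := Finset.sum_mul_sq_le_sq_mul_sq (Finset.range N) (fun n => y (n + 1) + y n) z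
    refine h1.trans (mul_le_mul_of_nonneg_right ?_ hZ0)
    have h2 : ∀ n, (y (n + 1) + y n) ^ 2 ≤ 2 * y (n + 1) ^ 2 + 2 * y n ^ 2 := fun n => by
      nlinarith [sq_nonneg (y (n + 1) - y n)]
    refine (Finset.sum_le_sum fun n _ => h2 n).trans ?_
    rw [Finset.sum_add_distrib, ← Finset.mul_sum, ← Finset.mul_sum]
    have h3 : ∑ n ∈ Finset.range N, y (n + 1) ^ 2 ≤ Y2 := by
      rw [hY2, Finset.sum_range_succ']
      have := sq_nonneg (y 0)
      linarith
    have h4 : ∑ n ∈ Finset.range N, y n ^ 2 ≤ Y2 := by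
      rw [hY2, Finset.sum_range_succ]
      have := sq_nonneg (y N)
      linarith
    linarith
  rcases h20.eq_or_lt with h0 | hpos
  · rw [← h0, zero_pow two_ne_zero]
    positivity
  have c4 : Y3 ^ 2 ≤ A ^ 2 * (4 * Y2 * Z) := by
    calc Y3 ^ 2 ≤ (A * S) ^ 2 := by gcongr
      _ = A ^ 2 * S ^ 2 := by ring
      _ ≤ _ := by gcongr
  have c5 : Y2 ^ 4 ≤ (N + 1) * Y2 * (A ^ 2 * (4 * Y2 * Z)) := by
    calc Y2 ^ 4 = (Y2 ^ 2) ^ 2 := by ring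
      _ ≤ (Y1 * Y3) ^ 2 := by gcongr
      _ = Y1 ^ 2 * Y3 ^ 2 := by ring
      _ ≤ _ := by gcongr
  have hp : 0 < Y2 ^ 2 := by positivity
  refine le_of_mul_le_mul_left ?_ hp
  nlinarith

/-- Discrete interpolation: increments of a sequence bounded in `L⁶` whose second differences are
small in `L²` are small in `L³`. -/
lemma sum_nrm_three_sq_le (u : ℕ → X → E) (N : ℕ)
    (h2 : ∀ n ≤ N + 1, MemLp (u n) 2 μ) (h6 : ∀ n ≤ N + 1, MemLp (u n) 6 μ) {L L' : ℝ}
    (hL : ∀ n ≤ N + 1, nrm 6 μ (u n) ≤ L) (hL' : ∀ n ≤ N + 1, nrm 3 μ (u n) ≤ L') :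
    ∑ n ∈ Finset.range (N + 1), nrm 3 μ (u (n + 1) - u n) ^ 2
      ≤ 2 * √(4 * (N + 1) * (4 * L) ^ 2 * ∑ n ∈ Finset.range N,
          nrm 2 μ (u (n + 2) - u (n + 1) - (u (n + 1) - u n)) ^ 2)
        + 8 * L' ^ 2 / (N + 1) := by
  -- Removing the chord makes the sequence vanish at both ends and leaves second differences
  -- unchanged. The chord adds `m` to each increment, which accounts for the last term of the bound.
  set m : X → E := ((N : ℝ) + 1)⁻¹ • (u (N + 1) - u 0) with hm
  set a : ℕ → X → E := fun n => u n - u 0 - (n : ℝ) • m with ha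
  have hN : (0 : ℝ) < (N : ℝ) + 1 := by positivity
  have h3 : ∀ n ≤ N + 1, MemLp (u n) 3 μ := fun n hn => memLp_three (h2 n hn) (h6 n hn)
  have hL0 : 0 ≤ L := (nrm_nonneg _ _).trans (hL 0 (by omega))
  have hL0' : 0 ≤ L' := (nrm_nonneg _ _).trans (hL' 0 (by omega))
  have hmm : ∀ p : ℝ≥0∞, (∀ n ≤ N + 1, MemLp (u n) p μ) → MemLp m p μ := fun p hp =>
    ((hp _ le_rfl).sub (hp 0 (by omega))).const_smul _
  have ham : ∀ p : ℝ≥0∞, (∀ n ≤ N + 1, MemLp (u n) p μ) → ∀ n ≤ N + 1, MemLp (a n) p μ :=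
    fun p hp n hn => ((hp n hn).sub (hp 0 (by omega))).sub ((hmm p hp).const_smul _)
  have hmb : ∀ p : ℝ≥0∞, 1 ≤ p → (∀ n ≤ N + 1, MemLp (u n) p μ) → ∀ M : ℝ,
      (∀ n ≤ N + 1, nrm p μ (u n) ≤ M) → nrm p μ m ≤ 2 * M / (N + 1) := by
    intro p hp1 hp M hM
    rw [hm, nrm_smul, abs_of_nonneg (by positivity), inv_mul_eq_div]
    gcongr
    have := nrm_sub_le hp1 (hp (N + 1) le_rfl) (hp 0 (by omega))
    linarith [hM (N + 1) le_rfl, hM 0 (by omega)]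
  have haA : ∀ n ≤ N + 1, nrm 6 μ (a n) ≤ 4 * L := by
    intro n hn
    have b1 := nrm_sub_le (p := 6) (by norm_num) ((h6 n hn).sub (h6 0 (by omega)))
      ((hmm 6 h6).const_smul (n : ℝ))
    have b2 := nrm_sub_le (p := 6) (by norm_num) (h6 n hn) (h6 0 (by omega))
    have b3 : nrm 6 μ ((n : ℝ) • m) ≤ 2 * L := by
      rw [nrm_smul, abs_of_nonneg (by positivity)]
      have hn' : (n : ℝ) ≤ N + 1 := by exact_mod_cast hn
      calc (n : ℝ) * nrm 6 μ m ≤ (N + 1) * (2 * L / (N + 1)) :=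
            mul_le_mul hn' (hmb 6 (by norm_num) h6 L hL) (nrm_nonneg _ _) hN.le
        _ = 2 * L := by field_simp
    have b4 := hL n hn
    have b5 := hL 0 (by omega)
    simp only [ha]
    linarith
  have hD : ∀ n, a (n + 1) - a n = u (n + 1) - u n - m := by
    intro n
    simp only [ha]
    push_cast
    rw [add_smul, one_smul]; abel
  have hD2 : ∀ n, a (n + 2) - a (n + 1) - (a (n + 1) - a n)
      = u (n + 2) - u (n + 1) - (u (n + 1) - u n) := by
    intro n
    rw [hD n, hD (n + 1)]; abel
  have key := sq_sum_sq_le (y := fun n => nrm 3 μ (a (n + 1) - a n))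
    (z := fun n => nrm 2 μ (a (n + 2) - a (n + 1) - (a (n + 1) - a n)))
    (fun n => nrm_nonneg _ _) (fun n => nrm_nonneg _ _) (A := 4 * L) N
    (sum_nrm_cube_le a N (by simp [ha]) (by
        simp only [ha, hm, smul_smul]
        push_cast
        rw [mul_inv_cancel₀ hN.ne', one_smul, sub_self]) (ham 2 h2) (ham 6 h6) haA)
  simp_rw [hD2] at key
  have key2 := Real.le_sqrt_of_sq_le key
  have hstep : ∀ n ∈ Finset.range (N + 1), nrm 3 μ (u (n + 1) - u n) ^ 2
      ≤ 2 * nrm 3 μ (a (n + 1) - a n) ^ 2 + 2 * (2 * L' / (N + 1)) ^ 2 := by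
    intro n hn
    have hn := Finset.mem_range.1 hn
    have e : u (n + 1) - u n = (a (n + 1) - a n) + m := by rw [hD]; abel
    have b1 := nrm_add_le (p := 3) (by norm_num) ((ham 3 h3 (n + 1) (by omega)).sub
      (ham 3 h3 n (by omega))) (hmm 3 h3)
    have b2 := hmb 3 (by norm_num) h3 L' hL'
    rw [e]
    have b3 := nrm_nonneg (μ := μ) 3 (a (n + 1) - a n + m)
    have b4 : nrm 3 μ (a (n + 1) - a n + m) ^ 2
        ≤ (nrm 3 μ (a (n + 1) - a n) + 2 * L' / (N + 1)) ^ 2 := by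
      gcongr; linarith
    nlinarith [sq_nonneg (nrm 3 μ (a (n + 1) - a n) - 2 * L' / (N + 1))]
  refine (Finset.sum_le_sum hstep).trans ?_
  rw [Finset.sum_add_distrib, ← Finset.mul_sum, Finset.sum_const, Finset.card_range, nsmul_eq_mul]
  refine add_le_add (mul_le_mul_of_nonneg_left key2 (by norm_num)) (le_of_eq ?_)
  push_cast
  field_simp
  ring

end Discrete

end

section
variable {d : ℕ} {Ω : Set (Rd d)} {α : ℝ}

/-! ### The velocity space -/

lemma memH1Zero_of_mem {v : L2Vec d} (h : v ∈ velocitySpace Ω α) : MemH1Zero Ω v := h.2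

lemma MemH1.sub_partialD {v w z : Rd d → Rd d} (hv : MemH1 v) (hw : MemH1 w)
    (hz : z =ᵐ[volume] v - w) (j : Fin d) :
    HasWeakPartial univ j z (partialD j v - partialD j w) := by
  have h := (partialD_spec hv j).2.sub (locallyIntegrable_of_memLp_two hv.1)
    (locallyIntegrable_of_memLp_two hw.1)
    (locallyIntegrable_of_memLp_two (partialD_spec hv j).1)
    (locallyIntegrable_of_memLp_two (partialD_spec hw j).1) (partialD_spec hw j).2
  exact h.congr (by simpa using hz.symm) (ae_eq_refl _)

lemma MemH1.partialD_sub_ae {v w z : Rd d → Rd d} (hv : MemH1 v) (hw : MemH1 w)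
    (hz : z =ᵐ[volume] v - w) (j : Fin d) :
    partialD j z =ᵐ[volume] partialD j v - partialD j w :=
  partialD_ae_eq ((partialD_spec hv j).1.sub (partialD_spec hw j).1) (hv.sub_partialD hw hz j)

lemma aestronglyMeasurable_gagliardo {v : Rd d → Rd d} (hv : AEStronglyMeasurable v volume) :
    AEStronglyMeasurable (fun z : Rd d × Rd d => v z.1 - v z.2) volume :=
  (hv.comp_quasiMeasurePreserving Measure.quasiMeasurePreserving_fst).sub
    (hv.comp_quasiMeasurePreserving Measure.quasiMeasurePreserving_snd)

lemma measurable_kernel (r : ℝ) : Measurable fun z : Rd d × Rd d => ‖z.1 - z.2‖ ^ r := by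
  fun_prop

lemma ae_prod_of_ae {p : Rd d → Prop} (h : ∀ᵐ x, p x) :
    ∀ᵐ z : Rd d × Rd d, p z.1 ∧ p z.2 :=
  (Measure.quasiMeasurePreserving_fst.ae h).and (Measure.quasiMeasurePreserving_snd.ae h)

lemma MemHalpha.sub_of_ae {v w z : Rd d → Rd d} (hv : MemHalpha α v) (hw : MemHalpha α w)
    (hz : z =ᵐ[volume] v - w) : MemHalpha α z := by
  have hzL : MemLp z 2 volume := (memLp_congr_ae hz).2 (hv.1.sub hw.1)
  refine ⟨hzL, (hv.2.add hw.2).mono ?_ ?_⟩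
  · exact (aestronglyMeasurable_gagliardo hzL.1).norm.div₀
      (measurable_kernel _).aestronglyMeasurable
  · filter_upwards [ae_prod_of_ae hz] with x hx
    have h0 : (0 : ℝ) ≤ ‖x.1 - x.2‖ ^ ((d : ℝ) / 2 + α) := by positivity
    rw [hx.1, hx.2, Real.norm_of_nonneg (by positivity)]
    simp only [Pi.add_apply, Pi.sub_apply]
    rw [← add_div, Real.norm_of_nonneg (by positivity)]
    gcongr
    rw [show v x.1 - w x.1 - (v x.2 - w x.2) = (v x.1 - v x.2) - (w x.1 - w x.2) by abel]
    exact norm_sub_le _ _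

lemma sub_mem_velocitySpace {v w : L2Vec d} (hv : v ∈ velocitySpace Ω α)
    (hw : w ∈ velocitySpace Ω α) : v - w ∈ velocitySpace Ω α := by
  have hz := Lp.coeFn_sub v w
  refine ⟨hv.1.sub_of_ae hw.1 hz, ⟨Lp.memLp _, fun j => ⟨_, ?_, hv.2.1.sub_partialD hw.2.1 hz j⟩⟩,
    ?_⟩
  · exact (partialD_spec hv.2.1 j).1.sub (partialD_spec hw.2.1 j).1
  · filter_upwards [hz, hv.2.2, hw.2.2] with x h1 h2 h3 hx
    rw [h1, Pi.sub_apply, h2 hx, h3 hx, sub_zero]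

/-! ### The bilinear forms -/

/-- The kernel is split evenly between the two difference quotients, each of which is square
integrable on the product space. -/
lemma integrable_gagliardo (hα : 0 < α) {v w : Rd d → Rd d} (hv : MemHalpha α v)
    (hw : MemHalpha α w) :
    Integrable (fun z : Rd d × Rd d =>
      inner ℝ (v z.1 - v z.2) (w z.1 - w z.2) / ‖z.1 - z.2‖ ^ ((d : ℝ) + 2 * α)) volume := by
  refine (integrable_norm_mul_norm hv.2 hw.2).mono' ?_ (Eventually.of_forall fun z => ?_)
  · exact ((aestronglyMeasurable_gagliardo hv.1.1).inner
      (aestronglyMeasurable_gagliardo hw.1.1)).div₀ (measurable_kernel _).aestronglyMeasurable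
  · have hk : ‖z.1 - z.2‖ ^ ((d : ℝ) + 2 * α)
        = ‖z.1 - z.2‖ ^ ((d : ℝ) / 2 + α) * ‖z.1 - z.2‖ ^ ((d : ℝ) / 2 + α) := by
      rw [← Real.rpow_add_of_nonneg (norm_nonneg _) (by positivity) (by positivity)]
      congr 1; ring
    have h0 : (0 : ℝ) ≤ ‖z.1 - z.2‖ ^ ((d : ℝ) / 2 + α) := by positivity
    rw [norm_div, norm_div, norm_div, norm_norm, norm_norm, Real.norm_of_nonneg h0, hk,
      Real.norm_of_nonneg (mul_nonneg h0 h0), div_mul_div_comm]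
    gcongr
    exact norm_inner_le_norm _ _

lemma gagliardoForm_eq (hα : 0 < α) {v w : Rd d → Rd d} (hv : MemHalpha α v)
    (hw : MemHalpha α w) : gagliardoForm α v w = ∫ z : Rd d × Rd d,
      inner ℝ (v z.1 - v z.2) (w z.1 - w z.2) / ‖z.1 - z.2‖ ^ ((d : ℝ) + 2 * α) :=
  (integral_prod _ (integrable_gagliardo hα hv hw)).symm

lemma gagliardoForm_self (v : Rd d → Rd d) : gagliardoForm α v v = gagliardoSq α v := by
  simp only [gagliardoForm, gagliardoSq, real_inner_self_eq_norm_sq]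

lemma gagliardoForm_sub (hα : 0 < α) {v w z : Rd d → Rd d} (hv : MemHalpha α v)
    (hw : MemHalpha α w) (hz : z =ᵐ[volume] v - w) :
    gagliardoForm α v z - gagliardoForm α w z = gagliardoSq α z := by
  have hzH := hv.sub_of_ae hw hz
  rw [← gagliardoForm_self, gagliardoForm_eq hα hv hzH, gagliardoForm_eq hα hw hzH,
    gagliardoForm_eq hα hzH hzH,
    ← integral_sub (integrable_gagliardo hα hv hzH) (integrable_gagliardo hα hw hzH)]
  refine integral_congr_ae ?_
  filter_upwards [ae_prod_of_ae hz] with x hx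
  rw [← sub_div, ← inner_sub_left]
  congr 2
  rw [hx.1, hx.2]
  simp only [Pi.sub_apply]
  abel

lemma gagliardoSq_nonneg (v : Rd d → Rd d) : 0 ≤ gagliardoSq α v :=
  integral_nonneg fun _ => integral_nonneg fun _ => by positivity

lemma fracConst_nonneg (hα : α ∈ Ioo (0 : ℝ) 1) : 0 ≤ fracConst d α := by
  have h1 : 0 < Real.Gamma (((d : ℝ) + 2 * α) / 2) :=
    Real.Gamma_pos_of_pos (by have := hα.1; positivity)
  have h2 : 0 < Real.Gamma (1 - α) := Real.Gamma_pos_of_pos (by linarith [hα.2])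
  have := hα.1
  unfold fracConst
  positivity

lemma gradForm_sub {v w z : Rd d → Rd d} (hv : MemH1 v) (hw : MemH1 w) (hz1 : MemH1 z)
    (hz : z =ᵐ[volume] v - w) : gradForm Ω v z - gradForm Ω w z = gradNormSq Ω z := by
  have hi : ∀ {v : Rd d → Rd d}, MemH1 v →
      Integrable (fun x => ∑ j, inner ℝ (partialD j v x) (partialD j z x)) (volume.restrict Ω) := by
    intro v hv
    refine (integrable_finsetSum _ fun j _ => ?_).integrableOn
    exact (integrable_norm_mul_norm (partialD_spec hv j).1 (partialD_spec hz1 j).1).mono'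
      ((partialD_spec hv j).1.1.inner (partialD_spec hz1 j).1.1)
      (Eventually.of_forall fun x => norm_inner_le_norm _ _)
  rw [gradForm, gradForm, ← integral_sub (hi hv) (hi hw), gradNormSq]
  refine integral_congr_ae (ae_restrict_of_ae ?_)
  filter_upwards [ae_all_iff.2 fun j => hv.partialD_sub_ae hw hz j] with x hx
  rw [← Finset.sum_sub_distrib]
  refine Finset.sum_congr rfl fun j _ => ?_
  rw [← inner_sub_left, ← real_inner_self_eq_norm_sq, hx j, Pi.sub_apply]

/-! ### Restriction to `Ω` -/

lemma restr_coeFn (v : L2Vec d) : restr Ω v =ᵐ[volume.restrict Ω] v :=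
  LpToLpRestrictCLM_coeFn ℝ Ω v

lemma l2Form_eq_inner (g : L2On Ω (Rd d)) (v : L2Vec d) :
    l2Form Ω g v = inner ℝ g (restr Ω v) := by
  rw [L2.inner_def, l2Form]
  refine integral_congr_ae ?_
  filter_upwards [restr_coeFn (Ω := Ω) v] with x hx
  rw [hx]

lemma l2Form_eq_inner' (w v : L2Vec d) :
    l2Form Ω w v = inner ℝ (restr Ω w) (restr Ω v) := by
  rw [← l2Form_eq_inner, l2Form, l2Form]
  refine integral_congr_ae ?_
  filter_upwards [restr_coeFn (Ω := Ω) w] with x hx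
  rw [hx]

lemma l2NormSq_eq (v : L2Vec d) : l2NormSq Ω v = ‖restr Ω v‖ ^ 2 := by
  rw [← real_inner_self_eq_norm_sq, ← l2Form_eq_inner', l2NormSq, l2Form]
  simp only [real_inner_self_eq_norm_sq]

lemma norm_restr_eq {v : L2Vec d} (hΩ : MeasurableSet Ω) (hv : ∀ᵐ x, x ∉ Ω → v x = 0) :
    ‖restr Ω v‖ = nrm 2 volume v := by
  have h : v =ᵐ[volume] Ω.indicator v := by
    filter_upwards [hv] with x hx
    by_cases hxΩ : x ∈ Ω
    · rw [indicator_of_mem hxΩ]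
    · rw [indicator_of_notMem hxΩ, hx hxΩ]
  rw [Lp.norm_def, eLpNorm_congr_ae (restr_coeFn v), nrm, eLpNorm_congr_ae h,
    eLpNorm_indicator_eq_eLpNorm_restrict hΩ]

end

section
variable {d : ℕ} {Ω : Set (Rd d)} {α ν γ T : ℝ}

/-! ### Consequences of the regularity of the exact solution -/

lemma exists_ae_bound {X B : Type*} [MeasurableSpace X] [NormedAddCommGroup B] {μ : Measure X}
    {G : X → B} (hG : MemLp G ⊤ μ) : ∃ M : ℝ, 0 ≤ M ∧ ∀ᵐ t ∂μ, ‖G t‖ ≤ M := by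
  refine ⟨(eLpNorm G ⊤ μ).toReal, ENNReal.toReal_nonneg, ?_⟩
  rw [eLpNorm_exponent_top]
  have hfin : eLpNormEssSup G μ ≠ ⊤ := by simpa [eLpNorm_exponent_top] using hG.2.ne
  filter_upwards [enorm_ae_le_eLpNormEssSup G μ] with t ht
  have := ENNReal.toReal_mono hfin ht
  simpa using this

/-- This links the regularity hypothesis, stated with weak derivatives on `Ω`, to `partialD`, taken
on the whole space: they agree on `Ω`, and the latter vanishes outside. -/
lemma MemH1Zero.nrm_partialD_eq (hΩ : IsOpen Ω) {v : L2Vec d} (hv : MemH1Zero Ω v) {j : Fin d}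
    {g : L2On Ω (Rd d)} (hg : HasWeakPartial Ω j (restr Ω v) g) :
    nrm 2 volume (partialD j v) = ‖g‖ := by
  have hw := (partialD_spec hv.1 j).2.restrict (Ω := Ω)
  have heq := HasWeakPartial.unique hΩ ((hv.memLp_partialD j).restrict Ω) (Lp.memLp g)
    (hw.congr (restr_coeFn v).symm (ae_eq_refl _)) hg
  have h : partialD j v =ᵐ[volume] Ω.indicator (partialD j v) := by
    filter_upwards [hv.partialD_eq_zero j] with x hx
    by_cases hxΩ : x ∈ Ω
    · rw [indicator_of_mem hxΩ]
    · rw [indicator_of_notMem hxΩ, hx hxΩ]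
  rw [nrm, eLpNorm_congr_ae h, eLpNorm_indicator_eq_eLpNorm_restrict hΩ.measurableSet,
    eLpNorm_congr_ae heq, Lp.norm_def]

lemma nrm_sub_eq_norm_restr (hΩ : MeasurableSet Ω) {v w : L2Vec d}
    (hv : v ∈ velocitySpace Ω α) (hw : w ∈ velocitySpace Ω α) :
    nrm 2 volume (⇑v - ⇑w) = ‖restr Ω v - restr Ω w‖ := by
  rw [← map_sub, norm_restr_eq hΩ (sub_mem_velocitySpace hv hw).2.2]
  exact nrm_congr (Lp.coeFn_sub v w).symm

/-- The bound on the gradient of an `L^∞(H¹)` function holds at every time. -/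
lemma exists_gradient_bound (hΩ : IsOpen Ω) (hT : 0 < T) {u : ℝ → L2Vec d}
    (hmem : ∀ t ∈ Icc 0 T, u t ∈ velocitySpace Ω α)
    (hc : ContinuousOn (fun t => restr Ω (u t)) (Icc 0 T))
    (hu1 : MemTimeLqH1 Ω T ⊤ (fun t => restr Ω (u t))) :
    ∃ M : ℝ, 0 ≤ M ∧ ∀ t ∈ Icc 0 T, ∀ j, nrm 2 volume (partialD j (u t)) ≤ M := by
  have hj : ∀ j : Fin d, ∃ M : ℝ, 0 ≤ M ∧ ∀ᵐ t ∂(volume.restrict (Ioo 0 T)),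
      nrm 2 volume (partialD j (u t)) ≤ M := by
    intro j
    obtain ⟨G, hG, hGw⟩ := hu1.2 j
    obtain ⟨M, hM0, hM⟩ := exists_ae_bound hG
    refine ⟨M, hM0, ?_⟩
    filter_upwards [hM, hGw, ae_restrict_mem measurableSet_Ioo] with t h1 h2 h3
    rwa [(memH1Zero_of_mem (hmem t (Ioo_subset_Icc_self h3))).nrm_partialD_eq hΩ h2]
  choose M hM0 hM using hj
  refine ⟨∑ j, M j, Finset.sum_nonneg fun j _ => hM0 j, fun t ht j => ?_⟩
  refine le_trans ?_ (Finset.single_le_sum (fun j _ => hM0 j) (Finset.mem_univ j))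
  -- The bound holds on a dense set of times. Any `t` is approached along it, and lower
  -- semicontinuity carries the bound over, so that it is available at the nodes of every time grid.
  set s : Set ℝ := {t | t ∈ Ioo 0 T → nrm 2 volume (partialD j (u t)) ≤ M j} with hs
  have hsd : Dense s := by
    refine Measure.dense_of_ae (μ := volume) ?_
    exact (ae_restrict_iff' measurableSet_Ioo).1 (hM j)
  have htc : t ∈ closure (Ioo 0 T ∩ s) := by
    have h1 := hsd.open_subset_closure_inter (isOpen_Ioo (a := (0 : ℝ)) (b := T))
    have h2 := closure_minimal h1 isClosed_closure
    rw [closure_Ioo hT.ne] at h2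
    exact h2 ht
  obtain ⟨τ, hτ, hτt⟩ := mem_closure_iff_seq_limit.1 htc
  have hτm : ∀ k, τ k ∈ Icc 0 T := fun k => Ioo_subset_Icc_self (hτ k).1
  have hv := memH1Zero_of_mem (hmem t ht)
  have hvk := fun k => memH1Zero_of_mem (hmem _ (hτm k))
  have hlim : Tendsto (fun k => nrm 2 volume (⇑(u (τ k)) - ⇑(u t))) atTop (𝓝 0) := by
    have h1 : Tendsto (fun k => restr Ω (u (τ k))) atTop (𝓝 (restr Ω (u t))) :=
      (hc t ht).tendsto.comp (tendsto_nhdsWithin_iff.2 ⟨hτt, Eventually.of_forall hτm⟩)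
    have h2 := tendsto_iff_norm_sub_tendsto_zero.1 h1
    refine h2.congr fun k => ?_
    exact (nrm_sub_eq_norm_restr hΩ.measurableSet (hmem _ (hτm k)) (hmem t ht)).symm
  have key := eLpNorm_weakPartial_le_of_tendsto (M := ENNReal.ofReal (M j)) hv.memLp
    (hv.memLp_partialD j) (fun k => (hvk k).memLp) (fun k => (hvk k).memLp_partialD j)
    (partialD_spec hv.1 j).2 (fun k => (partialD_spec (hvk k).1 j).2)
    (fun k => (ENNReal.le_ofReal_iff_toReal_le ((hvk k).memLp_partialD j).2.ne (hM0 j)).2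
      ((hτ k).2 (hτ k).1)) hlim
  exact (ENNReal.le_ofReal_iff_toReal_le (hv.memLp_partialD j).2.ne (hM0 j)).1 key

/-- Incompressibility is imposed only for positive times, but the first step of the scheme is
transported by the initial velocity; the property is recovered as an L² limit from `t > 0`. -/
lemma IsExactSolution.isSolenoidal (hΩ : IsOpen Ω) (hT : 0 < T) {f : ℝ → L2On Ω (Rd d)}
    {u₀ : L2On Ω (Rd d)} {u : ℝ → L2Vec d} {p : ℝ → L2On Ω ℝ}
    (h : IsExactSolution Ω α ν γ T f u₀ u p) : IsSolenoidal (u 0) := by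
  have h0 : (0 : ℝ) ∈ Icc 0 T := ⟨le_rfl, hT.le⟩
  set τ : ℕ → ℝ := fun k => T * (1 / ((k : ℝ) + 1)) with hτ
  have hτm : ∀ k, τ k ∈ Ioc 0 T := fun k => by
    have hk : (0 : ℝ) < (k : ℝ) + 1 := by positivity
    refine ⟨by positivity, mul_le_of_le_one_right hT.le ?_⟩
    rw [div_le_one hk]; linarith [(Nat.cast_nonneg k : (0 : ℝ) ≤ k)]
  have hτ0 : Tendsto τ atTop (𝓝 0) := by
    have := (tendsto_one_div_add_atTop_nhds_zero_nat (𝕜 := ℝ)).const_mul T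
    rwa [mul_zero] at this
  have hm := fun k => h.mem_velocity _ (Ioc_subset_Icc_self (hτm k))
  refine IsSolenoidal.of_tendsto (wk := fun k => u (τ k)) (Lp.memLp _) (fun k => Lp.memLp _)
    (fun k => (memH1Zero_of_mem (hm k)).isSolenoidal hΩ.measurableSet
      (h.incompressible _ (hτm k))) ?_
  have h1 : Tendsto (fun k => restr Ω (u (τ k))) atTop (𝓝 (restr Ω (u 0))) :=
    (h.continuous 0 h0).tendsto.comp
      (tendsto_nhdsWithin_iff.2 ⟨hτ0, Eventually.of_forall fun k => Ioc_subset_Icc_self (hτm k)⟩)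
  refine (tendsto_iff_norm_sub_tendsto_zero.1 h1).congr fun k => ?_
  exact (nrm_sub_eq_norm_restr hΩ.measurableSet (hm k) (h.mem_velocity 0 h0)).symm

/-! ### The error equation -/

lemma eq_of_restr_eq (hΩ : MeasurableSet Ω) {v w : L2Vec d} (hv : v ∈ velocitySpace Ω α)
    (hw : w ∈ velocitySpace Ω α) (h : restr Ω v = restr Ω w) : v = w := by
  have hs := sub_mem_velocitySpace hv hw
  have h1 := norm_restr_eq hΩ hs.2.2
  rw [map_sub, h, sub_self, norm_zero] at h1
  rw [← sub_eq_zero, ← norm_eq_zero, Lp.norm_def]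
  exact h1.symm

lemma integral_sub_sub_eq_integral_add {X : Type*} [MeasurableSpace X] {μ : Measure X}
    {a b c p q : X → ℝ} (ha : Integrable a μ) (hb : Integrable b μ) (hc : Integrable c μ)
    (hp : Integrable p μ) (hq : Integrable q μ)
    (h : ∀ᵐ x ∂μ, a x - b x - c x = p x + q x) :
    (∫ x, a x ∂μ) - (∫ x, b x ∂μ) - ∫ x, c x ∂μ = (∫ x, p x ∂μ) + ∫ x, q x ∂μ := by
  have e := integral_congr_ae (f := a - b - c) (g := p + q) h
  rwa [integral_sub' (ha.sub hb) hc, integral_sub' ha hb, integral_add' hp hq] at e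

/-- The difference of the convective terms. -/
lemma triForm_sub_triForm (hd : d = 2 ∨ d = 3) (hΩb : Bornology.IsBounded Ω)
    {u₁ u₀ U₁ U₀ : L2Vec d} (hu₁ : u₁ ∈ velocitySpace Ω α) (hu₀ : u₀ ∈ velocitySpace Ω α)
    (hU₁ : U₁ ∈ velocitySpace Ω α) (hU₀ : U₀ ∈ velocitySpace Ω α) (hs : IsSolenoidal U₀) :
    triForm Ω u₁ u₁ (u₁ - U₁ : L2Vec d) - triForm Ω U₀ U₁ (u₁ - U₁ : L2Vec d)
      = tri (⇑u₁ - ⇑u₀) (fun j => partialD j u₁) (u₁ - U₁ : L2Vec d)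
        + tri (u₀ - U₀ : L2Vec d) (fun j => partialD j u₁) (u₁ - U₁ : L2Vec d) := by
  obtain ⟨K, -, hS⟩ := exists_memH1Zero_sobolev hd hΩb
  have h6 : ∀ v : L2Vec d, v ∈ velocitySpace Ω α → MemLp v 6 volume := fun v hv =>
    (hS v _ (Lp.memLp v) (memH1Zero_of_mem hv).memLp_partialD
      (fun j => (partialD_spec hv.2.1 j).2) (by
        filter_upwards [hv.2.2] with x hx hxΩ
        exact hx fun h => hxΩ (Metric.self_subset_cthickening _ h))).1
  have h3 : ∀ v : L2Vec d, v ∈ velocitySpace Ω α → MemLp v 3 volume := fun v hv =>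
    memLp_three (Lp.memLp v) (h6 v hv)
  have he := sub_mem_velocitySpace hu₁ hU₁
  have he₀ := sub_mem_velocitySpace hu₀ hU₀
  have hG := (memH1Zero_of_mem hu₁).memLp_partialD
  -- The error transported by `U₀` and tested with itself contributes zero; subtracting this zero
  -- reduces the claim to an algebraic identity under the integral.
  have hself := tri_self_eq_zero hd hΩb hs (h3 _ hU₀) (memH1Zero_of_mem he)
  rw [triForm_eq_tri he.2.2, triForm_eq_tri he.2.2, ← sub_zero (tri _ _ _ - tri _ _ _), ← hself]
  refine integral_sub_sub_eq_integral_add (integrable_tri (h3 _ hu₁) hG (h6 _ he))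
    (integrable_tri (h3 _ hU₀) (memH1Zero_of_mem hU₁).memLp_partialD (h6 _ he))
    (integrable_tri (h3 _ hU₀) (memH1Zero_of_mem he).memLp_partialD (h6 _ he))
    (integrable_tri ((h3 _ hu₁).sub (h3 _ hu₀)) hG (h6 _ he))
    (integrable_tri (h3 _ he₀) hG (h6 _ he)) ?_
  filter_upwards [Lp.coeFn_sub u₀ U₀, ae_all_iff.2 fun j =>
    hu₁.2.1.partialD_sub_ae hU₁.2.1 (Lp.coeFn_sub u₁ U₁) j] with x h1 h2
  rw [← Finset.sum_sub_distrib, ← Finset.sum_sub_distrib, ← Finset.sum_add_distrib]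
  refine Finset.sum_congr rfl fun j _ => ?_
  rw [h2 j, h1]
  simp only [Pi.sub_apply, PiLp.sub_apply, inner_sub_left]
  ring

lemma divergence_sub_ae {v w : L2Vec d} (hv : v ∈ velocitySpace Ω α)
    (hw : w ∈ velocitySpace Ω α)
    (h1 : ∀ᵐ x ∂(volume.restrict Ω), divergence v x = 0)
    (h2 : ∀ᵐ x ∂(volume.restrict Ω), divergence w x = 0) :
    ∀ᵐ x ∂(volume.restrict Ω), divergence (v - w : L2Vec d) x = 0 := by
  filter_upwards [h1, h2, ae_restrict_of_ae (ae_all_iff.2 fun j =>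
    hv.2.1.partialD_sub_ae hw.2.1 (Lp.coeFn_sub v w) j)] with x h1 h2 h3
  simp only [divergence] at *
  simp only [h3, Pi.sub_apply, PiLp.sub_apply, Finset.sum_sub_distrib, h1, h2, sub_zero]

lemma integral_mul_eq_zero_of_ae {X : Type*} [MeasurableSpace X] {μ : Measure X} {q g : X → ℝ}
    (h : ∀ᵐ x ∂μ, g x = 0) : ∫ x, q x * g x ∂μ = 0 := by
  refine integral_eq_zero_of_ae ?_
  filter_upwards [h] with x hx
  simp [hx]

/-- The energy identity for the error, for one time step. -/
lemma error_energy_identity (hd : d = 2 ∨ d = 3) (hΩb : Bornology.IsBounded Ω) (hα : 0 < α)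
    {u₁ u₀ U₁ U₀ : L2Vec d} (hu₁ : u₁ ∈ velocitySpace Ω α) (hu₀ : u₀ ∈ velocitySpace Ω α)
    (hU₁ : U₁ ∈ velocitySpace Ω α) (hU₀ : U₀ ∈ velocitySpace Ω α) (hs : IsSolenoidal U₀)
    (hdu : ∀ᵐ x ∂(volume.restrict Ω), divergence u₁ x = 0)
    (hdU : ∀ᵐ x ∂(volume.restrict Ω), divergence U₁ x = 0)
    {f₁ u' : L2On Ω (Rd d)} {p P : L2On Ω ℝ} {Δt : ℝ}
    (h1 : ∀ v ∈ velocitySpace Ω α,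
      l2Form Ω u' v + spatialForm Ω α ν γ u₁ u₁ p v = l2Form Ω f₁ v)
    (h2 : ∀ v ∈ velocitySpace Ω α,
      l2Form Ω (Δt⁻¹ • (U₁ - U₀) : L2Vec d) v + spatialForm Ω α ν γ U₀ U₁ P v = l2Form Ω f₁ v) :
    inner ℝ (u' - Δt⁻¹ • (restr Ω U₁ - restr Ω U₀)) (restr Ω (u₁ - U₁))
      + tri (⇑u₁ - ⇑u₀) (fun j => partialD j u₁) (u₁ - U₁ : L2Vec d)
      + tri (u₀ - U₀ : L2Vec d) (fun j => partialD j u₁) (u₁ - U₁ : L2Vec d)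
      + ν * gradNormSq Ω (u₁ - U₁ : L2Vec d)
      + γ * (fracConst d α / 2) * gagliardoSq α (u₁ - U₁ : L2Vec d) = 0 := by
  have he := sub_mem_velocitySpace hu₁ hU₁
  have e1 := h1 _ he
  have e2 := h2 _ he
  -- Both pressures are paired with the divergence of the error, which is zero.
  have hdiv := divergence_sub_ae hu₁ hU₁ hdu hdU
  rw [spatialForm, integral_mul_eq_zero_of_ae hdiv, l2Form_eq_inner] at e1
  rw [spatialForm, integral_mul_eq_zero_of_ae hdiv, l2Form_eq_inner', map_smul, map_sub] at e2
  have e3 := triForm_sub_triForm hd hΩb hu₁ hu₀ hU₁ hU₀ hs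
  have e4 := gradForm_sub (Ω := Ω) hu₁.2.1 hU₁.2.1 he.2.1 (Lp.coeFn_sub u₁ U₁)
  have e5 := gagliardoForm_sub hα hu₁.1 hU₁.1 (Lp.coeFn_sub u₁ U₁)
  rw [inner_sub_left, ← e4, ← e5]
  linarith

end

section
variable {d : ℕ} {Ω : Set (Rd d)} {α ν γ T : ℝ}

/-! ### Real inequalities -/

lemma young_eighth {ν : ℝ} (hν : 0 < ν) (a b : ℝ) : a * b ≤ ν / 8 * b ^ 2 + 2 / ν * a ^ 2 := by
  have h : ν / 8 * b ^ 2 + 2 / ν * a ^ 2 - a * b = (ν * b - 4 * a) ^ 2 / (8 * ν) := by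
    field_simp; ring
  have : 0 ≤ (ν * b - 4 * a) ^ 2 / (8 * ν) := by positivity
  linarith

/-- Here `x` and `s` stand for L² and gradient norms of the error, `om` for consistency, `y` and `m`
for the L³ norms of the exact increment and of the old error. Three Young inequalities each spend
`ν/8` of the new dissipation; interpolating `m` and a fourth one spend `ν/8` at the old level. The
remaining 5/8 splits into 1/2, which is kept, and 1/8, which stays in the energy to pay the
old-level term of the next step. -/
lemma energy_step {ν Δ x₀ x₁ δ s₀ s₁ G om y m K Kp Q : ℝ} (hν : 0 < ν) (hΔ : 0 ≤ Δ)
    (hE : 1 / 2 * x₁ ^ 2 - 1 / 2 * x₀ ^ 2 + 1 / 2 * δ + Δ * ν * s₁ ^ 2 + Δ * G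
      ≤ Δ * (Kp * om * s₁ + Q * y * s₁ + Q * m * s₁)) (hm : m ^ 2 ≤ x₀ * (K * s₀)) :
    1 / 2 * x₁ ^ 2 + 1 / 8 * Δ * ν * s₁ ^ 2 + (1 / 2 * δ + 1 / 2 * Δ * ν * s₁ ^ 2 + Δ * G)
      ≤ 1 / 2 * x₀ ^ 2 + 1 / 8 * Δ * ν * s₀ ^ 2
        + Δ * (2 / ν * Kp ^ 2 * om ^ 2 + 2 / ν * Q ^ 2 * y ^ 2
          + 2 / ν * (2 / ν * Q ^ 2 * K) ^ 2 * x₀ ^ 2) := by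
  have y1 := young_eighth hν (Kp * om) s₁
  have y2 := young_eighth hν (Q * y) s₁
  have y3 := young_eighth hν (Q * m) s₁
  have y4 := young_eighth hν (2 / ν * Q ^ 2 * K * x₀) s₀
  have y5 : 2 / ν * (Q * m) ^ 2 ≤ 2 / ν * Q ^ 2 * K * x₀ * s₀ := by
    have h0 : 0 ≤ 2 / ν * Q ^ 2 := by positivity
    have := mul_le_mul_of_nonneg_left hm h0
    calc _ = 2 / ν * Q ^ 2 * m ^ 2 := by ring
      _ ≤ _ := this
      _ = _ := by ring
  have hsum : Kp * om * s₁ + Q * y * s₁ + Q * m * s₁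
      ≤ 3 * (ν / 8 * s₁ ^ 2) + ν / 8 * s₀ ^ 2 + (2 / ν * Kp ^ 2 * om ^ 2 + 2 / ν * Q ^ 2 * y ^ 2
          + 2 / ν * (2 / ν * Q ^ 2 * K) ^ 2 * x₀ ^ 2) := by
    have e1 : 2 / ν * (Kp * om) ^ 2 = 2 / ν * Kp ^ 2 * om ^ 2 := by ring
    have e2 : 2 / ν * (Q * y) ^ 2 = 2 / ν * Q ^ 2 * y ^ 2 := by ring
    have e3 : 2 / ν * (2 / ν * Q ^ 2 * K * x₀) ^ 2
        = 2 / ν * (2 / ν * Q ^ 2 * K) ^ 2 * x₀ ^ 2 := by ring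
    linarith
  have := mul_le_mul_of_nonneg_left hsum hΔ
  nlinarith

/-- A discrete Grönwall inequality for an explicit recursion. -/
lemma discrete_gronwall {Φ P r : ℕ → ℝ} {c : ℝ} (hc : 0 ≤ c) (hP : ∀ n, 0 ≤ P n)
    (hr : ∀ n, 0 ≤ r n) (h0 : Φ 0 = 0) (N : ℕ)
    (h : ∀ n < N, Φ (n + 1) + P n ≤ (1 + c) * Φ n + r n) :
    Φ N + ∑ n ∈ Finset.range N, P n ≤ Real.exp (c * N) * ∑ n ∈ Finset.range N, r n := by
  induction N with
  | zero => simp [h0]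
  | succ N ih =>
    have ih := ih fun n hn => h n (by omega)
    have hs := h N (by omega)
    rw [Finset.sum_range_succ, Finset.sum_range_succ]
    set S := ∑ n ∈ Finset.range N, P n with hS
    set R := ∑ n ∈ Finset.range N, r n with hR
    have hS0 : 0 ≤ S := Finset.sum_nonneg fun n _ => hP n
    have hR0 : 0 ≤ R := Finset.sum_nonneg fun n _ => hr n
    have e1 : 1 + c ≤ Real.exp c := by linarith [Real.add_one_le_exp c]
    have e2 : Real.exp (c * ((N + 1 : ℕ) : ℝ)) = Real.exp c * Real.exp (c * N) := by
      rw [← Real.exp_add]; congr 1; push_cast; ring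
    have e3 : 1 ≤ Real.exp (c * ((N + 1 : ℕ) : ℝ)) := Real.one_le_exp (by positivity)
    calc Φ (N + 1) + (S + P N) ≤ (1 + c) * Φ N + r N + S := by linarith
      _ ≤ (1 + c) * (Φ N + S) + r N := by nlinarith
      _ ≤ (1 + c) * (Real.exp (c * N) * R) + r N := by gcongr
      _ ≤ Real.exp c * (Real.exp (c * N) * R) + r N := by gcongr
      _ = Real.exp (c * ((N + 1 : ℕ) : ℝ)) * R + r N := by rw [e2]; ring
      _ ≤ Real.exp (c * ((N + 1 : ℕ) : ℝ)) * R + Real.exp (c * ((N + 1 : ℕ) : ℝ)) * r N := by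
          have := le_mul_of_one_le_left (hr N) e3
          linarith
      _ = _ := by ring

/-! ### Sobolev constants on the velocity space -/

/-- The Poincaré constant `Kp` comes from the Sobolev bound and Hölder on the bounded set `Ω`. -/
lemma exists_velocity_sobolev (hd : d = 2 ∨ d = 3) (hΩ : IsOpen Ω)
    (hΩb : Bornology.IsBounded Ω) :
    ∃ K Kp : ℝ, 0 ≤ K ∧ 0 ≤ Kp ∧ ∀ v : Rd d → Rd d, MemH1Zero Ω v → MemLp v 6 volume ∧
      nrm 6 volume v ≤ K * √(gradNormSq Ω v) ∧ nrm 2 volume v ≤ Kp * √(gradNormSq Ω v) := by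
  obtain ⟨K, hK, hS⟩ := exists_memH1Zero_sobolev hd hΩb
  have hA : volume Ω ^ (1 / (2 : ℝ≥0∞).toReal - 1 / (6 : ℝ≥0∞).toReal) ≠ ⊤ :=
    ENNReal.rpow_ne_top_of_nonneg (by norm_num) hΩb.measure_lt_top.ne
  set A := (volume Ω ^ (1 / (2 : ℝ≥0∞).toReal - 1 / (6 : ℝ≥0∞).toReal)).toReal with hAdef
  have hA0 : 0 ≤ A := ENNReal.toReal_nonneg
  refine ⟨K * d, A * (K * d), by positivity, by positivity, fun v hv => ?_⟩
  obtain ⟨h6, hb⟩ := hS v _ hv.memLp hv.memLp_partialD (fun j => (partialD_spec hv.1 j).2) (by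
    filter_upwards [hv.2] with x hx hxΩ
    exact hx fun h => hxΩ (Metric.self_subset_cthickening _ h))
  have hb' : nrm 6 volume v ≤ K * d * √(gradNormSq Ω v) := by
    rw [mul_assoc]
    exact hb.trans (mul_le_mul_of_nonneg_left hv.sum_nrm_partialD_le hK)
  refine ⟨h6, hb', ?_⟩
  have h2 := eLpNorm_le_of_eq_zero_off hΩ.measurableSet hv.2 hv.memLp.1
    (show (2 : ℝ≥0∞) ≤ 6 by norm_num)
  have h3 := ENNReal.toReal_mono (ENNReal.mul_ne_top h6.2.ne hA) h2
  rw [ENNReal.toReal_mul] at h3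
  calc nrm 2 volume v ≤ nrm 6 volume v * A := h3
    _ ≤ (K * d * √(gradNormSq Ω v)) * A := by gcongr
    _ = _ := by ring

/-! ### Time increments of the exact solution -/

/-- Both increments are compared with `Δ` times the derivative at their common node, which cancels.
-/
lemma IsTimeC1H2.norm_second_diff_le {B : Type} [NormedAddCommGroup B] [NormedSpace ℝ B]
    [CompleteSpace B] {U V W : ℝ → B} (hU : IsTimeC1H2 T U V W) {Δ : ℝ} (hΔ : 0 ≤ Δ) (n : ℕ)
    (hn : ((n : ℝ) + 2) * Δ ≤ T) :
    ‖U (((n + 2 : ℕ) : ℝ) * Δ) - U (((n + 1 : ℕ) : ℝ) * Δ)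
        - (U (((n + 1 : ℕ) : ℝ) * Δ) - U ((n : ℝ) * Δ))‖
      ≤ Δ * ((∫ r in (((n + 1 : ℕ) : ℝ) * Δ)..((((n + 1 : ℕ) : ℝ) + 1) * Δ), ‖W r‖)
        + ∫ r in ((n : ℝ) * Δ)..(((n : ℝ) + 1) * Δ), ‖W r‖) := by
  have hn0 : 0 ≤ (n : ℝ) * Δ := by positivity
  have e2 : ((n + 2 : ℕ) : ℝ) * Δ = (((n + 1 : ℕ) : ℝ) + 1) * Δ := by push_cast; ring
  have e1 : (((n : ℝ) + 1) * Δ) = ((n + 1 : ℕ) : ℝ) * Δ := by push_cast; ring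
  have c1 := hU.norm_sub_sub_smul_le (a := ((n + 1 : ℕ) : ℝ) * Δ)
    (b := (((n + 1 : ℕ) : ℝ) + 1) * Δ) (c := ((n + 1 : ℕ) : ℝ) * Δ)
    (by push_cast; linarith) (by linarith) (by push_cast; linarith) ⟨le_rfl, by linarith⟩
  have c0 := hU.norm_sub_sub_smul_le (a := (n : ℝ) * Δ) (b := ((n + 1 : ℕ) : ℝ) * Δ)
    (c := ((n + 1 : ℕ) : ℝ) * Δ) hn0 (by push_cast; linarith) (by push_cast; linarith)
    ⟨by push_cast; linarith, le_rfl⟩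
  have d1 : (((n + 1 : ℕ) : ℝ) + 1) * Δ - ((n + 1 : ℕ) : ℝ) * Δ = Δ := by ring
  have d0 : ((n + 1 : ℕ) : ℝ) * Δ - (n : ℝ) * Δ = Δ := by push_cast; ring
  rw [d1] at c1
  rw [d0] at c0
  have hle := _root_.norm_sub_le
    (U ((((n + 1 : ℕ) : ℝ) + 1) * Δ) - U (((n + 1 : ℕ) : ℝ) * Δ) - Δ • V (((n + 1 : ℕ) : ℝ) * Δ))
    (U (((n + 1 : ℕ) : ℝ) * Δ) - U ((n : ℝ) * Δ) - Δ • V (((n + 1 : ℕ) : ℝ) * Δ))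
  rw [sub_sub_sub_cancel_right] at hle
  rw [e2, e1, mul_add]
  exact hle.trans (add_le_add c1 c0)

lemma IsTimeC1H2.sum_second_diff_le {B : Type} [NormedAddCommGroup B] [NormedSpace ℝ B]
    [CompleteSpace B] {U V W : ℝ → B} (hU : IsTimeC1H2 T U V W) {Δ : ℝ} (hΔ : 0 ≤ Δ) {m : ℕ}
    (hm : ((m : ℝ) + 1) * Δ ≤ T) :
    ∑ n ∈ Finset.range m, ‖U (((n + 2 : ℕ) : ℝ) * Δ) - U (((n + 1 : ℕ) : ℝ) * Δ)
        - (U (((n + 1 : ℕ) : ℝ) * Δ) - U ((n : ℝ) * Δ))‖ ^ 2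
      ≤ 4 * Δ ^ 3 * ∫ r, ‖W r‖ ^ 2 := by
  obtain ⟨om, hom⟩ : ∃ om : ℕ → ℝ,
      ∀ n : ℕ, om n = ∫ r in ((n : ℝ) * Δ)..(((n : ℝ) + 1) * Δ), ‖W r‖ := ⟨_, fun _ => rfl⟩
  have s1 := hU.sum_sq_le hΔ (m + 1)
  have s3 := hU.sum_sq_le hΔ m
  simp only [← hom] at s1 s3
  rw [Finset.sum_range_succ'] at s1
  have h0 := sq_nonneg (om 0)
  have hz : ∀ n ∈ Finset.range m, ‖U (((n + 2 : ℕ) : ℝ) * Δ) - U (((n + 1 : ℕ) : ℝ) * Δ)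
      - (U (((n + 1 : ℕ) : ℝ) * Δ) - U ((n : ℝ) * Δ))‖ ^ 2
      ≤ 2 * Δ ^ 2 * (om (n + 1) ^ 2 + om n ^ 2) := by
    intro n hn
    have hn : (n : ℝ) + 1 ≤ m := by exact_mod_cast Finset.mem_range.1 hn
    have h := hU.norm_second_diff_le hΔ n (le_trans (mul_le_mul_of_nonneg_right (by linarith) hΔ) hm)
    rw [← hom, ← hom] at h
    have h2 := pow_le_pow_left₀ (norm_nonneg _) h 2
    have h3 : Δ ^ 2 * (om (n + 1) + om n) ^ 2 ≤ Δ ^ 2 * (2 * (om (n + 1) ^ 2 + om n ^ 2)) :=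
      mul_le_mul_of_nonneg_left (by linarith [sq_nonneg (om (n + 1) - om n)]) (sq_nonneg Δ)
    rw [mul_pow] at h2
    linarith
  refine (Finset.sum_le_sum hz).trans ?_
  rw [← Finset.mul_sum, Finset.sum_add_distrib]
  have h4 := mul_le_mul_of_nonneg_left (show ∑ n ∈ Finset.range m, om (n + 1) ^ 2
    + ∑ n ∈ Finset.range m, om n ^ 2 ≤ 2 * (Δ * ∫ r, ‖W r‖ ^ 2) by linarith)
    (show 0 ≤ 2 * Δ ^ 2 by positivity)
  linarith

/-- The second differences have squared L² norms summing to order `Δ³`, and there are at most `T/Δ`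
steps; discrete interpolation with the uniform L⁶ bound gives order `Δ`. -/
lemma exists_increment_bound (hd : d = 2 ∨ d = 3) (hΩ : IsOpen Ω) (hΩb : Bornology.IsBounded Ω)
    (hT : 0 < T) {u : ℝ → L2Vec d} (hmem : ∀ t ∈ Icc 0 T, u t ∈ velocitySpace Ω α)
    {V W : ℝ → L2On Ω (Rd d)} (hU : IsTimeC1H2 T (fun t => restr Ω (u t)) V W) {M : ℝ}
    (hM : ∀ t ∈ Icc 0 T, ∀ j, nrm 2 volume (partialD j (u t)) ≤ M) :
    ∃ C : ℝ, 0 ≤ C ∧ ∀ Δ : ℝ, 0 < Δ → ∀ N : ℕ, (N : ℝ) * Δ ≤ T →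
      ∑ n ∈ Finset.range N, nrm 3 volume (⇑(u (((n : ℝ) + 1) * Δ)) - ⇑(u ((n : ℝ) * Δ))) ^ 2
        ≤ C * Δ := by
  obtain ⟨K, Kp, hK, hKp, hS⟩ := exists_velocity_sobolev hd hΩ hΩb
  have hmemH : ∀ t ∈ Icc 0 T, MemH1Zero Ω (u t) := fun t ht => memH1Zero_of_mem (hmem t ht)
  have h6 : ∀ t ∈ Icc 0 T, MemLp (u t) 6 volume := fun t ht => (hS _ (hmemH t ht)).1
  have hg : ∀ t ∈ Icc 0 T, √(gradNormSq Ω (u t)) ≤ √(d * M ^ 2) := by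
    intro t ht
    refine Real.sqrt_le_sqrt ?_
    rw [(hmemH t ht).gradNormSq_eq]
    refine (Finset.sum_le_sum fun j _ => pow_le_pow_left₀ (nrm_nonneg _ _) (hM t ht j) 2).trans ?_
    simp
  set L := K * √(d * M ^ 2) with hLdef
  set L₂ := Kp * √(d * M ^ 2) with hL2def
  have hL0 : 0 ≤ L := by positivity
  have hL20 : 0 ≤ L₂ := by positivity
  have hL : ∀ t ∈ Icc 0 T, nrm 6 volume (u t) ≤ L := fun t ht =>
    (hS _ (hmemH t ht)).2.1.trans (mul_le_mul_of_nonneg_left (hg t ht) hK)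
  have hL2 : ∀ t ∈ Icc 0 T, nrm 2 volume (u t) ≤ L₂ := fun t ht =>
    (hS _ (hmemH t ht)).2.2.trans (mul_le_mul_of_nonneg_left (hg t ht) hKp)
  have hL3 : ∀ t ∈ Icc 0 T, nrm 3 volume (u t) ≤ √(L₂ * L) := by
    intro t ht
    refine Real.le_sqrt_of_sq_le ((nrm_three_sq_le (Lp.memLp _) (h6 t ht)
      (memLp_three (Lp.memLp _) (h6 t ht))).trans ?_)
    exact mul_le_mul (hL2 t ht) (hL t ht) (nrm_nonneg _ _) hL20
  set Q := ∫ r, ‖W r‖ ^ 2 with hQ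
  have hQ0 : 0 ≤ Q := integral_nonneg fun _ => by positivity
  refine ⟨2 * (16 * L * √(T * Q)) + 16 * (L₂ * L) / T, by positivity, fun Δ hΔ N hN => ?_⟩
  rcases Nat.eq_zero_or_pos N with rfl | hNpos
  · simp only [Finset.range_zero, Finset.sum_empty]
    positivity
  -- The grid is extended to the largest one fitting in `[0, T]`. Its length is at least `T/2`, so
  -- the chord term, of order `1/(m+1)`, is of order `Δ` even when `N` is small.
  set N' := ⌊T / Δ⌋₊ with hN'
  have hNN' : N ≤ N' := Nat.le_floor ((le_div_iff₀ hΔ).2 hN)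
  obtain ⟨m, hm⟩ : ∃ m, N' = m + 1 := ⟨N' - 1, by omega⟩
  have hmT : ((m : ℝ) + 1) * Δ ≤ T := by
    have := Nat.floor_le (show 0 ≤ T / Δ by positivity)
    rw [← hN', hm] at this
    push_cast at this
    exact (le_div_iff₀ hΔ).1 this
  have hmT2 : T ≤ 2 * ((m : ℝ) + 1) * Δ := by
    have := Nat.lt_floor_add_one (T / Δ)
    rw [← hN', hm, div_lt_iff₀ hΔ] at this
    push_cast at this
    nlinarith
  have htn : ∀ n ≤ m + 1, (n : ℝ) * Δ ∈ Icc 0 T := by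
    intro n hn
    have : (n : ℝ) ≤ m + 1 := by exact_mod_cast hn
    exact ⟨by positivity, (mul_le_mul_of_nonneg_right this hΔ.le).trans hmT⟩
  have key := sum_nrm_three_sq_le (μ := volume) (fun n : ℕ => (⇑(u ((n : ℝ) * Δ)) : Rd d → Rd d)) m
    (fun n _ => Lp.memLp _) (fun n hn => h6 _ (htn n hn)) (fun n hn => hL _ (htn n hn))
    (fun n hn => hL3 _ (htn n hn))
  have hZ : ∑ n ∈ Finset.range m, nrm 2 volume
      (⇑(u (((n + 2 : ℕ) : ℝ) * Δ)) - ⇑(u (((n + 1 : ℕ) : ℝ) * Δ))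
        - (⇑(u (((n + 1 : ℕ) : ℝ) * Δ)) - ⇑(u ((n : ℝ) * Δ)))) ^ 2 ≤ 4 * Δ ^ 3 * Q := by
    refine le_of_eq_of_le (Finset.sum_congr rfl fun n hn => ?_) (hU.sum_second_diff_le hΔ.le hmT)
    have hn := Finset.mem_range.1 hn
    have t0 := hmem _ (htn n (by omega))
    have t1 := hmem _ (htn (n + 1) (by omega))
    have t2 := hmem _ (htn (n + 2) (by omega))
    rw [← map_sub, ← map_sub, ← nrm_sub_eq_norm_restr hΩ.measurableSet
      (sub_mem_velocitySpace t2 t1) (sub_mem_velocitySpace t1 t0)]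
    congr 1
    exact nrm_congr ((Lp.coeFn_sub _ _).symm.sub (Lp.coeFn_sub _ _).symm)
  have hfin : ∑ n ∈ Finset.range N,
      nrm 3 volume (⇑(u (((n : ℝ) + 1) * Δ)) - ⇑(u ((n : ℝ) * Δ))) ^ 2
      ≤ ∑ n ∈ Finset.range (m + 1),
        nrm 3 volume (⇑(u (((n + 1 : ℕ) : ℝ) * Δ)) - ⇑(u ((n : ℝ) * Δ))) ^ 2 := by
    push_cast
    exact Finset.sum_le_sum_of_subset_of_nonneg
      (Finset.range_subset_range.2 (by omega)) fun _ _ _ => by positivity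
  refine hfin.trans (key.trans ?_)
  have hsqrt : √(4 * ((m : ℝ) + 1) * (4 * L) ^ 2 * ∑ n ∈ Finset.range m, nrm 2 volume
      (⇑(u (((n + 2 : ℕ) : ℝ) * Δ)) - ⇑(u (((n + 1 : ℕ) : ℝ) * Δ))
        - (⇑(u (((n + 1 : ℕ) : ℝ) * Δ)) - ⇑(u ((n : ℝ) * Δ)))) ^ 2)
      ≤ 16 * L * √(T * Q) * Δ := by
    refine Real.sqrt_le_iff.2 ⟨by positivity, ?_⟩
    calc _ ≤ 4 * ((m : ℝ) + 1) * (4 * L) ^ 2 * (4 * Δ ^ 3 * Q) := by gcongr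
      _ = 256 * L ^ 2 * Q * Δ ^ 2 * (((m : ℝ) + 1) * Δ) := by ring
      _ ≤ 256 * L ^ 2 * Q * Δ ^ 2 * T := by gcongr
      _ = _ := by
        have h := Real.sq_sqrt (show 0 ≤ T * Q by positivity)
        linear_combination -(256 * L ^ 2 * Δ ^ 2) * h
  have hlast : 8 * √(L₂ * L) ^ 2 / ((m : ℝ) + 1) ≤ 16 * (L₂ * L) / T * Δ := by
    rw [Real.sq_sqrt (by positivity), div_mul_eq_mul_div, div_le_div_iff₀ (by positivity) hT]
    have : 0 ≤ L₂ * L := by positivity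
    nlinarith
  calc _ ≤ 2 * (16 * L * √(T * Q) * Δ) + 16 * (L₂ * L) / T * Δ :=
        add_le_add (mul_le_mul_of_nonneg_left hsqrt (by norm_num)) hlast
    _ = _ := by ring

end

section
variable {d : ℕ} {Ω : Set (Rd d)} {α ν γ T : ℝ}

/-! ### The error estimate -/

set_option maxHeartbeats 1000000 in
/-- The energy estimate for one step of the scheme. -/
lemma error_step (hd : d = 2 ∨ d = 3) (hΩ : MeasurableSet Ω) (hΩb : Bornology.IsBounded Ω)
    (hα : 0 < α) (hν : 0 < ν) {K Kp M om Δt : ℝ} (hΔ : 0 < Δt)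
    (hS : ∀ v : Rd d → Rd d, MemH1Zero Ω v → MemLp v 6 volume ∧
      nrm 6 volume v ≤ K * √(gradNormSq Ω v) ∧ nrm 2 volume v ≤ Kp * √(gradNormSq Ω v))
    {u₁ u₀ U₁ U₀ : L2Vec d} (hu₁ : u₁ ∈ velocitySpace Ω α) (hu₀ : u₀ ∈ velocitySpace Ω α)
    (hU₁ : U₁ ∈ velocitySpace Ω α) (hU₀ : U₀ ∈ velocitySpace Ω α) (hs : IsSolenoidal U₀)
    (hdu : ∀ᵐ x ∂(volume.restrict Ω), divergence u₁ x = 0)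
    (hdU : ∀ᵐ x ∂(volume.restrict Ω), divergence U₁ x = 0)
    {f₁ u' : L2On Ω (Rd d)} {p P : L2On Ω ℝ}
    (h1 : ∀ v ∈ velocitySpace Ω α,
      l2Form Ω u' v + spatialForm Ω α ν γ u₁ u₁ p v = l2Form Ω f₁ v)
    (h2 : ∀ v ∈ velocitySpace Ω α,
      l2Form Ω (Δt⁻¹ • (U₁ - U₀) : L2Vec d) v + spatialForm Ω α ν γ U₀ U₁ P v = l2Form Ω f₁ v)
    (hM : ∀ j, nrm 2 volume (partialD j u₁) ≤ M)
    (hom : ‖restr Ω u₁ - restr Ω u₀ - Δt • u'‖ ≤ Δt * om) :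
    1 / 2 * l2NormSq Ω (u₁ - U₁ : L2Vec d) + 1 / 8 * Δt * ν * gradNormSq Ω (u₁ - U₁ : L2Vec d)
      + (1 / 2 * l2NormSq Ω (u₁ - U₁ - (u₀ - U₀) : L2Vec d)
        + 1 / 2 * Δt * ν * gradNormSq Ω (u₁ - U₁ : L2Vec d)
        + Δt * (γ * (fracConst d α / 2) * gagliardoSq α (u₁ - U₁ : L2Vec d)))
    ≤ 1 / 2 * l2NormSq Ω (u₀ - U₀ : L2Vec d) + 1 / 8 * Δt * ν * gradNormSq Ω (u₀ - U₀ : L2Vec d)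
      + Δt * (2 / ν * Kp ^ 2 * om ^ 2
        + 2 / ν * (d * M * K) ^ 2 * nrm 3 volume (⇑u₁ - ⇑u₀) ^ 2
        + 2 / ν * (2 / ν * (d * M * K) ^ 2 * K) ^ 2 * l2NormSq Ω (u₀ - U₀ : L2Vec d)) := by
  have key := error_energy_identity hd hΩb hα hu₁ hu₀ hU₁ hU₀ hs hdu hdU h1 h2
  have he₁ := sub_mem_velocitySpace hu₁ hU₁
  have he₀ := sub_mem_velocitySpace hu₀ hU₀
  obtain ⟨e16, e16b, e12⟩ := hS _ (memH1Zero_of_mem he₁)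
  obtain ⟨e06, e06b, -⟩ := hS _ (memH1Zero_of_mem he₀)
  have hpd : ∀ j, MemLp (partialD j u₁) 2 volume := (memH1Zero_of_mem hu₁).memLp_partialD
  have hsum : ∑ j, nrm 2 volume (partialD j u₁) ≤ d * M :=
    (Finset.sum_le_sum fun j _ => hM j).trans (by simp)
  have h3u : MemLp (⇑u₁ - ⇑u₀) 3 volume :=
    (memLp_three (Lp.memLp _) (hS _ (memH1Zero_of_mem hu₁)).1).sub
      (memLp_three (Lp.memLp _) (hS _ (memH1Zero_of_mem hu₀)).1)
  have h3e := memLp_three (Lp.memLp _) e06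
  have tri_le : ∀ w : Rd d → Rd d, MemLp w 3 volume →
      |tri w (fun j => partialD j u₁) (u₁ - U₁ : L2Vec d)|
        ≤ d * M * K * nrm 3 volume w * √(gradNormSq Ω (u₁ - U₁ : L2Vec d)) := by
    intro w hw
    refine (abs_tri_le hw hpd e16).trans ?_
    have hS0 : 0 ≤ ∑ j, nrm 2 volume (partialD j u₁) :=
      Finset.sum_nonneg fun j _ => nrm_nonneg _ _
    calc _ ≤ nrm 3 volume w * (d * M) * (K * √(gradNormSq Ω (u₁ - U₁ : L2Vec d))) :=
          mul_le_mul (mul_le_mul_of_nonneg_left hsum (nrm_nonneg _ _)) e16b (nrm_nonneg _ _)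
            (mul_nonneg (nrm_nonneg _ _) (hS0.trans hsum))
      _ = _ := by ring
  have b1 := tri_le _ h3u
  have b2 := tri_le _ h3e
  rw [l2NormSq_eq, l2NormSq_eq, l2NormSq_eq, map_sub (restr Ω) (u₁ - U₁)]
  have hn1 : ‖restr Ω (u₁ - U₁)‖ ≤ Kp * √(gradNormSq Ω (u₁ - U₁ : L2Vec d)) := by
    rw [norm_restr_eq hΩ he₁.2.2]
    exact e12
  have hm : nrm 3 volume (u₀ - U₀ : L2Vec d) ^ 2 ≤ ‖restr Ω (u₀ - U₀)‖
      * (K * √(gradNormSq Ω (u₀ - U₀ : L2Vec d))) := by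
    refine (nrm_three_sq_le (Lp.memLp _) e06 h3e).trans ?_
    rw [norm_restr_eq hΩ he₀.2.2]
    exact mul_le_mul_of_nonneg_left e06b (nrm_nonneg _ _)
  -- The exact derivative is replaced by the exact difference quotient, at the price of the
  -- consistency error.
  have hinner : Δt * inner ℝ (u' - Δt⁻¹ • (restr Ω U₁ - restr Ω U₀)) (restr Ω (u₁ - U₁))
      = inner ℝ (restr Ω (u₁ - U₁) - restr Ω (u₀ - U₀)) (restr Ω (u₁ - U₁))
        - inner ℝ (restr Ω u₁ - restr Ω u₀ - Δt • u') (restr Ω (u₁ - U₁)) := by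
    rw [← inner_sub_left, ← real_inner_smul_left, smul_sub, smul_inv_smul₀ hΔ.ne', map_sub,
      map_sub]
    congr 1
    abel
  have hpol : inner ℝ (restr Ω (u₁ - U₁) - restr Ω (u₀ - U₀)) (restr Ω (u₁ - U₁))
      = 1 / 2 * ‖restr Ω (u₁ - U₁)‖ ^ 2 - 1 / 2 * ‖restr Ω (u₀ - U₀)‖ ^ 2
        + 1 / 2 * ‖restr Ω (u₁ - U₁) - restr Ω (u₀ - U₀)‖ ^ 2 := by
    rw [norm_sub_sq_real, inner_sub_left, real_inner_self_eq_norm_sq, real_inner_comm]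
    ring
  have hR : inner ℝ (restr Ω u₁ - restr Ω u₀ - Δt • u') (restr Ω (u₁ - U₁))
      ≤ Δt * (Kp * om * √(gradNormSq Ω (u₁ - U₁ : L2Vec d))) := by
    refine (real_inner_le_norm _ _).trans ?_
    calc _ ≤ (Δt * om) * (Kp * √(gradNormSq Ω (u₁ - U₁ : L2Vec d))) :=
          mul_le_mul hom hn1 (norm_nonneg _) ((norm_nonneg _).trans hom)
      _ = _ := by ring
  have hg₁ := Real.sq_sqrt (gradNormSq_nonneg (Ω := Ω) (u₁ - U₁ : L2Vec d))
  have hg₀ := Real.sq_sqrt (gradNormSq_nonneg (Ω := Ω) (u₀ - U₀ : L2Vec d))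
  have hk := congrArg (fun z => Δt * z) key
  simp only [mul_add, mul_zero] at hk
  rw [hinner, hpol] at hk
  have c1 := mul_le_mul_of_nonneg_left ((neg_le_abs _).trans b1) hΔ.le
  have c2 := mul_le_mul_of_nonneg_left ((neg_le_abs _).trans b2) hΔ.le
  generalize gagliardoSq α (u₁ - U₁ : L2Vec d) = G at hk ⊢
  generalize √(gradNormSq Ω (u₁ - U₁ : L2Vec d)) = s₁ at *
  generalize √(gradNormSq Ω (u₀ - U₀ : L2Vec d)) = s₀ at *
  rw [← hg₁] at hk
  rw [← hg₁, ← hg₀]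
  refine energy_step hν hΔ.le ?_ hm
  linarith

/-- Grönwall starts from zero energy, and even for the zero field `partialD` is known only up to
null sets. -/
lemma gradNormSq_zero : gradNormSq Ω (0 : L2Vec d) = 0 := by
  have h : ∀ j, partialD j (0 : L2Vec d) =ᵐ[volume] (0 : Rd d → Rd d) := fun j =>
    partialD_ae_eq MemLp.zero (by
      intro φ _ _ _
      have : ∀ᵐ x ∂volume.restrict univ, fderiv ℝ φ x (EuclideanSpace.single j 1)
          • (0 : L2Vec d) x = 0 := by
        rw [Measure.restrict_univ]
        filter_upwards [Lp.coeFn_zero (Rd d) 2 (volume : Measure (Rd d))] with x hx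
        rw [hx]
        simp
      rw [integral_congr_ae this]
      simp)
  rw [gradNormSq, integral_congr_ae (g := fun _ => (0 : ℝ))]
  · simp
  · refine ae_restrict_of_ae ?_
    filter_upwards [ae_all_iff.2 h] with x hx
    exact Finset.sum_eq_zero fun j _ => by rw [hx j]; simp

theorem exists_error_bound (hd : d = 2 ∨ d = 3)
    (hΩ : IsOpen Ω) (hΩb : Bornology.IsBounded Ω)
    (hα : α ∈ Ioo (0 : ℝ) 1) (hν : 0 < ν) (hγ : 0 ≤ γ) (hT : 0 < T)
    {f : ℝ → L2On Ω (Rd d)} {u₀ : L2On Ω (Rd d)} {u : ℝ → L2Vec d} {p : ℝ → L2On Ω ℝ}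
    (hsol : IsExactSolution Ω α ν γ T f u₀ u p)
    (hu1 : MemTimeLqH1 Ω T ⊤ (fun t => restr Ω (u t)))
    (hu2 : MemTimeHk T 2 (fun t => restr Ω (u t))) :
    ∃ C : ℝ, 0 < C ∧
      ∀ Δt : ℝ, 0 < Δt → ∀ N : ℕ, (N : ℝ) * Δt ≤ T →
      ∀ (U : ℕ → L2Vec d) (P : ℕ → L2On Ω ℝ), IsIMEXEuler Ω α ν γ Δt f u₀ N U P →
        1 / 2 * l2NormSq Ω (err u U Δt N) + 1 / 8 * Δt * ν * gradNormSq Ω (err u U Δt N)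
          + ∑ n ∈ Finset.range N,
            (1 / 2 * l2NormSq Ω (err u U Δt (n + 1) - err u U Δt n : L2Vec d)
              + 1 / 2 * Δt * ν * gradNormSq Ω (err u U Δt (n + 1))
              + Δt * (γ * (fracConst d α / 2) * gagliardoSq α (err u U Δt (n + 1))))
        ≤ C * Δt ^ 2 := by
  obtain ⟨V, W, hVW⟩ := exists_isTimeC1H2 hT hsol.continuous hu2
  obtain ⟨M, hM0, hM⟩ := exists_gradient_bound hΩ hT hsol.mem_velocity hsol.continuous hu1
  obtain ⟨K, Kp, hK, hKp, hS⟩ := exists_velocity_sobolev hd hΩ hΩb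
  obtain ⟨D, hD0, hD⟩ := exists_increment_bound hd hΩ hΩb hT hsol.mem_velocity hVW hM
  set c := 2 / ν * (2 / ν * (d * M * K) ^ 2 * K) ^ 2 with hc
  have hc0 : 0 ≤ c := by positivity
  set B := 2 / ν * Kp ^ 2 * (∫ r, ‖W r‖ ^ 2) + 2 / ν * (d * M * K) ^ 2 * D with hB
  have hW0 : 0 ≤ ∫ r, ‖W r‖ ^ 2 := integral_nonneg fun _ => by positivity
  have hB0 : 0 ≤ B := by positivity
  -- The summand one only ensures that the constant is positive.
  refine ⟨Real.exp (2 * c * T) * B + 1, by positivity, fun Δt hΔ N hN U P hU => ?_⟩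
  have hmem : ∀ n ≤ N, (n : ℝ) * Δt ∈ Icc 0 T := fun n hn =>
    ⟨by positivity, (mul_le_mul_of_nonneg_right (by exact_mod_cast hn) hΔ.le).trans hN⟩
  have h00 : (0 : ℝ) ∈ Icc 0 T := ⟨le_rfl, hT.le⟩
  have hU0 : U 0 = u 0 := eq_of_restr_eq hΩ.measurableSet (hU.mem_velocity 0 (Nat.zero_le _))
    (hsol.mem_velocity 0 h00) (hU.initial.trans hsol.initial.symm)
  have hsolen : ∀ n ≤ N, IsSolenoidal (U n) := by
    intro n hn
    rcases n with _ | n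
    · rw [hU0]
      exact hsol.isSolenoidal hΩ hT
    · exact (memH1Zero_of_mem (hU.mem_velocity _ hn)).isSolenoidal hΩ.measurableSet
        (hU.incompressible n hn)
  have hl0 : ∀ v : L2Vec d, 0 ≤ l2NormSq Ω v := fun v => by rw [l2NormSq_eq]; positivity
  have hgag : ∀ v : L2Vec d, 0 ≤ γ * (fracConst d α / 2) * gagliardoSq α v := fun v =>
    mul_nonneg (mul_nonneg hγ (by have := fracConst_nonneg (d := d) hα; positivity))
      (gagliardoSq_nonneg _)
  have herr0 : err u U Δt 0 = 0 := by simp [err, hU0]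
  obtain ⟨om, hom⟩ : ∃ om : ℕ → ℝ,
      ∀ n : ℕ, om n = ∫ r in ((n : ℝ) * Δt)..(((n : ℝ) + 1) * Δt), ‖W r‖ := ⟨_, fun _ => rfl⟩
  -- The factor two appears because the energy contains only half of the squared L² norm.
  have hG := discrete_gronwall (c := 2 * c * Δt)
    (Φ := fun n => 1 / 2 * l2NormSq Ω (err u U Δt n)
      + 1 / 8 * Δt * ν * gradNormSq Ω (err u U Δt n))
    (P := fun n => 1 / 2 * l2NormSq Ω (err u U Δt (n + 1) - err u U Δt n : L2Vec d)
      + 1 / 2 * Δt * ν * gradNormSq Ω (err u U Δt (n + 1))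
      + Δt * (γ * (fracConst d α / 2) * gagliardoSq α (err u U Δt (n + 1))))
    (r := fun n => Δt * (2 / ν * Kp ^ 2 * om n ^ 2 + 2 / ν * (d * M * K) ^ 2
      * nrm 3 volume (⇑(u (((n : ℝ) + 1) * Δt)) - ⇑(u ((n : ℝ) * Δt))) ^ 2))
    (by positivity)
    (fun n => by
      have h1 := hl0 (err u U Δt (n + 1) - err u U Δt n)
      have h2 := gradNormSq_nonneg (Ω := Ω) (err u U Δt (n + 1))
      have h3 := hgag (err u U Δt (n + 1))
      positivity)
    (fun n => by positivity)
    (by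
      rw [herr0, gradNormSq_zero, l2NormSq_eq, map_zero]
      simp) N ?_
  · refine hG.trans ?_
    have e1 : 2 * c * Δt * N ≤ 2 * c * T := by
      calc _ = 2 * c * (N * Δt) := by ring
        _ ≤ _ := by gcongr
    have e2 : ∑ n ∈ Finset.range N, Δt * (2 / ν * Kp ^ 2 * om n ^ 2 + 2 / ν * (d * M * K) ^ 2
        * nrm 3 volume (⇑(u (((n : ℝ) + 1) * Δt)) - ⇑(u ((n : ℝ) * Δt))) ^ 2) ≤ B * Δt ^ 2 := by
      have s1 := hVW.sum_sq_le hΔ.le N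
      simp only [← hom] at s1
      rw [← Finset.mul_sum, Finset.sum_add_distrib, ← Finset.mul_sum, ← Finset.mul_sum]
      calc _ ≤ Δt * (2 / ν * Kp ^ 2 * (Δt * ∫ r, ‖W r‖ ^ 2)
            + 2 / ν * (d * M * K) ^ 2 * (D * Δt)) := by
            gcongr
            exact hD Δt hΔ N hN
        _ = _ := by rw [hB]; ring
    calc _ ≤ Real.exp (2 * c * T) * (B * Δt ^ 2) :=
          mul_le_mul (Real.exp_le_exp.2 e1) e2
            (Finset.sum_nonneg fun n _ => by positivity) (Real.exp_pos _).le
      _ ≤ _ := by nlinarith [sq_nonneg Δt]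
  · intro n hn
    have t0 := hmem n hn.le
    have t1 := hmem (n + 1) hn
    push_cast at t1
    have t1' : ((n : ℝ) + 1) * Δt ∈ Ioc 0 T := ⟨by positivity, t1.2⟩
    obtain ⟨u', hu', hmom⟩ := hsol.momentum _ t1'
    -- The derivative in the momentum equation and the one built from weak derivatives agree by
    -- uniqueness within `[0, T]`, which also covers the one-sided case at `T`.
    have hu'V : u' = V (((n : ℝ) + 1) * Δt) :=
      (uniqueDiffOn_Icc hT _ t1).eq_deriv _ hu' (hVW.hasDerivWithinAt t1)
    have hcons := hVW.norm_sub_sub_smul_le (a := (n : ℝ) * Δt) (b := ((n : ℝ) + 1) * Δt)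
      (c := ((n : ℝ) + 1) * Δt) t0.1 (by linarith) t1.2 ⟨by linarith, le_rfl⟩
    rw [← hu'V, ← hom, show ((n : ℝ) + 1) * Δt - n * Δt = Δt by ring] at hcons
    have hstep := error_step hd hΩ.measurableSet hΩb hα.1 hν hΔ hS (hsol.mem_velocity _ t1)
      (hsol.mem_velocity _ t0) (hU.mem_velocity (n + 1) hn) (hU.mem_velocity n hn.le)
      (hsolen n hn.le) (hsol.incompressible _ t1') (hU.incompressible n hn) hmom
      (hU.momentum n hn) (hM _ t1) hcons
    have e1 : err u U Δt (n + 1) = u (((n : ℝ) + 1) * Δt) - U (n + 1) := by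
      rw [err]; push_cast; rfl
    have e0 : err u U Δt n = u ((n : ℝ) * Δt) - U n := rfl
    rw [← e1, ← e0, ← hc] at hstep
    have hg0 := gradNormSq_nonneg (Ω := Ω) (err u U Δt n)
    have hx : 0 ≤ 2 * c * Δt * (1 / 8 * Δt * ν * gradNormSq Ω (err u U Δt n)) := by positivity
    linarith

end

end FracNS

end

theorem mainTheorem8 (d : ℕ) (hd : d = 2 ∨ d = 3)
    (Ω : Set (FracNS.Rd d)) (hΩ : IsOpen Ω) (hΩb : Bornology.IsBounded Ω)
    (α ν γ T : ℝ) (hα : α ∈ Ioo (0 : ℝ) 1) (hν : 0 < ν) (hγ : 0 ≤ γ) (hT : 0 < T)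
    (f : ℝ → FracNS.L2On Ω (FracNS.Rd d)) (u₀ : FracNS.L2On Ω (FracNS.Rd d))
    (u : ℝ → FracNS.L2Vec d) (p : ℝ → FracNS.L2On Ω ℝ)
    (hsol : FracNS.IsExactSolution Ω α ν γ T f u₀ u p)
    (hu1 : FracNS.MemTimeLqH1 Ω T ⊤ (fun t => FracNS.restr Ω (u t)))
    (hu2 : FracNS.MemTimeHk T 2 (fun t => FracNS.restr Ω (u t)))
    (hp : FracNS.MemTimeLqH1 Ω T 2 p)
    (hf : MemLp f 2 (volume.restrict (Ioo 0 T))) :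
    ∃ C : ℝ, 0 < C ∧
      ∀ Δt : ℝ, 0 < Δt → ∀ N : ℕ, (N : ℝ) * Δt ≤ T →
      ∀ (U : ℕ → FracNS.L2Vec d) (P : ℕ → FracNS.L2On Ω ℝ),
        FracNS.IsIMEXEuler Ω α ν γ Δt f u₀ N U P →
        1 / 2 * FracNS.l2NormSq Ω (FracNS.err u U Δt N)
          + 1 / 8 * Δt * ν * FracNS.gradNormSq Ω (FracNS.err u U Δt N)
          + 1 / 2 * ∑ n ∈ Finset.range N,
              FracNS.l2NormSq Ω (FracNS.err u U Δt (n + 1) - FracNS.err u U Δt n : FracNS.L2Vec d)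
          + 1 / 2 * Δt * ∑ n ∈ Finset.range N,
              ν * FracNS.gradNormSq Ω (FracNS.err u U Δt (n + 1))
          + Δt * ∑ n ∈ Finset.range N,
              γ * (FracNS.fracConst d α / 2) * FracNS.gagliardoSq α (FracNS.err u U Δt (n + 1))
        ≤ C * Δt ^ 2 := by
  obtain ⟨C, hC, h⟩ := FracNS.exists_error_bound hd hΩ hΩb hα hν hγ hT hsol hu1 hu2
  refine ⟨C, hC, fun Δt hΔ N hN U P hU => le_of_eq_of_le ?_ (h Δt hΔ N hN U P hU)⟩
  simp only [Finset.sum_add_distrib, Finset.mul_sum, mul_assoc]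
  ring
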